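/- **Setting.** Let $\mathcal A=\mathbb Q[u_0,u_1,u_2,\dots]$ with $\deg u_i=i$, and let $\partial$ be the derivation of $\mathcal A$ with $\partial u_i=u_{i+1}$. The KdV derivations $(D_k)_{k\ge0}$ are the unique derivations of $\mathcal A$ that commute with $\partial$ and with $D_1$ and satisfy $D_0=\partial$, $D_1u_0=u_0u_1+\frac1{12}u_3$, and $D_ku_0-\frac{u_0^k}{k!}u_1\in\mathcal A^{\ge2}$ (all monomials of degree $\ge 2$). The canonical tau-structure is the unique family $\Omega_{p,q}\in\mathcal A$ $(p,q\ge0)$ with $\Omega_{0,0}=u_0$, $\Omega_{p,q}=\Omega_{q,p}$, $D_r\Omega_{p,q}=D_q\Omega_{p,r}$, and $\Omega_{p,q}=0$ when all $u_i=0$; for $n\ge3$ put $\Omega_{p_1,\dots,p_n}=D_{p_1}\cdots D_{p_{n-2}}\Omega_{p_{n-1},p_n}$. For $C\in\mathbb C$ let $u_{\Theta(C)}\in\mathbb C[[t_0,t_1,\dots]]$, with $t_0=x$, be the solution of the KdV hierarchy $\partial u/\partial t_k=D_k(u_0)|_{u_i=\partial_x^iu}$ $(k\ge 0)$ with $u(x,0,0,\dots)=C/(x-1)^2$.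 For $n\ge2$ let $\Omega^{\Theta(C)}_{p_1,\dots,p_n}(\mathbf 0)$ be the value at $\mathbf t=0$ of $\Omega_{p_1,\dots,p_n}|_{u_i=\partial_x^iu_{\Theta(C)}}$. Let $\log\tau\in\mathbb C[[t_0,t_1,\dots]]$ satisfy $\partial_{t_p}\partial_{t_q}\log\tau=\Omega_{p,q}|_{u_i=\partial_x^iu_{\Theta(C)}}$ and $\sum_{i\ge0}(1+2i)\,t_i\,\partial_{t_i}\log\tau+C=\partial_{t_0}\log\tau$, and put $\Omega^{\Theta(C)}_p(\mathbf 0)=(\partial_{t_p}\log\tau)(\mathbf 0)$. For $f\in\mathbb C[[x]]$, a pair of wave functions of $f$ is a pair $\psi=(1+\sum_{m\ge1}\phi_m(x)z^{-m})e^{xz}$, $\psi^*=(1+\sum_{m\ge1}\phi^*_m(x)z^{-m})e^{-xz}$ with $\phi_m,\phi_m^*\in\mathbb C[[x]]$, such that $\psi$ and $\psi^*$ both satisfy $(\partial_x^2+2f)y=z^2y$, and $\partial_x^i(\psi)\,\psi^*$ has residue $0$ at $z=\infty$ for all $i\ge0$. **Theorem.** Let $C,\alpha\in\mathbb C$ with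 $\alpha^2=\frac14-2C$, let $(s)_m=s(s+1)\cdots(s+m-1)$, and for $k\ge0$ put $a_k(\alpha)=\frac{(\alpha-k+\frac12)_{2k}}{2^k\,k!}$. Then $a_k(\alpha)\in\mathbb Q[\alpha^2]=\mathbb Q[C]$ and $$a_k(\alpha)=\frac{(-1)^k}{k!}\prod_{j=1}^k\Bigl(C+\binom j2\Bigr)\quad(k\ge0),\qquad a_k(\alpha)=(-1)^k(2k-1)\,\Omega^{\Theta(C)}_{k-1}(\mathbf 0)\quad(k\ge1).$$ The two functions $$\psi(z,x)=\sum_{k\ge0}\frac{a_k(\alpha)}{z^k(1-x)^k}\,e^{zx},\qquad\psi^*(z,x)=\psi(-z,x)$$ form a pair of wave functions of $f=C/(x-1)^2$. The series $u_{\Theta(C)}$ and $\log\tau$, and the $D_k$ and $\Omega_{p,q}$ above, exist. Moreover, with $$D_{\Theta(C)}(z,w)=\left.\frac{\psi(z,x)\,\psi^*_x(w,x)-\psi^*(w,x)\,\psi_x(z,x)}{w^2-z^2}\right|_{x=0},$$ for every $n\ge2$ one has $$\sum_{p_1,\dots,p_n\ge0}\Omega^{\Theta(C)}_{p_1,\dots,p_n}(\mathbf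 0)\prod_{j=1}^n\frac{(2p_j+1)!!}{z_j^{2p_j+2}}=(-1)^{n-1}\sum_{\sigma\in S_n/C_n}\ \prod_{i=1}^nD_{\Theta(C)}\bigl(z_{\sigma(i)},z_{\sigma(i+1)}\bigr)-\frac{\delta_{n,2}}{(z_1-z_2)^2},$$ where $C_n$ is the cyclic group generated by $i\mapsto i+1$ and $\sigma(n+1)=\sigma(1)$. This is an identity in the field of fractions of $\mathbb C[[z_1^{-1},\dots,z_n^{-1}]]$. -/

import Mathlib

open scoped Nat

noncomputable section

namespace KdV

/-! ### Differential polynomials, the KdV derivations and the canonical tau-structure -/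

/-- The algebra `ℚ[u₀, u₁, u₂, …]` of differential polynomials. -/
abbrev DiffPoly : Type := MvPolynomial ℕ ℚ

/-- The variable `uᵢ`. -/
def u (i : ℕ) : DiffPoly := MvPolynomial.X i

/-- The derivation `∂` of the algebra of differential polynomials with `∂ uᵢ = uᵢ₊₁`. -/
def del : Derivation ℚ DiffPoly DiffPoly :=
  MvPolynomial.mkDerivation ℚ (fun i => u (i + 1))

/-- All monomials of `P` have degree at least `d`, where `deg uᵢ = i`. -/
def DegreeGE (d : ℕ) (P : DiffPoly) : Prop :=
  ∀ m ∈ P.support, d ≤ m.sum (fun i e => e * i)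

/-- The (unique) family of KdV derivations `D₀, D₁, D₂, …`: each commutes with `∂` and with `D₁`,
`D₀ = ∂`, `D₁ u₀ = u₀ u₁ + u₃ / 12`, and `Dₖ u₀ = u₀ᵏ u₁ / k! + Qₖ` where all the monomials of
`Qₖ` have degree at least two. -/
structure IsKdVDerivations (D : ℕ → Derivation ℚ DiffPoly DiffPoly) : Prop where
  zero : D 0 = del
  one : D 1 (u 0) = u 0 * u 1 + MvPolynomial.C (1 / 12) * u 3
  leading : ∀ k, DegreeGE 2 (D k (u 0) - MvPolynomial.C (1 / (k ! : ℚ)) * u 0 ^ k * u 1)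
  comm_zero : ∀ k P, D k (D 0 P) = D 0 (D k P)
  comm_one : ∀ k P, D k (D 1 P) = D 1 (D k P)

/-- The canonical tau-structure of the KdV hierarchy: the tau-structure `Ω_{p,q}` all of whose
members vanish when all `uᵢ` are zero. -/
structure IsCanonicalTauStructure (D : ℕ → Derivation ℚ DiffPoly DiffPoly)
    (Ω : ℕ → ℕ → DiffPoly) : Prop where
  zero_zero : Ω 0 0 = u 0
  symm : ∀ p q, Ω p q = Ω q p
  closed : ∀ p q r, D r (Ω p q) = D q (Ω p r)
  vanish : ∀ p q, MvPolynomial.constantCoeff (Ω p q) = 0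

/-- `Ω_{p₁,…,pₙ} = D_{p₁} ⋯ D_{pₙ₋₂} Ω_{pₙ₋₁,pₙ}` for `n ≥ 2` (and `0`, unused, for `n < 2`). -/
def multiOmega (D : ℕ → Derivation ℚ DiffPoly DiffPoly) (Ω : ℕ → ℕ → DiffPoly) :
    List ℕ → DiffPoly
  | [] => 0
  | [_] => 0
  | [p, q] => Ω p q
  | p :: q :: r :: l => D p (multiOmega D Ω (q :: r :: l))

/-! ### Solutions in `ℂ⟦t₀, t₁, t₂, …⟧`, where `t₀ = x` -/

/-- Formal power series in the times `t₀ = x, t₁, t₂, …`. -/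
abbrev TimeSeries : Type := MvPowerSeries ℕ ℂ

/-- `∂ / ∂tₖ`. -/
def dt (k : ℕ) : TimeSeries → TimeSeries := fun g => MvPowerSeries.pderiv ℂ k g

/-- The image of a differential polynomial under `uᵢ ↦ ∂ₓⁱ U`. -/
def evalJet (U : TimeSeries) : DiffPoly →ₐ[ℚ] TimeSeries :=
  MvPolynomial.aeval (fun i => (dt 0)^[i] U)

/-- `U` solves the KdV hierarchy `∂U/∂tₖ = Dₖ(u₀)|_{uᵢ = ∂ₓⁱ U}`, `k ≥ 0`. -/
def IsSolution (D : ℕ → Derivation ℚ DiffPoly DiffPoly) (U : TimeSeries) : Prop :=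
  ∀ k, dt k U = evalJet U (D k (u 0))

/-- The initial data `U(x, 0, 0, …)`. -/
def initialData (U : TimeSeries) : PowerSeries ℂ :=
  PowerSeries.mk (fun m => MvPowerSeries.coeff (Finsupp.single 0 m) U)

/-- `F` is the logarithm of a tau-function of the solution `U`:
`∂² F / ∂t_p ∂t_q = Ω_{p,q}|_{uᵢ = ∂ₓⁱ U}`. -/
def IsLogTau (Ω : ℕ → ℕ → DiffPoly) (U F : TimeSeries) : Prop :=
  ∀ p q, dt p (dt q F) = evalJet U (Ω p q)

/-- The (locally finite) sum `∑_{i ≥ 0} (1 + 2 i) tᵢ Gᵢ`, given by its coefficients: in degree `m`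
only the terms with `m i ≠ 0` contribute. -/
def scalingSum (G : ℕ → TimeSeries) : TimeSeries :=
  fun m => ∑ i ∈ m.support,
    (1 + 2 * (i : ℂ)) * MvPowerSeries.coeff m (MvPowerSeries.X i * G i)

/-- The string-type equation `∑_{i ≥ 0} (1 + 2 i) tᵢ ∂F/∂tᵢ + C = ∂F/∂t₀`. -/
def StringEquation (C : ℂ) (F : TimeSeries) : Prop :=
  scalingSum (fun i => dt i F) + MvPowerSeries.C C = dt 0 F

/-- The initial data `C / (x - 1)²` of the generalized BGW solution, expanded at `x = 0`. -/
def bgwInitial (C : ℂ) : PowerSeries ℂ :=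
  PowerSeries.C C * ((PowerSeries.X - 1) ^ 2)⁻¹

/-- `U` is the generalized BGW solution with parameter `C`. -/
def IsBGWSolution (D : ℕ → Derivation ℚ DiffPoly DiffPoly) (C : ℂ) (U : TimeSeries) : Prop :=
  IsSolution D U ∧ initialData U = bgwInitial C

/-- The correlator `Ω_{p₁,…,pₙ}(0)` of the solution `U`, for `n ≥ 2`. -/
def correlator (D : ℕ → Derivation ℚ DiffPoly DiffPoly) (Ω : ℕ → ℕ → DiffPoly) (U : TimeSeries)
    {n : ℕ} (p : Fin n → ℕ) : ℂ :=
  MvPowerSeries.constantCoeff (evalJet U (multiOmega D Ω (List.ofFn p)))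

/-- The one-point correlator `Ω_p(0) = (∂ log τ / ∂t_p)(0)`, where `F = log τ`. -/
def onePoint (F : TimeSeries) (p : ℕ) : ℂ :=
  MvPowerSeries.constantCoeff (dt p F)

/-- `∑_{p₁,…,pₙ ≥ 0} c(p₁,…,pₙ) ∏ⱼ (2 pⱼ + 1)!! / zⱼ^{2 pⱼ + 2}`, as a power series in the
variables `ζⱼ = 1 / zⱼ`. -/
def generatingSeries {n : ℕ} (c : (Fin n → ℕ) → ℂ) : MvPowerSeries (Fin n) ℂ :=
  fun m =>
    if ∀ j, m j = 2 * (m j / 2 - 1) + 2 then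
      c (fun j => m j / 2 - 1) * ∏ j, (((2 * (m j / 2 - 1) + 1)‼ : ℕ) : ℂ)
    else 0

/-! ### Wave functions

An element `w e^{xz}` or `w e^{-xz}` of `ℂ⟦x⟧((z⁻¹)) e^{± xz}` is represented by its amplitude
`w`, a Laurent series in `ζ = z⁻¹` with coefficients in `ℂ⟦x⟧`. -/

/-- Laurent series in `ζ = z⁻¹` over `ℂ⟦x⟧`. -/
abbrev Amplitude : Type := LaurentSeries (PowerSeries ℂ)

/-- The element `z = ζ⁻¹`. -/
def zA : Amplitude := HahnSeries.single (-1) 1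

/-- `∂ₓ` on amplitudes: `∂ₓ (w e^{ε x z}) = (∂ₓ w + ε z w) e^{ε x z}`. -/
def dx (ε : ℤ) (w : Amplitude) : Amplitude :=
  w.map (PowerSeries.derivative ℂ) + ε • (zA * w)

/-- `w e^{ε x z}` has the form `(1 + w₁(x) / z + w₂(x) / z² + ⋯) e^{ε x z}` and satisfies
`(∂ₓ² + 2 f) ψ = z² ψ`. -/
structure IsWave (f : PowerSeries ℂ) (ε : ℤ) (w : Amplitude) : Prop where
  coeff_zero : w.coeff 0 = 1
  coeff_neg : ∀ k < 0, w.coeff k = 0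
  schroedinger : dx ε (dx ε w) + HahnSeries.C (2 * f) * w = zA ^ 2 * w

/-- `ψ = w e^{xz}` and `ψ* = ws e^{-xz}` form a pair of wave functions of `f`: both have the
required form and solve the Schroedinger equation, and `∂ₓⁱ(ψ) ψ*` has zero residue at `z = ∞`
(that is, no term in `z⁻¹ = ζ¹`) for all `i ≥ 0`. -/
structure IsWavePair (f : PowerSeries ℂ) (w ws : Amplitude) : Prop where
  wave : IsWave f 1 w
  dual : IsWave f (-1) ws
  residue : ∀ i : ℕ, ((dx 1)^[i] w * ws).coeff 1 = 0

/-- The substitution `z ↦ -z`. -/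
def reflect (w : Amplitude) : Amplitude where
  coeff k := k.negOnePow • w.coeff k
  isPWO_support' := w.isPWO_support.mono fun k hk h => hk (by simp [h])

/-- `aₖ(α) = (α - k + 1/2)_{2k} / (2ᵏ k!)`, with the rising factorial. -/
def a (k : ℕ) (α : ℂ) : ℂ :=
  (ascPochhammer ℂ (2 * k)).eval (α - k + 1 / 2) / (2 ^ k * (k ! : ℂ))

/-- The amplitude `∑ₖ aₖ(α) z⁻ᵏ (1 - x)⁻ᵏ`. -/
def bgwPsi (α : ℂ) : Amplitude :=
  HahnSeries.ofPowerSeries ℤ (PowerSeries ℂ)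
    (PowerSeries.mk fun k => PowerSeries.C (a k α) * ((1 - PowerSeries.X)⁻¹) ^ k)

/-! ### The kernel `D(z, w)` and cyclic products

All rational expressions in `z₁, …, zₙ` with coefficients in power series in `ζⱼ = 1 / zⱼ` are
computed in the field of fractions of `ℂ⟦ζ₁, …, ζₙ⟧`. -/

instance (n : ℕ) : IsDomain (MvPowerSeries (Fin n) ℂ) := NoZeroDivisors.to_isDomain _

/-- The field of fractions of `ℂ⟦ζ₁, …, ζₙ⟧`. -/
abbrev ZField (n : ℕ) : Type := FractionRing (MvPowerSeries (Fin n) ℂ)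

/-- The element `ζⱼ`. -/
def zeta {n : ℕ} (j : Fin n) : ZField n :=
  algebraMap (MvPowerSeries (Fin n) ℂ) (ZField n) (MvPowerSeries.X j)

/-- The element `zⱼ = 1 / ζⱼ`. -/
def zvar {n : ℕ} (j : Fin n) : ZField n := (zeta j)⁻¹

/-- Substitution of `ζⱼ` for the variable of a Laurent series. -/
def laurentAt {n : ℕ} (j : Fin n) (g : LaurentSeries ℂ) : ZField n :=
  zeta j ^ g.order *
    algebraMap (MvPowerSeries (Fin n) ℂ) (ZField n)
      (PowerSeries.subst (MvPowerSeries.X j : MvPowerSeries (Fin n) ℂ) g.powerSeriesPart)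

/-- The value at `x = 0` of (the element represented by) an amplitude. -/
def atZero (w : Amplitude) : LaurentSeries ℂ :=
  w.map (PowerSeries.constantCoeff (R := ℂ))

/-- `D(zᵢ, zⱼ) = (ψ(zᵢ) ψ*ₓ(zⱼ) - ψ*(zⱼ) ψₓ(zᵢ)) / (zⱼ² - zᵢ²)`, evaluated at `x = 0`, for
`ψ = w e^{xz}` and `ψ* = ws e^{-xz}` (and `i ≠ j`). -/
def kernelD (w ws : Amplitude) {n : ℕ} (i j : Fin n) : ZField n :=
  (laurentAt i (atZero w) * laurentAt j (atZero (dx (-1) ws))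
      - laurentAt j (atZero ws) * laurentAt i (atZero (dx 1 w)))
    / (zvar j ^ 2 - zvar i ^ 2)

/-- `∏ᵢ K(σ(i), σ(i+1))`, with indices modulo `n`. -/
def cyclicProd {n : ℕ} {R : Type} [CommRing R] (K : Fin n → Fin n → R)
    (σ : Equiv.Perm (Fin n)) : R :=
  ∏ i, K (σ i) (σ (finRotate n i))

/-- The cyclic group `Cₙ`, as the subgroup of `Sₙ` generated by `i ↦ i + 1`. -/
def cyclicSubgroup (n : ℕ) : Subgroup (Equiv.Perm (Fin n)) :=
  Subgroup.zpowers (finRotate n)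

theorem cyclicProd_eq {n : ℕ} {R : Type} [CommRing R] (K : Fin n → Fin n → R)
    (σ τ : Equiv.Perm (Fin n)) (h : σ⁻¹ * τ ∈ cyclicSubgroup n) :
    cyclicProd K σ = cyclicProd K τ := by
  obtain ⟨k, hk⟩ := h
  have hτ : τ = σ * finRotate n ^ k := by
    rw [← mul_inv_cancel_left σ τ, ← hk]
  subst hτ
  have hc : ∀ i, (finRotate n ^ k) (finRotate n i) = finRotate n ((finRotate n ^ k) i) := by
    intro i
    rw [← Equiv.Perm.mul_apply, ← Equiv.Perm.mul_apply, ← zpow_add_one, ← zpow_one_add, add_comm]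
  unfold cyclicProd
  simp only [Equiv.Perm.mul_apply, hc]
  exact (Equiv.prod_comp (finRotate n ^ k) (fun i => K (σ i) (σ (finRotate n i)))).symm

/-- The sum over `σ ∈ Sₙ / Cₙ` of the cyclic products `∏ᵢ K(σ(i), σ(i+1))`. -/
def cyclicSum {n : ℕ} {R : Type} [CommRing R] (K : Fin n → Fin n → R) : R :=
  ∑ᶠ q : Equiv.Perm (Fin n) ⧸ cyclicSubgroup n,
    Quotient.lift (cyclicProd K)
      (fun σ τ h => cyclicProd_eq K σ τ (QuotientGroup.leftRel_apply.mp h)) q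

end KdV

end

/-! Everything rests on the basic resolvent b(λ) = 1 + u₀λ⁻¹ + ⋯ of ∂² + 2u₀, determined by a
quadratic differential equation (`bSeries_quadratic`). Its derivative is the Lenard recursion; its
linearisation shows how the flows u₀ ↦ ∂b_{q+1} act on b (`X_mul_flow_bSeries_succ`). From this come
the symmetry of flow_q(b_{p+1}) in p and q, hence commutativity of the flows, and explicit
potentials that form the tau-structure. Dividing by double factorials gives the KdV derivations.
They are unique because a symmetry of KdV without terms of degree less than two vanishes, as one
sees on its part of lowest weight (`symmetry_eq_zero`). The tau-structure is unique because ker ∂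
consists of the constants.

The function C/(x-1)² is homogeneous: at x = 0 the derivation ∂ takes the same values as the Euler
derivation that counts weights (`evalInit_del`). The Taylor coefficients of the solution are values
of iterated flows there, and closedness of the tau-structure integrates to log τ, with integration
constants forced by the string equation. On weighted homogeneous polynomials the Lenard recursion
becomes a two-term recursion of numbers; it is that of aₖ(α) up to normalisation, which gives the
one-point correlators.

For n points, put ∇ₖ = Σ_q ζₖ^{2q} flow_q. It acts on a 2 × 2 Lax matrix Lᵢ, built from b(ζᵢ²) and
its derivatives, as [Lₖ, Lᵢ]/(ζₖ² - ζᵢ²) plus a commutator with a gauge term (`nabla_lax`). The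
two-point series is a trace of L₁L₂ over (ζ₁² - ζ₂²)² minus an elementary correction free of the uᵢ.
Applying ∇ₖ to the trace of a product along a closed path inserts the vertex k into each edge in
turn: neighbouring commutator terms combine by partial fractions, and the gauge term disappears
under the trace. Induction gives the n-point series as a sum of traces over cyclic orders, an
identity of differential polynomials (`discr_pow_mul_corr`).

Wave functions enter only at the initial data. There b(ζ²) equals the product of the amplitudes of ψ
and ψ*, since both solve the same quadratic equation (`evalSq_bSeries`), and by the Wronskian
relation the Lax matrix has rank one, the product of the vectors made of ψ*, ∂ₓψ* and of ψ, ∂ₓψ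
(`map_evalInit_lax`). The trace along a closed path then factors into one scalar per edge, which is
the kernel D up to explicit powers of ζ. -/

noncomputable section

namespace KdV

/-! ### Coefficientwise derivations of power series -/

section CoeffDer

variable {σ R : Type*} [CommRing R] [Algebra ℚ R]

/-- The coefficientwise extension of a derivation to power series. -/
def coeffDer (δ : Derivation ℚ R R) : Derivation ℚ (MvPowerSeries σ R) (MvPowerSeries σ R) :=
  Derivation.mk'
    { toFun := fun f m => δ (MvPowerSeries.coeff m f)
      map_add' := fun f g => by
        ext m
        exact map_add δ _ _
      map_smul' := fun c f => by
        ext m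
        exact δ.map_smul _ _ }
    (fun f g => by
      classical
      ext m
      change δ (MvPowerSeries.coeff m (f * g)) = _
      rw [map_add, smul_eq_mul, smul_eq_mul, mul_comm g, MvPowerSeries.coeff_mul,
        MvPowerSeries.coeff_mul, MvPowerSeries.coeff_mul, map_sum, ← Finset.sum_add_distrib]
      refine Finset.sum_congr rfl fun x _ => ?_
      rw [Derivation.leibniz, smul_eq_mul, smul_eq_mul, mul_comm (MvPowerSeries.coeff x.2 g)]
      rfl)

theorem coeff_coeffDer (δ : Derivation ℚ R R) (f : MvPowerSeries σ R) (m : σ →₀ ℕ) :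
    MvPowerSeries.coeff m (coeffDer δ f) = δ (MvPowerSeries.coeff m f) := rfl

theorem coeffDer_C (δ : Derivation ℚ R R) (r : R) :
    coeffDer δ (MvPowerSeries.C r : MvPowerSeries σ R) = MvPowerSeries.C (δ r) := by
  classical
  ext m
  rw [coeff_coeffDer, MvPowerSeries.coeff_C, MvPowerSeries.coeff_C]
  split_ifs <;> simp

theorem coeffDer_X (δ : Derivation ℚ R R) (i : σ) :
    coeffDer δ (MvPowerSeries.X i : MvPowerSeries σ R) = 0 := by
  classical
  ext m
  rw [coeff_coeffDer, MvPowerSeries.coeff_X]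
  split_ifs <;> simp

theorem coeffDer_comm {δ ε : Derivation ℚ R R} (h : ∀ P, δ (ε P) = ε (δ P))
    (f : MvPowerSeries σ R) : coeffDer δ (coeffDer ε f) = coeffDer ε (coeffDer δ f) := by
  ext m
  exact h _

theorem coeff_coeffDer_powerSeries (δ : Derivation ℚ R R) (f : PowerSeries R) (k : ℕ) :
    PowerSeries.coeff k (coeffDer δ f : PowerSeries R) = δ (PowerSeries.coeff k f) := rfl

theorem coeffDer_powerSeries_C (δ : Derivation ℚ R R) (r : R) :
    (coeffDer δ (PowerSeries.C r) : PowerSeries R) = PowerSeries.C (δ r) :=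
  coeffDer_C δ r

theorem coeffDer_powerSeries_X (δ : Derivation ℚ R R) :
    (coeffDer δ (PowerSeries.X : PowerSeries R) : PowerSeries R) = 0 :=
  coeffDer_X δ ()

theorem X_pow_dvd_coeffDer (δ : Derivation ℚ R R) {f : PowerSeries R} {n : ℕ}
    (h : (PowerSeries.X : PowerSeries R) ^ n ∣ f) :
    (PowerSeries.X : PowerSeries R) ^ n ∣ (coeffDer δ f : PowerSeries R) := by
  rw [PowerSeries.X_pow_dvd_iff] at h ⊢
  intro k hk
  rw [coeff_coeffDer_powerSeries, h k hk, map_zero]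

end CoeffDer

/-- A power series `Z` vanishes if multiplication by a series with nonzero constant term turns it
into something of higher order. -/
theorem powerSeries_eq_zero_of_dvd {R : Type*} [CommRing R] [IsDomain R] {f Z : PowerSeries R}
    (hf : PowerSeries.constantCoeff f ≠ 0)
    (h : ∀ n, PowerSeries.X ^ n ∣ Z → PowerSeries.X ^ (n + 1) ∣ f * Z) : Z = 0 := by
  have key : ∀ n, (PowerSeries.X : PowerSeries R) ^ n ∣ Z := by
    intro n
    induction n with
    | zero => simp
    | succ n ih =>
      have h1 := h n ih
      obtain ⟨Y, rfl⟩ := ih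
      rw [pow_succ] at h1 ⊢
      rw [mul_left_comm] at h1
      have h2 := (mul_dvd_mul_iff_left (pow_ne_zero n PowerSeries.X_ne_zero)).1 h1
      rw [PowerSeries.X_dvd_iff, map_mul] at h2
      refine mul_dvd_mul_left _ (PowerSeries.X_dvd_iff.2 ?_)
      exact (mul_eq_zero.1 h2).resolve_left hf
  ext k
  exact (PowerSeries.X_pow_dvd_iff.1 (key (k + 1))) k (Nat.lt_succ_self k)

/-! ### Evolutionary derivations -/

/-- The derivation commuting with `∂` that maps `u₀` to `Q`. -/
def evol (Q : DiffPoly) : Derivation ℚ DiffPoly DiffPoly :=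
  MvPolynomial.mkDerivation ℚ (fun i => del^[i] Q)

theorem del_u (i : ℕ) : del (u i) = u (i + 1) := MvPolynomial.mkDerivation_X _ _ _

theorem iterate_del_u (i : ℕ) : del^[i] (u 0) = u i := by
  induction i with
  | zero => rfl
  | succ i ih => rw [Function.iterate_succ_apply', ih, del_u]

theorem evol_u (Q : DiffPoly) (i : ℕ) : evol Q (u i) = del^[i] Q :=
  MvPolynomial.mkDerivation_X _ _ _

theorem derivation_ext {δ ε : Derivation ℚ DiffPoly DiffPoly} (h : ∀ i, δ (u i) = ε (u i)) :
    δ = ε :=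
  MvPolynomial.derivation_ext h

/-- A commutator of derivations is again a derivation, so it vanishes once it vanishes on the
variables. The same device is used for all commutation rules below. -/
theorem evol_del (Q P : DiffPoly) : evol Q (del P) = del (evol Q P) := by
  have h : ⁅evol Q, del⁆ = 0 := derivation_ext fun i => by
    rw [Derivation.commutator_apply, del_u, evol_u, evol_u, Function.iterate_succ_apply', sub_self,
      Derivation.coe_zero, Pi.zero_apply]
  have h2 := congrArg (fun δ : Derivation ℚ DiffPoly DiffPoly => δ P) h
  simpa [Derivation.commutator_apply, sub_eq_zero] using h2

/-- A derivation commuting with `∂` is determined by its value on `u₀`. -/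
theorem eq_evol {δ : Derivation ℚ DiffPoly DiffPoly} (h : ∀ P, δ (del P) = del (δ P)) :
    δ = evol (δ (u 0)) :=
  derivation_ext fun i => by
    rw [evol_u]
    induction i with
    | zero => rfl
    | succ i ih => rw [← del_u, h, ih, Function.iterate_succ_apply']

theorem derivation_ext_of_comm {δ ε : Derivation ℚ DiffPoly DiffPoly}
    (hδ : ∀ P, δ (del P) = del (δ P)) (hε : ∀ P, ε (del P) = del (ε P))
    (h : δ (u 0) = ε (u 0)) : δ = ε := by
  rw [eq_evol hδ, eq_evol hε, h]

/-! ### The basic resolvent -/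

/-- The coefficients of the basic resolvent `b(λ) = 1 + u₀ λ⁻¹ + ⋯` of `∂² + 2 u₀`, i.e. the
solution of `4 (1 - 2 u₀ s) b² - 2 s b b'' + s b'² = 4`, where `s = λ⁻¹`. -/
def b : ℕ → DiffPoly
  | 0 => 1
  | k + 1 => MvPolynomial.C (1 / 8) *
      (8 * u 0 * (∑ i : Fin (k + 1), b i * b (k - i))
        + 2 * (∑ i : Fin (k + 1), b i * del (del (b (k - i))))
        - (∑ i : Fin (k + 1), del (b i) * del (b (k - i)))
        - 4 * (∑ i : Fin k, b (i + 1) * b (k - i)))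
  decreasing_by all_goals omega

theorem b_zero : b 0 = 1 := by rw [b]

/-- In the coefficient of s^{k+1} of the quadratic equation, the two extreme terms of 4b² contribute
8 b_{k+1}; the interior ones form the last sum. This is the recursion without fractions. -/
theorem eight_mul_b_succ (k : ℕ) : 8 * b (k + 1) =
    8 * u 0 * (∑ x ∈ Finset.HasAntidiagonal.antidiagonal k, b x.1 * b x.2)
      + 2 * (∑ x ∈ Finset.HasAntidiagonal.antidiagonal k, b x.1 * del (del (b x.2)))
      - (∑ x ∈ Finset.HasAntidiagonal.antidiagonal k, del (b x.1) * del (b x.2))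
      - 4 * (∑ i ∈ Finset.range k, b (i + 1) * b (k - i)) := by
  rw [b, ← mul_assoc, show (8 : DiffPoly) * MvPolynomial.C (1 / 8) = 1 by
    rw [show (8 : DiffPoly) = MvPolynomial.C 8 from (map_ofNat MvPolynomial.C 8).symm,
      ← map_mul]; norm_num, one_mul]
  rw [Finset.sum_range, Finset.Nat.sum_antidiagonal_eq_sum_range_succ (fun i j => b i * b j),
    Finset.Nat.sum_antidiagonal_eq_sum_range_succ (fun i j => b i * del (del (b j))),
    Finset.Nat.sum_antidiagonal_eq_sum_range_succ (fun i j => del (b i) * del (b j)),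
    Finset.sum_range, Finset.sum_range, Finset.sum_range]

theorem b_one : b 1 = u 0 := by
  have h := eight_mul_b_succ 0
  have h8 : (8 : DiffPoly) ≠ 0 := by norm_num
  refine mul_left_cancel₀ h8 ?_
  simpa [b_zero] using h

/-- The resolvent `b(λ)` as a power series in `s = λ⁻¹`. -/
def bSeries : PowerSeries DiffPoly := PowerSeries.mk b

/-- `∂` on power series with differential polynomial coefficients. -/
abbrev delS {σ : Type*} : Derivation ℚ (MvPowerSeries σ DiffPoly) (MvPowerSeries σ DiffPoly) :=
  coeffDer del

/-- `∂` on `A⟦s⟧`. -/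
abbrev delP (f : PowerSeries DiffPoly) : PowerSeries DiffPoly := coeffDer (σ := Unit) del f

theorem coeff_delP (f : PowerSeries DiffPoly) (k : ℕ) :
    PowerSeries.coeff k (delP f) = del (PowerSeries.coeff k f) := rfl

theorem bSeries_quadratic :
    4 * (1 - 2 * PowerSeries.C (u 0) * PowerSeries.X) * bSeries ^ 2
      - 2 * PowerSeries.X * bSeries * delP (delP bSeries)
      + PowerSeries.X * delP bSeries ^ 2 = 4 := by
  have e : 4 * (1 - 2 * PowerSeries.C (u 0) * PowerSeries.X) * bSeries ^ 2
      - 2 * PowerSeries.X * bSeries * delP (delP bSeries)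
      + PowerSeries.X * delP bSeries ^ 2 =
      PowerSeries.C 4 * (bSeries * bSeries) + PowerSeries.X *
        (PowerSeries.C (-8 * u 0) * (bSeries * bSeries)
          - PowerSeries.C 2 * (bSeries * delP (delP bSeries)) + delP bSeries * delP bSeries) := by
    simp only [map_mul, map_neg, map_ofNat]
    ring
  rw [e]
  ext1 k
  cases k with
  | zero =>
    simp [PowerSeries.coeff_zero_eq_constantCoeff, bSeries, b_zero,
      map_ofNat (PowerSeries.constantCoeff (R := DiffPoly))]
  | succ k =>
    have h := eight_mul_b_succ k
    rw [map_add, PowerSeries.coeff_succ_X_mul, map_add, map_sub, PowerSeries.coeff_C_mul,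
      PowerSeries.coeff_C_mul, PowerSeries.coeff_C_mul, PowerSeries.coeff_mul,
      PowerSeries.coeff_mul, PowerSeries.coeff_mul, PowerSeries.coeff_mul,
      Finset.Nat.sum_antidiagonal_eq_sum_range_succ
        (fun i j => PowerSeries.coeff i bSeries * PowerSeries.coeff j bSeries) (k + 1),
      Finset.sum_range_succ, Finset.sum_range_succ']
    simp only [coeff_delP, bSeries, PowerSeries.coeff_mk, b_zero, Nat.sub_zero, Nat.sub_self,
      Nat.add_sub_add_right]
    rw [show (4 : PowerSeries DiffPoly) =
      PowerSeries.C 4 from (map_ofNat (PowerSeries.C (R := DiffPoly)) 4).symm, PowerSeries.coeff_C,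
      if_neg (Nat.succ_ne_zero k)]
    linear_combination h

theorem constantCoeff_bSeries : PowerSeries.constantCoeff bSeries = 1 := by
  rw [← PowerSeries.coeff_zero_eq_constantCoeff_apply, bSeries, PowerSeries.coeff_mk, b_zero]

theorem bSeries_ne_zero : bSeries ≠ 0 := fun h => by
  simpa [h] using constantCoeff_bSeries

theorem two_ne_zero_powerSeries : (2 : PowerSeries DiffPoly) ≠ 0 := fun h => by
  have h1 := congrArg (PowerSeries.constantCoeff (R := DiffPoly)) h
  rw [map_ofNat, map_zero] at h1
  exact two_ne_zero h1

/-- The Lenard recursion for the resolvent. -/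
theorem bSeries_lenard :
    4 * (1 - 2 * PowerSeries.C (u 0) * PowerSeries.X) * delP bSeries =
      PowerSeries.X * delP (delP (delP bSeries))
        + 4 * PowerSeries.X * PowerSeries.C (u 1) * bSeries := by
  have h := congrArg (coeffDer (σ := Unit) del) bSeries_quadratic
  have h4 : coeffDer (σ := Unit) del (4 : PowerSeries DiffPoly) = 0 :=
    (coeffDer (σ := Unit) del).map_natCast 4
  have h2 : coeffDer (σ := Unit) del (2 : PowerSeries DiffPoly) = 0 :=
    (coeffDer (σ := Unit) del).map_natCast 2
  have hX : coeffDer (σ := Unit) del (PowerSeries.X : PowerSeries DiffPoly) = 0 :=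
    coeffDer_powerSeries_X _
  have hC : coeffDer (σ := Unit) del (PowerSeries.C (u 0)) = PowerSeries.C (u 1) := by
    rw [← del_u]; exact coeffDer_powerSeries_C _ _
  have h1 : coeffDer (σ := Unit) del (1 : PowerSeries DiffPoly) = 0 :=
    Derivation.map_one_eq_zero _
  simp only [map_add, map_sub, Derivation.leibniz, pow_two, smul_eq_mul, h4, h2, hX, hC, h1] at h
  have h8 : (2 * bSeries : PowerSeries DiffPoly) ≠ 0 :=
    mul_ne_zero two_ne_zero_powerSeries bSeries_ne_zero
  -- Differentiating the quadratic equation gives 2b times the Lenard relation, as the terms b'b''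
  -- cancel.
  refine mul_left_cancel₀ h8 ?_
  linear_combination h

theorem four_mul_del_b_succ (k : ℕ) : 4 * del (b (k + 1)) =
    del (del (del (b k))) + 8 * u 0 * del (b k) + 4 * u 1 * b k := by
  have h := congrArg (PowerSeries.coeff (k + 1)) bSeries_lenard
  rw [show 4 * (1 - 2 * PowerSeries.C (u 0) * PowerSeries.X) * delP bSeries =
      PowerSeries.C 4 * delP bSeries
        - PowerSeries.X * (PowerSeries.C (8 * u 0) * delP bSeries) by
      simp only [map_mul, map_ofNat]; ring,
    show PowerSeries.X * delP (delP (delP bSeries))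
        + 4 * PowerSeries.X * PowerSeries.C (u 1) * bSeries =
      PowerSeries.X * (delP (delP (delP bSeries)) + PowerSeries.C (4 * u 1) * bSeries) by
      simp only [map_mul, map_ofNat]; ring] at h
  rw [map_sub, PowerSeries.coeff_succ_X_mul, PowerSeries.coeff_succ_X_mul, map_add,
    PowerSeries.coeff_C_mul, PowerSeries.coeff_C_mul, PowerSeries.coeff_C_mul] at h
  simp only [coeff_delP, bSeries, PowerSeries.coeff_mk] at h
  linear_combination h

/-! ### The flows -/

/-- The flow `u₀ ↦ ∂ b_{q+1}`, which is `(2 q + 1)!!` times the KdV derivation `D_q`. -/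
def flow (q : ℕ) : Derivation ℚ DiffPoly DiffPoly := evol (del (b (q + 1)))

theorem flow_u_zero (q : ℕ) : flow q (u 0) = del (b (q + 1)) := evol_u _ 0

theorem flow_del (q : ℕ) (P : DiffPoly) : flow q (del P) = del (flow q P) := evol_del _ P

theorem flow_zero : flow 0 = del :=
  derivation_ext_of_comm (flow_del 0) (fun _ => rfl) (by rw [flow_u_zero, zero_add, b_one])

/-- The linearisation of `bSeries_quadratic`. -/
theorem bSeries_linearised (q : ℕ) :
    8 * (1 - 2 * PowerSeries.C (u 0) * PowerSeries.X) * bSeries * coeffDer (σ := Unit) (flow q) bSeries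
      - 8 * PowerSeries.X * PowerSeries.C (del (b (q + 1))) * bSeries ^ 2
      - 2 * PowerSeries.X * (coeffDer (σ := Unit) (flow q) bSeries * delP (delP bSeries)
        + bSeries * delP (delP (coeffDer (σ := Unit) (flow q) bSeries)))
      + 2 * PowerSeries.X * delP bSeries * delP (coeffDer (σ := Unit) (flow q) bSeries) = 0 := by
  have h := congrArg (coeffDer (σ := Unit) (flow q)) bSeries_quadratic
  have h4 : coeffDer (σ := Unit) (flow q) (4 : PowerSeries DiffPoly) = 0 :=
    (coeffDer (σ := Unit) (flow q)).map_natCast 4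
  have h2 : coeffDer (σ := Unit) (flow q) (2 : PowerSeries DiffPoly) = 0 :=
    (coeffDer (σ := Unit) (flow q)).map_natCast 2
  have hX : coeffDer (σ := Unit) (flow q) (PowerSeries.X : PowerSeries DiffPoly) = 0 :=
    coeffDer_powerSeries_X _
  have hC : coeffDer (σ := Unit) (flow q) (PowerSeries.C (u 0)) =
      PowerSeries.C (del (b (q + 1))) := by
    rw [← flow_u_zero]; exact coeffDer_powerSeries_C _ _
  have h1 : coeffDer (σ := Unit) (flow q) (1 : PowerSeries DiffPoly) = 0 :=
    Derivation.map_one_eq_zero _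
  have hc := coeffDer_comm (σ := Unit) (flow_del q)
  have hc1 : coeffDer (σ := Unit) (flow q) (delP bSeries) =
    delP (coeffDer (σ := Unit) (flow q) bSeries) := hc _
  have hc2 : coeffDer (σ := Unit) (flow q) (delP (delP bSeries)) =
    delP (delP (coeffDer (σ := Unit) (flow q) bSeries)) := by
    rw [← hc1]; exact hc _
  simp only [map_add, map_sub, Derivation.leibniz, pow_two, smul_eq_mul, h4, h2, hX, hC, h1, hc1,
    hc2] at h
  linear_combination h

/-- Let W be the difference of the two sides. Combining s times the linearised equation for q + 1
with the one for q, the Lenard relation for b and the Lenard recursion for b_{q+1}, all source terms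
cancel and W solves the homogeneous linearised equation. That equation expresses 8(1 - 2u₀s)bW as s
times a series at least as divisible by s as W, which forces W = 0. -/
theorem X_mul_flow_bSeries_succ (q : ℕ) :
    PowerSeries.X * coeffDer (σ := Unit) (flow (q + 1)) bSeries =
      coeffDer (σ := Unit) (flow q) bSeries + PowerSeries.X *
        (PowerSeries.C (b (q + 1)) * delP bSeries - PowerSeries.C (del (b (q + 1))) * bSeries) := by
  have hq := bSeries_linearised q
  have hq1 := bSeries_linearised (q + 1)
  have hg : (4 : PowerSeries DiffPoly) * PowerSeries.C (del (b (q + 1 + 1))) =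
      PowerSeries.C (del (del (del (b (q + 1))))) + 8 * PowerSeries.C (u 0)
        * PowerSeries.C (del (b (q + 1))) + 4 * PowerSeries.C (u 1) * PowerSeries.C (b (q + 1)) := by
    have := congrArg (PowerSeries.C (R := DiffPoly)) (four_mul_del_b_succ (q + 1))
    simpa only [map_mul, map_add, map_ofNat] using this
  have hL := bSeries_lenard
  set s : PowerSeries DiffPoly := PowerSeries.X with hs
  set B := bSeries
  set Y0 : PowerSeries DiffPoly := coeffDer (σ := Unit) (flow q) B
  set Y1 : PowerSeries DiffPoly := coeffDer (σ := Unit) (flow (q + 1)) B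
  set g := b (q + 1)
  have dC : ∀ P : DiffPoly, coeffDer (σ := Unit) del (PowerSeries.C P : PowerSeries DiffPoly) = PowerSeries.C (del P) :=
    fun P => coeffDer_powerSeries_C _ _
  have dX : coeffDer (σ := Unit) del s = 0 := coeffDer_powerSeries_X _
  set W : PowerSeries DiffPoly := s * Y1 - (Y0 + s * (PowerSeries.C g * delP B - PowerSeries.C (del g) * B)) with hW
  have hW' : delP W = s * delP Y1 - (delP Y0 + s * (PowerSeries.C g * delP (delP B)
      - PowerSeries.C (del (del g)) * B)) := by
    rw [hW]
    simp only [map_add, map_sub, Derivation.leibniz, smul_eq_mul, dC, dX]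
    ring
  have hW'' : delP (delP W) = s * delP (delP Y1) - (delP (delP Y0) + s *
      (PowerSeries.C (del g) * delP (delP B) + PowerSeries.C g * delP (delP (delP B))
      - PowerSeries.C (del (del g)) * delP B - PowerSeries.C (del (del (del g))) * B)) := by
    rw [hW']
    simp only [map_add, map_sub, Derivation.leibniz, smul_eq_mul, dC, dX]
    ring
  have key : 8 * (1 - 2 * PowerSeries.C (u 0) * s) * B * W =
      s * (2 * (W * delP (delP B) + B * delP (delP W)) - 2 * delP B * delP W) := by
    rw [hW'', hW', hW]
    linear_combination s * hq1 - hq - 2 * s * PowerSeries.C g * B * hL + 2 * s ^ 2 * B ^ 2 * hg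
  have hW0 : W = 0 := by
    refine powerSeries_eq_zero_of_dvd (f := 8 * (1 - 2 * PowerSeries.C (u 0) * s) * B) ?_ ?_
    · rw [map_mul, map_mul, constantCoeff_bSeries, map_sub, map_mul, map_ofNat, hs, PowerSeries.constantCoeff_X]
      norm_num
    · intro n hn
      rw [key, pow_succ']
      refine mul_dvd_mul_left _ ?_
      have h1 : s ^ n ∣ delP W := X_pow_dvd_coeffDer _ hn
      have h2 : s ^ n ∣ delP (delP W) := X_pow_dvd_coeffDer _ h1
      exact dvd_sub (Dvd.dvd.mul_left (dvd_add (hn.mul_right _) (h2.mul_left _)) _)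
        (h1.mul_left _)
  exact sub_eq_zero.1 hW0

theorem flow_succ_b (q p : ℕ) : flow (q + 1) (b p) =
    flow q (b (p + 1)) + (b (q + 1) * del (b p) - del (b (q + 1)) * b p) := by
  have h := congrArg (PowerSeries.coeff (p + 1)) (X_mul_flow_bSeries_succ q)
  rw [PowerSeries.coeff_succ_X_mul, map_add, PowerSeries.coeff_succ_X_mul, map_sub,
    PowerSeries.coeff_C_mul, PowerSeries.coeff_C_mul] at h
  simpa only [coeff_delP, coeff_coeffDer_powerSeries, bSeries, PowerSeries.coeff_mk] using h

/-- Let S(q,p) be the difference of the two sides. In S(q+1,p) = S(q,p+1) the Wronskian terms of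
`flow_succ_b` cancel, so S(q,p) depends only on p + q. Being also antisymmetric, it is zero. -/
theorem flow_b_symm (q p : ℕ) : flow q (b (p + 1)) = flow p (b (q + 1)) := by
  have step : ∀ q p, flow (q + 1) (b (p + 1)) - flow p (b (q + 1 + 1)) =
      flow q (b (p + 1 + 1)) - flow (p + 1) (b (q + 1)) := fun q p => by
    rw [flow_succ_b q (p + 1), flow_succ_b p (q + 1)]
    ring
  have chain : ∀ q p, flow q (b (p + 1)) - flow p (b (q + 1)) =
      flow 0 (b (p + q + 1)) - flow (p + q) (b 1) := fun q => by
    induction q with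
    | zero => intro p; simp
    | succ q ih =>
      intro p
      rw [step, ih (p + 1), show p + 1 + q = p + (q + 1) by omega]
  have h1 := chain q p
  have h2 := chain p q
  rw [show q + p = p + q by omega] at h2
  have h3 : (2 : DiffPoly) * (flow q (b (p + 1)) - flow p (b (q + 1))) = 0 := by
    have h4 := chain (p + q) 0
    simp only [zero_add] at h4
    linear_combination h1 - h2
  exact sub_eq_zero.1 ((mul_eq_zero.1 h3).resolve_left two_ne_zero)

/-- The commutator of two flows commutes with ∂, so it is determined by its value on u₀, which is ∂
of the difference in `flow_b_symm`. -/
theorem flow_comm (q p : ℕ) (P : DiffPoly) : flow q (flow p P) = flow p (flow q P) := by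
  have h : ⁅flow q, flow p⁆ = 0 := derivation_ext_of_comm
    (fun P => by simp only [Derivation.commutator_apply, flow_del, map_sub])
    (fun P => by simp)
    (by simp only [Derivation.commutator_apply, flow_u_zero, flow_del, flow_b_symm q p,
      sub_self, Derivation.coe_zero, Pi.zero_apply])
  have h2 := congrArg (fun δ : Derivation ℚ DiffPoly DiffPoly => δ P) h
  simpa [Derivation.commutator_apply, sub_eq_zero] using h2

/-! ### The kernel of `∂` -/

theorem pderiv_u (i j : ℕ) : MvPolynomial.pderiv i (u j) = if i = j then 1 else 0 := by
  classical
  rw [u, MvPolynomial.pderiv_X, Pi.single_apply]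
  simp only [eq_comm]

theorem pderiv_succ_del (N : ℕ) (P : DiffPoly) : MvPolynomial.pderiv (N + 1) (del P) =
    MvPolynomial.pderiv N P + del (MvPolynomial.pderiv (N + 1) P) := by
  have h : ⁅(MvPolynomial.pderiv (N + 1) : Derivation ℚ DiffPoly DiffPoly), del⁆ =
      MvPolynomial.pderiv N := derivation_ext fun i => by
    rw [Derivation.commutator_apply, del_u, pderiv_u, pderiv_u, pderiv_u]
    split_ifs <;> simp_all
  rw [← h, Derivation.commutator_apply]
  ring

/-- By [∂/∂u_{N+1}, ∂] = ∂/∂u_N, if ∂P = 0 and P does not involve u_{N+1}, then it does not involve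
u_N. Starting above the highest variable of P, all variables drop out. -/
theorem eq_C_of_del_eq_zero {P : DiffPoly} (h : del P = 0) :
    P = MvPolynomial.C (MvPolynomial.constantCoeff P) := by
  -- The induction is downward in the index; k counts the steps taken below the bound on the
  -- variables of P.
  have h0 : ∀ k N, P.vars.sup id + 1 - k ≤ N → MvPolynomial.pderiv N P = 0 := by
    intro k
    induction k with
    | zero =>
      intro N hN
      refine MvPolynomial.pderiv_eq_zero_of_notMem_vars fun hm => ?_
      have := Finset.le_sup (f := id) hm
      simp only [id] at this
      omega
    | succ k ih =>
      intro N hN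
      have h1 := pderiv_succ_del N P
      rw [h, ih (N + 1) (by omega)] at h1
      simpa using h1.symm
  have h1 : ∀ N, MvPolynomial.pderiv N P = 0 := fun N => h0 (P.vars.sup id + 1) N (by omega)
  ext m
  rw [MvPolynomial.coeff_C]
  split_ifs with hm
  · rw [← hm]; rfl
  · obtain ⟨i, hi⟩ : ∃ i, m i ≠ 0 := by
      by_contra! hc
      exact hm (Finsupp.ext fun i => (hc i).symm)
    have h2 := congrArg (MvPolynomial.coeff (m - Finsupp.single i 1)) (h1 i)
    rw [MvPolynomial.coeff_pderiv, MvPolynomial.coeff_zero, tsub_add_cancel_of_le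
      (Finsupp.single_le_iff.2 (Nat.one_le_iff_ne_zero.2 hi))] at h2
    exact (mul_eq_zero.1 h2).resolve_right (by positivity)

theorem eq_of_del_eq {P Q : DiffPoly} (h : del P = del Q)
    (hc : MvPolynomial.constantCoeff P = MvPolynomial.constantCoeff Q) : P = Q := by
  have h1 := eq_C_of_del_eq_zero (P := P - Q) (by rw [map_sub, h, sub_self])
  rw [map_sub, hc, sub_self, map_zero] at h1
  exact sub_eq_zero.1 h1

/-- By the Leibniz rule the image of δ lies in the ideal generated by the δ(uᵢ). This serves for
constant terms, for the dispersionless limit, and for comparing two derivations after evaluation. -/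
theorem ringHom_comp_derivation {R : Type*} [CommRing R] (f : DiffPoly →+* R)
    {δ : Derivation ℚ DiffPoly DiffPoly} (h : ∀ i, f (δ (u i)) = 0) (P : DiffPoly) :
    f (δ P) = 0 := by
  induction P using MvPolynomial.induction_on with
  | C a => rw [← MvPolynomial.algebraMap_eq, Derivation.map_algebraMap, map_zero]
  | add p q hp hq => rw [map_add, map_add, hp, hq, add_zero]
  | mul_X p i hp =>
    rw [Derivation.leibniz, map_add, smul_eq_mul, smul_eq_mul, map_mul, map_mul, hp, mul_zero,
      add_zero, show MvPolynomial.X i = u i from rfl, h, mul_zero]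

theorem constantCoeff_u (i : ℕ) : MvPolynomial.constantCoeff (u i) = 0 :=
  MvPolynomial.constantCoeff_X ℚ i

theorem constantCoeff_del (P : DiffPoly) : MvPolynomial.constantCoeff (del P) = 0 :=
  ringHom_comp_derivation _ (fun i => by rw [del_u, constantCoeff_u]) P

theorem constantCoeff_flow (q : ℕ) (P : DiffPoly) :
    MvPolynomial.constantCoeff (flow q P) = 0 :=
  ringHom_comp_derivation _ (fun i => by
    rw [flow, evol_u, ← Function.iterate_succ_apply, Function.iterate_succ_apply',
      constantCoeff_del]) P

theorem constantCoeff_b_succ (k : ℕ) : MvPolynomial.constantCoeff (b (k + 1)) = 0 := by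
  induction k using Nat.strong_induction_on with
  | _ k ih =>
    have h := congrArg (MvPolynomial.constantCoeff) (eight_mul_b_succ k)
    simp only [map_mul, map_add, map_sub, map_sum, constantCoeff_u, constantCoeff_del, map_ofNat,
      mul_zero, zero_mul, Finset.sum_const_zero, zero_add, sub_zero, zero_sub] at h
    rw [Finset.sum_eq_zero fun i hi => by
      rw [ih i (Finset.mem_range.1 hi), zero_mul]] at h
    linarith

/-! ### The tau-structure -/

/-- The potential `h` with `∂ h = w_{q+1,p} - w_{q,p+1}`, where `w_{q,p} = b_q b_p' - b_q' b_p`. -/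
def wronskianStep (q p : ℕ) : DiffPoly :=
  b (q + 1) * b p + b q * b (p + 1) - 4 * u 0 * b q * b p
    - MvPolynomial.C (1 / 2) * (del (del (b q)) * b p + b q * del (del (b p))
      - del (b q) * del (b p))

/-- A potential of `b_q b_p' - b_q' b_p`. -/
def wronskianPotential : ℕ → ℕ → DiffPoly
  | 0, p => b p
  | q + 1, p => wronskianPotential q (p + 1) + wronskianStep q p

/-- `(2 p + 1)!! (2 q + 1)!! Ω_{p,q}`. -/
def scaledTau : ℕ → ℕ → DiffPoly
  | p, 0 => b (p + 1)
  | p, q + 1 => scaledTau (p + 1) q + wronskianPotential (q + 1) (p + 1)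

theorem two_mul_C_half : (2 : DiffPoly) * MvPolynomial.C (1 / 2) = 1 := by
  rw [show (2 : DiffPoly) = MvPolynomial.C 2 from (map_ofNat MvPolynomial.C 2).symm, ← map_mul]
  norm_num

theorem del_mul (P Q : DiffPoly) : del (P * Q) = del P * Q + P * del Q := by
  rw [Derivation.leibniz, smul_eq_mul, smul_eq_mul]; ring

theorem del_C (c : ℚ) : del (MvPolynomial.C c) = 0 := by
  rw [← MvPolynomial.algebraMap_eq, Derivation.map_algebraMap]

/-- The Lenard recursion for b_q, multiplied by b_p, and that for b_p, multiplied by b_q, turn the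
third derivatives into ∂b_{q+1} and ∂b_{p+1}; the rest is an exact derivative. -/
theorem del_wronskianStep (q p : ℕ) : del (wronskianStep q p) =
    (b (q + 1) * del (b p) - del (b (q + 1)) * b p)
      - (b q * del (b (p + 1)) - del (b q) * b (p + 1)) := by
  have h1 := four_mul_del_b_succ q
  have h2 := four_mul_del_b_succ p
  have h4 : del (4 : DiffPoly) = 0 := del.map_natCast 4
  simp only [wronskianStep, map_add, map_sub, del_mul, del_C, del_u, h4]
  linear_combination MvPolynomial.C (1 / 2) * (b p * h1 + b q * h2)
    - (2 * (del (b (q + 1)) * b p + b q * del (b (p + 1)))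
      - 4 * (u 1 * b q * b p + u 0 * (del (b q) * b p + b q * del (b p)))) * two_mul_C_half

theorem del_wronskianPotential (q p : ℕ) :
    del (wronskianPotential q p) = b q * del (b p) - del (b q) * b p := by
  induction q generalizing p with
  | zero => simp [wronskianPotential, b_zero]
  | succ q ih => rw [wronskianPotential, map_add, ih, del_wronskianStep]; ring

/-- The recursion defining `scaledTau` integrates `flow_succ_b` term by term, the Wronskian being ∂
of its potential. -/
theorem del_scaledTau (p q : ℕ) : del (scaledTau p q) = flow q (b (p + 1)) := by
  induction q generalizing p with
  | zero => rw [scaledTau, flow_zero]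
  | succ q ih => rw [scaledTau, map_add, ih, del_wronskianPotential, flow_succ_b]

theorem constantCoeff_wronskianPotential (q p : ℕ) :
    MvPolynomial.constantCoeff (wronskianPotential q (p + 1)) = 0 := by
  induction q generalizing p with
  | zero => exact constantCoeff_b_succ p
  | succ q ih =>
    rw [wronskianPotential, map_add, ih, wronskianStep]
    simp [constantCoeff_b_succ, constantCoeff_del]

theorem constantCoeff_scaledTau (p q : ℕ) : MvPolynomial.constantCoeff (scaledTau p q) = 0 := by
  induction q generalizing p with
  | zero => exact constantCoeff_b_succ p
  | succ q ih => rw [scaledTau, map_add, ih, constantCoeff_wronskianPotential, add_zero]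

/-- An identity between polynomials without constant term may be tested after applying ∂. Here it
becomes the symmetry of the flows on b; closedness below becomes their commutativity. -/
theorem scaledTau_symm (p q : ℕ) : scaledTau p q = scaledTau q p :=
  eq_of_del_eq (by rw [del_scaledTau, del_scaledTau, flow_b_symm])
    (by rw [constantCoeff_scaledTau, constantCoeff_scaledTau])

theorem flow_scaledTau (p q r : ℕ) : flow r (scaledTau p q) = flow q (scaledTau p r) :=
  eq_of_del_eq (by rw [← flow_del, ← flow_del, del_scaledTau, del_scaledTau, flow_comm])
    (by rw [constantCoeff_flow, constantCoeff_flow])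

/-- The KdV derivations `D_q = (2 q + 1)!!⁻¹ flow q`. -/
def kdv (q : ℕ) : Derivation ℚ DiffPoly DiffPoly := (((2 * q + 1)‼ : ℕ) : ℚ)⁻¹ • flow q

/-- The canonical tau-structure. -/
def tau (p q : ℕ) : DiffPoly :=
  ((((2 * p + 1)‼ : ℕ) : ℚ)⁻¹ * (((2 * q + 1)‼ : ℕ) : ℚ)⁻¹) • scaledTau p q

theorem kdv_apply (q : ℕ) (P : DiffPoly) :
    kdv q P = (((2 * q + 1)‼ : ℕ) : ℚ)⁻¹ • flow q P := rfl

theorem kdv_comm (q p : ℕ) (P : DiffPoly) : kdv q (kdv p P) = kdv p (kdv q P) := by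
  simp only [kdv_apply, Derivation.map_smul, flow_comm q p]
  rw [smul_comm]

theorem kdv_zero : kdv 0 = del := by
  rw [kdv, flow_zero]
  simp

theorem isCanonicalTauStructure_tau : IsCanonicalTauStructure kdv tau where
  zero_zero := by simp [tau, scaledTau, b_one]
  symm p q := by rw [tau, tau, scaledTau_symm, mul_comm]
  closed p q r := by
    simp only [tau, kdv_apply, Derivation.map_smul, smul_smul, flow_scaledTau p q r]
    congr 1
    ring
  vanish p q := by
    rw [tau, MvPolynomial.smul_eq_C_mul, map_mul, constantCoeff_scaledTau, mul_zero]

/-- Closedness with r = 0 fixes ∂Ω_{p,0} = D_p u₀ and then ∂Ω_{p,q} = D_q Ω_{p,0}; the absence of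
constant terms fixes the integration constants. -/
theorem isCanonicalTauStructure_unique {D : ℕ → Derivation ℚ DiffPoly DiffPoly}
    (hD : D 0 = del) {Ω Ω' : ℕ → ℕ → DiffPoly} (h : IsCanonicalTauStructure D Ω)
    (h' : IsCanonicalTauStructure D Ω') : Ω = Ω' := by
  have key : ∀ {Ω : ℕ → ℕ → DiffPoly}, IsCanonicalTauStructure D Ω →
      (∀ p, del (Ω p 0) = D p (u 0)) ∧ ∀ p q, del (Ω p q) = D q (Ω p 0) := by
    intro Ω h
    refine ⟨fun p => ?_, fun p q => ?_⟩
    · rw [h.symm, ← hD, h.closed, h.zero_zero]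
    · rw [← hD, h.closed]
  have h0 : ∀ p, Ω p 0 = Ω' p 0 := fun p =>
    eq_of_del_eq (by rw [(key h).1, (key h').1]) (by rw [h.vanish, h'.vanish])
  funext p q
  exact eq_of_del_eq (by rw [(key h).2, (key h').2, h0]) (by rw [h.vanish, h'.vanish])

/-! ### Weights of monomials -/

/-- The weight of a monomial when `uᵢ` has weight `w i`. -/
def wt (w : ℕ → ℤ) (m : ℕ →₀ ℕ) : ℤ := m.sum fun i e => (e : ℤ) * w i

theorem wt_add (w : ℕ → ℤ) (m n : ℕ →₀ ℕ) : wt w (m + n) = wt w m + wt w n :=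
  Finsupp.sum_add_index' (fun _ => by simp) (fun _ _ _ => by push_cast; ring)

theorem wt_single (w : ℕ → ℤ) (i : ℕ) : wt w (Finsupp.single i 1) = w i := by
  rw [wt, Finsupp.sum_single_index (by simp)]; simp

/-- All monomials of `P` have weight at least `d`. -/
def WeightGE (w : ℕ → ℤ) (d : ℤ) (P : DiffPoly) : Prop := ∀ m ∈ P.support, d ≤ wt w m

theorem degreeGE_iff (d : ℕ) (P : DiffPoly) :
    DegreeGE d P ↔ WeightGE (fun i => (i : ℤ)) d P := by
  refine forall₂_congr fun m _ => ?_
  rw [wt, Finsupp.sum, Finsupp.sum]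
  exact_mod_cast Iff.rfl

namespace WeightGE

variable {w : ℕ → ℤ} {d e : ℤ} {P Q : DiffPoly}

theorem mono (h : WeightGE w d P) (hde : e ≤ d) : WeightGE w e P := fun m hm => hde.trans (h m hm)

theorem zero : WeightGE w d 0 := fun m hm => by simp at hm

theorem add (hP : WeightGE w d P) (hQ : WeightGE w d Q) : WeightGE w d (P + Q) := by
  classical
  intro m hm
  rcases Finset.mem_union.1 (MvPolynomial.support_add hm) with h | h
  · exact hP m h
  · exact hQ m h

theorem mul (hP : WeightGE w d P) (hQ : WeightGE w e Q) : WeightGE w (d + e) (P * Q) := by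
  classical
  intro m hm
  obtain ⟨a, ha, c, hc, rfl⟩ := Finset.mem_add.1 (MvPolynomial.support_mul P Q hm)
  rw [wt_add]
  exact add_le_add (hP a ha) (hQ c hc)

theorem C (c : ℚ) : WeightGE w 0 (MvPolynomial.C c) := fun m hm => by
  have := MvPolynomial.support_monomial_subset hm
  rw [Finset.mem_singleton.1 this]
  exact le_of_eq (by simp [wt])

theorem C_mul (c : ℚ) (hP : WeightGE w d P) : WeightGE w d (MvPolynomial.C c * P) := by
  simpa using (C c).mul hP

theorem neg (hP : WeightGE w d P) : WeightGE w d (-P) := by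
  simpa using hP.C_mul (-1)

theorem sub (hP : WeightGE w d P) (hQ : WeightGE w d Q) : WeightGE w d (P - Q) := by
  rw [sub_eq_add_neg]; exact hP.add hQ.neg

theorem sum {ι : Type*} {s : Finset ι} {f : ι → DiffPoly} (h : ∀ i ∈ s, WeightGE w d (f i)) :
    WeightGE w d (∑ i ∈ s, f i) :=
  Finset.sum_induction f (WeightGE w d) (fun _ _ => add) zero h

theorem monomial (m : ℕ →₀ ℕ) (c : ℚ) : WeightGE w (wt w m) (MvPolynomial.monomial m c) :=
  fun n hn => by
    have := MvPolynomial.support_monomial_subset hn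
    rw [Finset.mem_singleton.1 this]

theorem u (i : ℕ) : WeightGE w (w i) (u i) := by
  have := monomial (w := w) (Finsupp.single i 1) 1
  rwa [wt_single] at this

theorem coeff_eq_zero (hP : WeightGE w d P) {m : ℕ →₀ ℕ} (hm : wt w m < d) :
    MvPolynomial.coeff m P = 0 := by
  by_contra h
  exact absurd (hP m (MvPolynomial.mem_support_iff.2 h)) (not_le.2 hm)

/-- A derivation that raises the weights of the variables by `r` raises all weights by `r`. -/
theorem derivation {δ : Derivation ℚ DiffPoly DiffPoly} {r : ℤ}
    (hδ : ∀ i, WeightGE w (w i + r) (δ (KdV.u i))) (hP : WeightGE w d P) :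
    WeightGE w (d + r) (δ P) := by
  have hm : ∀ m : ℕ →₀ ℕ, WeightGE w (wt w m + r) (δ (MvPolynomial.monomial m 1)) := by
    intro m
    induction m using Finsupp.induction_linear with
    | zero =>
      rw [show MvPolynomial.monomial 0 1 = (1 : DiffPoly) from rfl, Derivation.map_one_eq_zero]
      exact zero
    | add m n hm hn =>
      rw [show MvPolynomial.monomial (m + n) (1 : ℚ) =
        MvPolynomial.monomial m 1 * MvPolynomial.monomial n 1 by
          rw [MvPolynomial.monomial_mul, one_mul], Derivation.leibniz, smul_eq_mul, smul_eq_mul,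
          wt_add]
      exact ((monomial m 1).mul hn |>.mono (by linarith)).add
        ((monomial n 1).mul hm |>.mono (by linarith))
    | single i k =>
      induction k with
      | zero =>
        rw [Finsupp.single_zero, show MvPolynomial.monomial 0 1 = (1 : DiffPoly) from rfl,
          Derivation.map_one_eq_zero]
        exact zero
      | succ k ih =>
        rw [Finsupp.single_add, show MvPolynomial.monomial (Finsupp.single i k + Finsupp.single i 1)
          (1 : ℚ) = MvPolynomial.monomial (Finsupp.single i k) 1 * KdV.u i by
            rw [KdV.u, MvPolynomial.X, MvPolynomial.monomial_mul, one_mul], Derivation.leibniz,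
          smul_eq_mul, smul_eq_mul, wt_add, wt_single]
        exact ((monomial _ 1).mul (hδ i) |>.mono (by linarith)).add
          ((u i).mul ih |>.mono (by linarith))
  rw [← MvPolynomial.support_sum_monomial_coeff P, map_sum]
  refine sum fun m hmP => ?_
  rw [show MvPolynomial.monomial m (MvPolynomial.coeff m P) =
    MvPolynomial.coeff m P • MvPolynomial.monomial m (1 : ℚ) by
      rw [MvPolynomial.smul_monomial, smul_eq_mul, mul_one], Derivation.map_smul,
      MvPolynomial.smul_eq_C_mul]
  exact ((hm m).mono (by linarith [hP m hmP])).C_mul _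

end WeightGE

/-- The derivation `uᵢ ↦ κᵢ uᵢ`. -/
def diagDer (κ : ℕ → ℤ) : Derivation ℚ DiffPoly DiffPoly :=
  MvPolynomial.mkDerivation ℚ fun i => MvPolynomial.C (κ i : ℚ) * u i

theorem diagDer_u (κ : ℕ → ℤ) (i : ℕ) : diagDer κ (u i) = MvPolynomial.C (κ i : ℚ) * u i :=
  MvPolynomial.mkDerivation_X _ _ _

theorem coeff_diagDer (κ : ℕ → ℤ) (P : DiffPoly) (m : ℕ →₀ ℕ) :
    MvPolynomial.coeff m (diagDer κ P) = (wt κ m : ℚ) * MvPolynomial.coeff m P := by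
  classical
  induction P using MvPolynomial.induction_on generalizing m with
  | C a =>
    rw [← MvPolynomial.algebraMap_eq, Derivation.map_algebraMap, MvPolynomial.algebraMap_eq,
      MvPolynomial.coeff_C, MvPolynomial.coeff_zero]
    split_ifs with h
    · rw [← h]; simp [wt]
    · simp
  | add p q hp hq => rw [map_add, MvPolynomial.coeff_add, MvPolynomial.coeff_add, hp, hq]; ring
  | mul_X p i hp =>
    rw [Derivation.leibniz, show (MvPolynomial.X i : DiffPoly) = u i from rfl, diagDer_u,
      smul_eq_mul, smul_eq_mul, mul_left_comm, MvPolynomial.coeff_add, MvPolynomial.coeff_C_mul,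
      mul_comm (u i), u, MvPolynomial.coeff_mul_X', MvPolynomial.coeff_mul_X', hp]
    split_ifs with h
    · have hm : wt κ m = wt κ (m - Finsupp.single i 1) + κ i := by
        rw [← wt_single κ i, ← wt_add, tsub_add_cancel_of_le
          (Finsupp.single_le_iff.2 (Nat.one_le_iff_ne_zero.2 (Finsupp.mem_support_iff.1 h)))]
      rw [hm]
      push_cast
      ring
    · ring

/-! ### The leading terms of the KdV derivations -/

/-- The homomorphism that kills `u₁, u₂, …`. -/
def dispersionless : DiffPoly →ₐ[ℚ] DiffPoly :=
  MvPolynomial.aeval fun i => if i = 0 then u 0 else 0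

theorem dispersionless_u (i : ℕ) : dispersionless (u i) = if i = 0 then u 0 else 0 :=
  MvPolynomial.aeval_X _ _

/-- What `dispersionless` removes are exactly the monomials containing some uᵢ with i ≥ 1. -/
theorem sub_dispersionless (P : DiffPoly) :
    WeightGE (fun i => (i : ℤ)) 1 (P - dispersionless P) := by
  have h0 : ∀ P : DiffPoly, WeightGE (fun i => (i : ℤ)) 0 P := fun P m _ =>
    Finset.sum_nonneg fun i _ => by positivity
  induction P using MvPolynomial.induction_on with
  | C a =>
    rw [← MvPolynomial.algebraMap_eq, AlgHom.commutes, sub_self]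
    exact WeightGE.zero
  | add p q hp hq =>
    rw [map_add, add_sub_add_comm]
    exact hp.add hq
  | mul_X p i hp =>
    rw [map_mul, show p * MvPolynomial.X i - dispersionless p * dispersionless (MvPolynomial.X i) =
      (p - dispersionless p) * u i + dispersionless p * (u i - dispersionless (u i)) by
        rw [u]; ring]
    refine WeightGE.add (by simpa using hp.mul (h0 (u i))) ?_
    refine (show (0 : ℤ) + 1 = 1 by norm_num) ▸ WeightGE.mul (h0 _) ?_
    rw [dispersionless_u]
    split_ifs with hi
    · rw [hi, sub_self]; exact WeightGE.zero
    · rw [sub_zero]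
      exact (WeightGE.u i).mono (by simp; omega)

theorem dispersionless_del (P : DiffPoly) : dispersionless (del P) = 0 :=
  ringHom_comp_derivation (dispersionless : DiffPoly →+* DiffPoly)
    (fun i => by rw [del_u]; simp [dispersionless_u]) P

/-- Without u₁, u₂, … the quadratic equation reads (1 - 2u₀s)G² = 1, so G = (1 - 2u₀s)^{-1/2}.
Differentiating in s and cancelling G gives (1 - 2u₀s)G' = u₀G, whose coefficients are the recursion
`hrec`. -/
theorem dispersionless_b (k : ℕ) : (((k + 1)! : ℕ) : DiffPoly) * dispersionless (b (k + 1)) =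
    (((2 * k + 1)‼ : ℕ) : DiffPoly) * u 0 ^ (k + 1) := by
  set G : PowerSeries DiffPoly := PowerSeries.map (dispersionless : DiffPoly →+* DiffPoly) bSeries
    with hG
  have hq := congrArg (PowerSeries.map (dispersionless : DiffPoly →+* DiffPoly)) bSeries_quadratic
  have hd : ∀ f, PowerSeries.map (dispersionless : DiffPoly →+* DiffPoly) (delP f) = 0 := by
    intro f
    ext1 k
    rw [PowerSeries.coeff_map, coeff_delP]
    exact dispersionless_del _
  simp only [map_sub, map_add, map_mul, map_pow, hd, map_ofNat, map_one, PowerSeries.map_C,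
    PowerSeries.map_X, ← hG] at hq
  rw [show (dispersionless : DiffPoly →+* DiffPoly) (u 0) = u 0 from dispersionless_u 0] at hq
  have hq' := congrArg (PowerSeries.derivative DiffPoly) hq
  have h4 : PowerSeries.derivative DiffPoly 4 = 0 := (PowerSeries.derivative DiffPoly).map_natCast 4
  have h2 : PowerSeries.derivative DiffPoly 2 = 0 := (PowerSeries.derivative DiffPoly).map_natCast 2
  simp only [map_sub, map_add, pow_two, Derivation.leibniz, smul_eq_mul, h4, h2,
    PowerSeries.derivative_X, PowerSeries.derivative_C, Derivation.map_one_eq_zero, map_zero] at hq'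
  have hG0 : G ≠ 0 := by
    intro h
    rw [h] at hq
    have := congrArg (PowerSeries.constantCoeff (R := DiffPoly)) hq
    simp [map_ofNat (PowerSeries.constantCoeff (R := DiffPoly))] at this
  have hq2 : (1 - 2 * PowerSeries.C (u 0) * PowerSeries.X) * PowerSeries.derivative DiffPoly G =
      PowerSeries.C (u 0) * G := by
    refine mul_left_cancel₀ (mul_ne_zero (mul_ne_zero two_ne_zero_powerSeries
      (mul_ne_zero two_ne_zero_powerSeries two_ne_zero_powerSeries)) hG0) ?_
    linear_combination hq'
  have hrec : ∀ k : ℕ, ((k : DiffPoly) + 1) * dispersionless (b (k + 1)) =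
      (2 * k + 1) * u 0 * dispersionless (b k) := by
    intro k
    have hcG : ∀ k, PowerSeries.coeff k G = dispersionless (b k) := fun k => by
      rw [hG, PowerSeries.coeff_map, bSeries, PowerSeries.coeff_mk]; rfl
    have h := congrArg (PowerSeries.coeff k) hq2
    rw [show (1 - 2 * PowerSeries.C (u 0) * PowerSeries.X) * PowerSeries.derivative DiffPoly G =
      PowerSeries.derivative DiffPoly G - PowerSeries.C (2 * u 0) *
        (PowerSeries.X * PowerSeries.derivative DiffPoly G) by
          rw [map_mul, map_ofNat]; ring, map_sub, PowerSeries.coeff_C_mul,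
      PowerSeries.coeff_C_mul, PowerSeries.coeff_derivative, hcG, hcG] at h
    cases k with
    | zero =>
      rw [PowerSeries.coeff_zero_X_mul] at h
      push_cast at h ⊢
      linear_combination h
    | succ k =>
      rw [PowerSeries.coeff_succ_X_mul, PowerSeries.coeff_derivative, hcG] at h
      push_cast at h ⊢
      linear_combination h
  induction k with
  | zero => simp [b_one, dispersionless_u]
  | succ k ih =>
    rw [Nat.factorial_succ, show 2 * (k + 1) + 1 = 2 * k + 1 + 2 by ring,
      Nat.doubleFactorial_add_two]
    have h := hrec (k + 1)
    push_cast at h ⊢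
    linear_combination (((k + 1)! : ℕ) : DiffPoly) * h + (2 * ((k : DiffPoly) + 1) + 1) * u 0 * ih

/-- The dispersionless part of b_{k+1} contributes the leading term exactly. The remainder has
degree at least one before ∂ is applied, hence at least two after. -/
theorem degreeGE_kdv (k : ℕ) :
    DegreeGE 2 (kdv k (u 0) - MvPolynomial.C (1 / (k ! : ℚ)) * u 0 ^ k * u 1) := by
  rw [degreeGE_iff]
  have hR := sub_dispersionless (b (k + 1))
  have hf : ((k + 1)! : ℚ) ≠ 0 := by positivity
  have hf' : (k ! : ℚ) ≠ 0 := by positivity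
  have hdf : (((2 * k + 1)‼ : ℕ) : ℚ) ≠ 0 := by
    exact_mod_cast (Nat.doubleFactorial_pos _).ne'
  have hb : dispersionless (b (k + 1)) =
      MvPolynomial.C (((2 * k + 1)‼ : ℕ) / ((k + 1)! : ℚ)) * u 0 ^ (k + 1) := by
    have h := congrArg (fun P => MvPolynomial.C (((k + 1)! : ℚ)⁻¹) * P) (dispersionless_b k)
    simp only [← mul_assoc] at h
    rw [← map_natCast (MvPolynomial.C (σ := ℕ) (R := ℚ)), ← map_mul, inv_mul_cancel₀ hf, map_one,
      one_mul, ← map_natCast (MvPolynomial.C (σ := ℕ) (R := ℚ)), ← map_mul] at h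
    rw [h, div_eq_inv_mul]
  have hd : kdv k (u 0) - MvPolynomial.C (1 / (k ! : ℚ)) * u 0 ^ k * u 1 =
      MvPolynomial.C ((((2 * k + 1)‼ : ℕ) : ℚ)⁻¹) *
        del (b (k + 1) - dispersionless (b (k + 1))) := by
    rw [kdv_apply, flow_u_zero, MvPolynomial.smul_eq_C_mul, map_sub, mul_sub, hb, del_mul, del_C,
      zero_mul, zero_add, Derivation.leibniz_pow, del_u, ← mul_assoc, ← map_mul]
    congr 1
    rw [show (((2 * k + 1)‼ : ℕ) : ℚ)⁻¹ * (((2 * k + 1)‼ : ℕ) / ((k + 1)! : ℚ)) =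
      1 / ((k : ℚ) + 1) / (k ! : ℚ) by
        rw [Nat.factorial_succ]; push_cast; field_simp]
    rw [Nat.add_sub_cancel, nsmul_eq_mul, smul_eq_mul,
      ← map_natCast (MvPolynomial.C (σ := ℕ) (R := ℚ)), ← mul_assoc, ← map_mul]
    rw [show 1 / ((k : ℚ) + 1) / (k ! : ℚ) * ((k + 1 : ℕ) : ℚ) = 1 / (k ! : ℚ) by
      push_cast; field_simp]
    ring
  rw [hd]
  refine WeightGE.C_mul _ ?_
  exact WeightGE.derivation (r := 1) (fun i => by
    rw [del_u]; exact_mod_cast WeightGE.u (w := fun i => (i : ℤ)) (i + 1)) hR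

theorem isKdVDerivations_kdv : IsKdVDerivations kdv where
  zero := kdv_zero
  one := by
    rw [kdv_apply, flow_u_zero, MvPolynomial.smul_eq_C_mul]
    -- The Lenard recursion gives 4∂b₂ = u₃ + 12u₀u₁, to be divided by 4 · 3!! = 12.
    have h := four_mul_del_b_succ 1
    have h4 : MvPolynomial.C (1 / 4) * (4 : DiffPoly) = 1 := by
      rw [show (4 : DiffPoly) = MvPolynomial.C 4 from (map_ofNat MvPolynomial.C 4).symm, ← map_mul]
      norm_num
    have h12 : MvPolynomial.C (1 / 12) * (12 : DiffPoly) = 1 := by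
      rw [show (12 : DiffPoly) = MvPolynomial.C 12 from (map_ofNat MvPolynomial.C 12).symm,
        ← map_mul]
      norm_num
    have h3 : (MvPolynomial.C ((((2 * 1 + 1)‼ : ℕ) : ℚ)⁻¹) : DiffPoly) =
        MvPolynomial.C (1 / 12) * 4 := by
      rw [show (4 : DiffPoly) = MvPolynomial.C 4 from (map_ofNat MvPolynomial.C 4).symm, ← map_mul]
      norm_num [Nat.doubleFactorial]
    rw [h3]
    simp only [b_one, del_u] at h
    linear_combination MvPolynomial.C (1 / 12) * h + u 0 * u 1 * h12
  leading := degreeGE_kdv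
  comm_zero k P := kdv_comm k 0 P
  comm_one k P := kdv_comm k 1 P

/-! ### Uniqueness of the KdV derivations -/

/-- The weights of the variables used to extract the lowest part of a symmetry. -/
def symmWeight (i : ℕ) : ℤ := if i = 0 then -1 else if i = 1 then 1 else 2 * i

/-- The diagonal part `uᵢ ↦ κᵢ u₁ uᵢ` of the first KdV derivation. -/
def symmDiag (i : ℕ) : ℤ := if i = 0 then 0 else if i = 1 then 1 else i + 1

/-- The weights of u₀, u₁, u₂, u₃, … are -1, 1, 4, 6, …: consecutive ones differ by at least 2. -/
theorem weightGE_del {d : ℤ} {P : DiffPoly} (hP : WeightGE symmWeight d P) :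
    WeightGE symmWeight (d + 2) (del P) := by
  refine WeightGE.derivation (fun i => ?_) hP
  rw [del_u]
  refine (WeightGE.u (i + 1)).mono ?_
  simp only [symmWeight]
  split_ifs <;> first | omega | (push_cast; omega) | simp_all

/-- The remainder of the Leibniz expansion consists of products u_a u_c with a, c ≥ 2 and a + c = i
+ 3, whose weight is 2(i + 3). -/
theorem iterate_del_u_zero_mul_u_one (i : ℕ) : ∃ R, WeightGE symmWeight (2 * (i + 2) + 2) R ∧
    del^[i + 2] (u 0 * u 1) = u 0 * u (i + 2 + 1) + ((i : DiffPoly) + 3) * u 1 * u (i + 2) + R := by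
  induction i with
  | zero =>
    refine ⟨0, WeightGE.zero, ?_⟩
    simp only [Function.iterate_succ_apply, zero_add, Function.iterate_zero, id, del_mul, del_u,
      map_add, add_zero]
    push_cast
    ring
  | succ i ih =>
    obtain ⟨R, hR, h⟩ := ih
    refine ⟨((i + 3 : ℕ) : DiffPoly) * (u 2 * u (i + 2)) + del R, ?_, ?_⟩
    · refine WeightGE.add ?_ ((weightGE_del hR).mono (by push_cast; linarith))
      rw [← map_natCast (MvPolynomial.C (σ := ℕ) (R := ℚ))]
      refine WeightGE.C_mul _ (((WeightGE.u 2).mul (WeightGE.u (i + 2))).mono ?_)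
      rw [symmWeight, symmWeight, if_neg two_ne_zero, if_neg (by norm_num), if_neg (by omega),
        if_neg (by omega)]
      push_cast
      linarith
    · have hn : del ((i : DiffPoly) + 3) = 0 := by
        have := del.map_natCast (i + 3)
        push_cast at this
        exact this
      rw [show i + 1 + 2 = i + 2 + 1 by ring, Function.iterate_succ_apply', h]
      simp only [map_add, del_mul, del_u, hn]
      push_cast
      ring

theorem iterate_del_add (i : ℕ) (P Q : DiffPoly) : del^[i] (P + Q) = del^[i] P + del^[i] Q := by
  induction i with
  | zero => rfl
  | succ i ih => rw [Function.iterate_succ_apply', ih, map_add, Function.iterate_succ_apply',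
      Function.iterate_succ_apply']

theorem iterate_del_C_mul (i : ℕ) (c : ℚ) (Q : DiffPoly) :
    del^[i] (MvPolynomial.C c * Q) = MvPolynomial.C c * del^[i] Q := by
  induction i with
  | zero => rfl
  | succ i ih => rw [Function.iterate_succ_apply', ih, del_mul, del_C, zero_mul, zero_add,
      Function.iterate_succ_apply']

/-- A derivation that commutes with `∂` and with the first KdV derivation and whose value on `u₀`
has no terms of degree less than two vanishes. -/
theorem symmetry_eq_zero {X : Derivation ℚ DiffPoly DiffPoly} (h0 : ∀ P, X (del P) = del (X P))
    (h1 : ∀ P, X (evol (u 0 * u 1 + MvPolynomial.C (1 / 12) * u 3) P) =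
      evol (u 0 * u 1 + MvPolynomial.C (1 / 12) * u 3) (X P))
    (h2 : DegreeGE 2 (X (u 0))) : X = 0 := by
  refine derivation_ext_of_comm h0 (fun P => by simp) ?_
  rw [Derivation.coe_zero, Pi.zero_apply]
  set Q := X (u 0) with hQ
  by_contra hne
  have hu : ∀ i, X (u i) = del^[i] Q := fun i => by
    conv_lhs => rw [eq_evol h0]
    exact evol_u _ _
  have heq := h1 (u 0)
  rw [evol_u, Function.iterate_zero, id, ← hQ, map_add, Derivation.leibniz, Derivation.leibniz,
    ← MvPolynomial.algebraMap_eq, Derivation.map_algebraMap, smul_zero, add_zero,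
    MvPolynomial.algebraMap_eq, hu 1, hu 3, ← hQ] at heq
  simp only [Function.iterate_succ_apply, Function.iterate_zero, id, smul_eq_mul] at heq
  set D1 := evol (u 0 * u 1 + MvPolynomial.C (1 / 12) * u 3) with hD1
  -- D₁ is split into u₀∂, which cancels in the symmetry equation, the diagonal part uᵢ ↦ κᵢu₁uᵢ,
  -- which raises the weight by 1, and N, which raises it by at least 2.
  set N : Derivation ℚ DiffPoly DiffPoly := D1 - u 0 • del - u 1 • diagDer symmDiag with hN
  have hNu : ∀ i, WeightGE symmWeight (symmWeight i + 2) (N (u i)) := by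
    intro i
    have hNi : N (u i) = del^[i] (u 0 * u 1) + MvPolynomial.C (1 / 12) * u (i + 3)
        - u 0 * u (i + 1) - u 1 * (MvPolynomial.C (symmDiag i : ℚ) * u i) := by
      rw [hN, Derivation.sub_apply, Derivation.sub_apply, Derivation.smul_apply,
        Derivation.smul_apply, hD1, evol_u, diagDer_u, del_u, smul_eq_mul, smul_eq_mul,
        iterate_del_add, iterate_del_C_mul, ← iterate_del_u 3, ← Function.iterate_add_apply,
        iterate_del_u]
    match i with
    | 0 =>
      have : N (u 0) = MvPolynomial.C (1 / 12) * u 3 := by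
        rw [hNi]; simp [symmDiag]
      rw [this]
      exact ((WeightGE.u 3).mono (by simp [symmWeight])).C_mul _
    | 1 =>
      have : N (u 1) = MvPolynomial.C (1 / 12) * u 4 := by
        rw [hNi]; simp [symmDiag, del_u]; ring
      rw [this]
      exact ((WeightGE.u 4).mono (by simp [symmWeight])).C_mul _
    | i + 2 =>
      obtain ⟨R, hR, h⟩ := iterate_del_u_zero_mul_u_one i
      have : N (u (i + 2)) = R + MvPolynomial.C (1 / 12) * u (i + 2 + 3) := by
        rw [hNi, h]
        simp only [symmDiag, Nat.add_eq_zero_iff, OfNat.ofNat_ne_zero, and_false, if_false,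
          show ¬ i + 2 = 1 by omega]
        push_cast
        rw [map_add, map_add, map_natCast, map_one, show MvPolynomial.C 2 = (2 : DiffPoly) from
          map_ofNat MvPolynomial.C 2]
        ring
      rw [this]
      refine WeightGE.add (hR.mono ?_) (((WeightGE.u _).mono ?_).C_mul _)
      · simp [symmWeight]
      · simp [symmWeight]; omega
  -- At a monomial m of minimal weight in Q, multiplication by u₁ leads to weight + 1, which neither
  -- N Q nor ∂³Q reaches.
  obtain ⟨m, hm, hmin⟩ := Finset.exists_min_image Q.support (wt symmWeight)
    (MvPolynomial.support_nonempty.2 hne)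
  have hQw : WeightGE symmWeight (wt symmWeight m) Q := hmin
  have hNQ : WeightGE symmWeight (wt symmWeight m + 2) (N Q) := WeightGE.derivation hNu hQw
  have hdQ : WeightGE symmWeight (wt symmWeight m + 2) (del (del (del Q))) :=
    (weightGE_del (weightGE_del (weightGE_del hQw))).mono (by linarith)
  have hrel : (Q - diagDer symmDiag Q) * u 1 = N Q - MvPolynomial.C (1 / 12) * del (del (del Q)) := by
    rw [hN, Derivation.sub_apply, Derivation.sub_apply, Derivation.smul_apply,
        Derivation.smul_apply, ← heq, smul_eq_mul, smul_eq_mul]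
    ring
  -- The coefficient of u₁ times m in `hrel` says that (1 - κ(m)) times the coefficient of m is
  -- zero. So κ(m) = 1, while κ(m) is at least the degree of m, which is at least 2.
  have hc := (hNQ.sub (hdQ.C_mul (1 / 12))).coeff_eq_zero (m := m + Finsupp.single 1 1) (by
    rw [wt_add, wt_single]; simp [symmWeight])
  rw [← hrel, u, MvPolynomial.coeff_mul_X, MvPolynomial.coeff_sub, coeff_diagDer] at hc
  have hcm := MvPolynomial.mem_support_iff.1 hm
  have hk : wt symmDiag m = 1 := by
    have : (1 - (wt symmDiag m : ℚ)) * MvPolynomial.coeff m Q = 0 := by linear_combination hc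
    have := (mul_eq_zero.1 this).resolve_right hcm
    have h' : (wt symmDiag m : ℚ) = 1 := by linarith
    exact_mod_cast h'
  have hdeg := (degreeGE_iff 2 Q).1 h2 m hm
  have hle : wt (fun i => (i : ℤ)) m ≤ wt symmDiag m := by
    refine Finset.sum_le_sum fun i _ => mul_le_mul_of_nonneg_left ?_ (by positivity)
    simp only [symmDiag]
    split_ifs <;> omega
  push_cast at hdeg
  omega

/-- In the difference of two candidates the prescribed leading terms cancel, leaving a symmetry of
KdV to which `symmetry_eq_zero` applies. -/
theorem isKdVDerivations_unique {D D' : ℕ → Derivation ℚ DiffPoly DiffPoly}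
    (h : IsKdVDerivations D) (h' : IsKdVDerivations D') : D = D' := by
  have h1 : ∀ {D : ℕ → Derivation ℚ DiffPoly DiffPoly}, IsKdVDerivations D →
      D 1 = evol (u 0 * u 1 + MvPolynomial.C (1 / 12) * u 3) := fun {D} h => by
    have hc : ∀ P, D 1 (del P) = del (D 1 P) := by
      rw [← h.zero]; exact h.comm_zero 1
    rw [eq_evol hc, h.one]
  funext k
  rw [← sub_eq_zero]
  refine symmetry_eq_zero (fun P => ?_) (fun P => ?_) ?_
  · rw [Derivation.sub_apply, Derivation.sub_apply, map_sub]
    congr 1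
    · rw [← h.zero, h.comm_zero]
    · rw [← h'.zero, h'.comm_zero]
  · rw [Derivation.sub_apply, Derivation.sub_apply, map_sub]
    congr 1
    · rw [← h1 h, h.comm_one]
    · rw [← h1 h', h'.comm_one]
  · rw [Derivation.sub_apply, degreeGE_iff]
    have e := ((degreeGE_iff _ _).1 (h.leading k)).sub ((degreeGE_iff _ _).1 (h'.leading k))
    rwa [sub_sub_sub_cancel_right] at e

/-! ### The Euler derivation -/

/-- The derivation `uᵢ ↦ (i + 2) uᵢ`, whose eigenvectors are the weighted homogeneous
differential polynomials. -/
def euler : Derivation ℚ DiffPoly DiffPoly := diagDer fun i => i + 2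

theorem euler_u (i : ℕ) : euler (u i) = ((i : DiffPoly) + 2) * u i := by
  rw [euler, diagDer_u]
  push_cast
  rw [map_add, map_natCast, show MvPolynomial.C 2 = (2 : DiffPoly) from map_ofNat MvPolynomial.C 2]

theorem derivation_mul (δ : Derivation ℚ DiffPoly DiffPoly) (P Q : DiffPoly) :
    δ (P * Q) = δ P * Q + P * δ Q := by
  rw [Derivation.leibniz, smul_eq_mul, smul_eq_mul]; ring

theorem euler_del (P : DiffPoly) : euler (del P) = del (euler P) + del P := by
  have h : ⁅euler, del⁆ = del := derivation_ext fun i => by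
    have hn : del ((i : DiffPoly) + 2) = 0 := by exact_mod_cast del.map_natCast (i + 2)
    rw [Derivation.commutator_apply, del_u, euler_u, euler_u, derivation_mul, hn, del_u]
    push_cast
    ring
  have h2 := congrArg (fun δ : Derivation ℚ DiffPoly DiffPoly => δ P) h
  simp only [Derivation.commutator_apply] at h2
  linear_combination h2

/-- With uᵢ of weight i + 2, the derivation ∂ raises the weight by 1, and every term of the
recursion for b_{k+1} has weight 2k + 2. -/
theorem euler_b (k : ℕ) : euler (b k) = 2 * (k : DiffPoly) * b k := by
  induction k using Nat.strong_induction_on with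
  | _ k ih =>
    cases k with
    | zero => simp [b_zero]
    | succ k =>
      have h8 : (8 : DiffPoly) ≠ 0 := by norm_num
      refine mul_left_cancel₀ h8 ?_
      have h := congrArg euler (eight_mul_b_succ k)
      have e1 : ∑ x ∈ Finset.HasAntidiagonal.antidiagonal k, euler (b x.1 * b x.2) =
          2 * (k : DiffPoly) * ∑ x ∈ Finset.HasAntidiagonal.antidiagonal k, b x.1 * b x.2 := by
        rw [Finset.mul_sum]
        refine Finset.sum_congr rfl fun x hx => ?_
        have hx' := Finset.HasAntidiagonal.mem_antidiagonal.1 hx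
        rw [derivation_mul, ih x.1 (by omega), ih x.2 (by omega), ← hx']
        push_cast
        ring
      have e2 : ∑ x ∈ Finset.HasAntidiagonal.antidiagonal k, euler (b x.1 * del (del (b x.2))) =
          2 * ((k : DiffPoly) + 1) *
            ∑ x ∈ Finset.HasAntidiagonal.antidiagonal k, b x.1 * del (del (b x.2)) := by
        rw [Finset.mul_sum]
        refine Finset.sum_congr rfl fun x hx => ?_
        have hx' := Finset.HasAntidiagonal.mem_antidiagonal.1 hx
        have hn : ∀ n : ℕ, del (2 * (n : DiffPoly)) = 0 := fun n => by
          exact_mod_cast del.map_natCast (2 * n)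
        rw [derivation_mul, euler_del, euler_del, ih x.1 (by omega), ih x.2 (by omega), ← hx',
          del_mul, hn, zero_mul, zero_add, map_add, del_mul, hn]
        push_cast
        ring
      have e3 : ∑ x ∈ Finset.HasAntidiagonal.antidiagonal k, euler (del (b x.1) * del (b x.2)) =
          2 * ((k : DiffPoly) + 1) *
            ∑ x ∈ Finset.HasAntidiagonal.antidiagonal k, del (b x.1) * del (b x.2) := by
        rw [Finset.mul_sum]
        refine Finset.sum_congr rfl fun x hx => ?_
        have hx' := Finset.HasAntidiagonal.mem_antidiagonal.1 hx
        have hn : ∀ n : ℕ, del (2 * (n : DiffPoly)) = 0 := fun n => by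
          exact_mod_cast del.map_natCast (2 * n)
        rw [derivation_mul, euler_del, euler_del, ih x.1 (by omega), ih x.2 (by omega), ← hx',
          del_mul, hn, del_mul, hn]
        push_cast
        ring
      have e4 : ∑ i ∈ Finset.range k, euler (b (i + 1) * b (k - i)) =
          2 * ((k : DiffPoly) + 1) * ∑ i ∈ Finset.range k, b (i + 1) * b (k - i) := by
        rw [Finset.mul_sum]
        refine Finset.sum_congr rfl fun i hi => ?_
        have hi' := Finset.mem_range.1 hi
        rw [derivation_mul, ih (i + 1) (by omega), ih (k - i) (by omega), Nat.cast_sub hi'.le]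
        push_cast
        ring
      have c2 : euler 2 = 0 := euler.map_natCast 2
      have c4 : euler 4 = 0 := euler.map_natCast 4
      have c8 : euler 8 = 0 := euler.map_natCast 8
      simp only [map_add, map_sub, derivation_mul euler (OfNat.ofNat _), derivation_mul euler (_ * _),
        c2, c4, c8, map_sum, e1, e2, e3, e4, euler_u] at h
      push_cast at h ⊢
      linear_combination h - 2 * ((k : DiffPoly) + 1) * eight_mul_b_succ k

theorem del_natCast_mul (n : ℕ) (P : DiffPoly) :
    del ((n : DiffPoly) * P) = (n : DiffPoly) * del P := by
  rw [del_mul, del.map_natCast, zero_mul, zero_add]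

/-- Both sides of [E, flow_k] = (2k+1) flow_k commute with ∂, so u₀ suffices: it has weight 2 and
∂b_{k+1} has weight 2k + 3. -/
theorem euler_flow (k : ℕ) (P : DiffPoly) :
    euler (flow k P) = flow k (euler P) + (2 * (k : DiffPoly) + 1) * flow k P := by
  have hn : ∀ δ : Derivation ℚ DiffPoly DiffPoly, δ (2 * (k : DiffPoly) + 1) = 0 := fun δ => by
    exact_mod_cast δ.map_natCast (2 * k + 1)
  have h : ⁅euler, flow k⁆ = (2 * (k : DiffPoly) + 1) • flow k := derivation_ext_of_comm
    (fun P => by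
      simp only [Derivation.commutator_apply, flow_del, euler_del, map_sub, map_add]
      ring)
    (fun P => by
      simp only [Derivation.smul_apply, flow_del, smul_eq_mul, derivation_mul, hn]
      ring)
    (by
      have h2 : flow k 2 = 0 := (flow k).map_natCast 2
      simp only [Derivation.commutator_apply, flow_u_zero, euler_del, euler_u, euler_b,
        Derivation.smul_apply, smul_eq_mul, Nat.cast_zero, zero_add, derivation_mul (flow k), h2]
      have := del_natCast_mul (2 * (k + 1)) (b (k + 1))
      push_cast at this ⊢
      linear_combination this)
  have h2 := congrArg (fun δ : Derivation ℚ DiffPoly DiffPoly => δ P) h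
  simp only [Derivation.commutator_apply, Derivation.smul_apply, smul_eq_mul] at h2
  linear_combination h2

theorem constantCoeff_euler (P : DiffPoly) : MvPolynomial.constantCoeff (euler P) = 0 :=
  ringHom_comp_derivation _ (fun i => by rw [euler_u, map_mul, constantCoeff_u, mul_zero]) P

theorem euler_scaledTau (p q : ℕ) :
    euler (scaledTau p q) = (2 * (p : DiffPoly) + 2 * q + 2) * scaledTau p q := by
  refine eq_of_del_eq ?_ (by
    rw [constantCoeff_euler, map_mul, constantCoeff_scaledTau, mul_zero])
  have h := euler_del (scaledTau p q)
  rw [del_scaledTau, euler_flow, euler_b, derivation_mul] at h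
  have hn : flow q (2 * ((p + 1 : ℕ) : DiffPoly)) = 0 := by
    exact_mod_cast (flow q).map_natCast (2 * (p + 1))
  rw [hn] at h
  have h1 := del_natCast_mul (2 * p + 2 * q + 2) (scaledTau p q)
  push_cast at h h1
  rw [h1, del_scaledTau]
  linear_combination -h

theorem euler_kdv (k : ℕ) (P : DiffPoly) :
    euler (kdv k P) = kdv k (euler P) + (2 * (k : DiffPoly) + 1) * kdv k P := by
  rw [kdv_apply, kdv_apply, Derivation.map_smul, euler_flow, smul_add, mul_smul_comm]

theorem euler_tau (p q : ℕ) : euler (tau p q) = (2 * (p : DiffPoly) + 2 * q + 2) * tau p q := by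
  rw [tau, Derivation.map_smul, euler_scaledTau, mul_smul_comm]

/-! ### Evaluation at the initial data -/

/-- Evaluation of a differential polynomial on the function `C / (x - 1)²` at `x = 0`. -/
def evalInit (C : ℂ) : DiffPoly →ₐ[ℚ] ℂ := MvPolynomial.aeval fun i => C * ((i + 1)! : ℂ)

theorem evalInit_u (C : ℂ) (i : ℕ) : evalInit C (u i) = C * ((i + 1)! : ℂ) :=
  MvPolynomial.aeval_X _ _

/-- This is the homogeneity of C/(x-1)². On the variables it says (i+2)! = (i+2)(i+1)!, and both
sides are derivations along the evaluation. It converts every derivative at the origin into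
multiplication by a weight. -/
theorem evalInit_del (C : ℂ) (P : DiffPoly) : evalInit C (del P) = evalInit C (euler P) := by
  have h := ringHom_comp_derivation (evalInit C : DiffPoly →+* ℂ) (δ := del - euler) (fun i => by
    rw [Derivation.sub_apply, del_u, euler_u, map_sub, map_mul]
    simp only [RingHom.coe_coe, evalInit_u, map_add, map_natCast, map_ofNat]
    rw [Nat.factorial_succ (i + 1)]
    push_cast
    ring) P
  rw [Derivation.sub_apply, map_sub] at h
  exact sub_eq_zero.1 h

/-! ### Iterated KdV derivations -/

instance : LeftCommutative fun (k : ℕ) (P : DiffPoly) => kdv k P := ⟨kdv_comm⟩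

/-- The composition of the KdV derivations with indices in a multiset. -/
def kdvIter (s : Multiset ℕ) (P : DiffPoly) : DiffPoly := s.foldr (fun k P => kdv k P) P

theorem kdvIter_zero (P : DiffPoly) : kdvIter 0 P = P := rfl

theorem kdvIter_cons (k : ℕ) (s : Multiset ℕ) (P : DiffPoly) :
    kdvIter (k ::ₘ s) P = kdv k (kdvIter s P) := Multiset.foldr_cons _ _ _ _

theorem kdvIter_kdv (k : ℕ) (s : Multiset ℕ) (P : DiffPoly) :
    kdvIter s (kdv k P) = kdv k (kdvIter s P) := by
  induction s using Multiset.induction_on with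
  | empty => rfl
  | cons l s ih => rw [kdvIter_cons, kdvIter_cons, ih, kdv_comm]

theorem kdvIter_add (s : Multiset ℕ) (P Q : DiffPoly) :
    kdvIter s (P + Q) = kdvIter s P + kdvIter s Q := by
  induction s using Multiset.induction_on with
  | empty => rfl
  | cons l s ih => rw [kdvIter_cons, kdvIter_cons, kdvIter_cons, ih, map_add]

theorem kdvIter_smul (s : Multiset ℕ) (c : ℚ) (P : DiffPoly) :
    kdvIter s (c • P) = c • kdvIter s P := by
  induction s using Multiset.induction_on with
  | empty => rfl
  | cons l s ih => rw [kdvIter_cons, kdvIter_cons, ih, Derivation.map_smul]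

theorem euler_kdvIter (s : Multiset ℕ) (P : DiffPoly) : euler (kdvIter s P) =
    kdvIter s (euler P) + (((s.map fun k => 2 * k + 1).sum : ℕ) : DiffPoly) * kdvIter s P := by
  induction s using Multiset.induction_on with
  | empty => simp [kdvIter_zero]
  | cons l s ih =>
    rw [kdvIter_cons, kdvIter_cons, euler_kdv, ih, map_add, derivation_mul, Derivation.map_natCast,
      Multiset.map_cons, Multiset.sum_cons]
    push_cast
    ring

/-! ### Time series -/

theorem coeff_dt (k : ℕ) (f : TimeSeries) (n : ℕ →₀ ℕ) : MvPowerSeries.coeff n (dt k f) =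
    MvPowerSeries.coeff (n + Finsupp.single k 1) f * (n k + 1) :=
  MvPowerSeries.coeff_pderiv _ _

theorem dt_add (k : ℕ) (f g : TimeSeries) : dt k (f + g) = dt k f + dt k g := map_add _ _ _

theorem dt_sub (k : ℕ) (f g : TimeSeries) : dt k (f - g) = dt k f - dt k g := map_sub _ _ _

theorem dt_mul (k : ℕ) (f g : TimeSeries) : dt k (f * g) = dt k f * g + f * dt k g := by
  rw [dt, Derivation.leibniz, smul_eq_mul, smul_eq_mul]
  simp only [dt]
  ring

theorem dt_C_mul (k : ℕ) (c : ℂ) (f : TimeSeries) :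
    dt k (MvPowerSeries.C c * f) = MvPowerSeries.C c * dt k f := by
  rw [dt_mul, dt, MvPowerSeries.pderiv_C, zero_mul, zero_add]

theorem dt_C (k : ℕ) (c : ℂ) : dt k (MvPowerSeries.C c) = 0 := MvPowerSeries.pderiv_C

theorem timeSeries_ext {f g : TimeSeries} (h : ∀ k, dt k f = dt k g)
    (hc : MvPowerSeries.constantCoeff f = MvPowerSeries.constantCoeff g) : f = g :=
  MvPowerSeries.pderiv.ext h hc

/-- The product of the factorials of the exponents. -/
def multiFactorial (m : ℕ →₀ ℕ) : ℂ := m.prod fun _ e => (e ! : ℂ)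

theorem multiFactorial_ne_zero (m : ℕ →₀ ℕ) : multiFactorial m ≠ 0 :=
  Finset.prod_ne_zero_iff.2 fun _ _ => Nat.cast_ne_zero.2 (Nat.factorial_ne_zero _)

theorem multiFactorial_add_single (m : ℕ →₀ ℕ) (k : ℕ) :
    multiFactorial (m + Finsupp.single k 1) = multiFactorial m * (m k + 1) := by
  have h0 : ∀ i ∈ insert k m.support, ((0 ! : ℕ) : ℂ) = 1 := fun _ _ => by simp
  have hs : (m + Finsupp.single k 1).support ⊆ insert k m.support := by
    intro i hi
    by_cases h : i = k
    · simp [h]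
    · refine Finset.mem_insert_of_mem (Finsupp.mem_support_iff.2 ?_)
      simpa [Finsupp.single_apply, Ne.symm h] using hi
  rw [multiFactorial, multiFactorial, Finsupp.prod_of_support_subset _ hs _ h0,
    Finsupp.prod_of_support_subset _ (Finset.subset_insert k _) _ h0,
    ← Finset.mul_prod_erase _ _ (Finset.mem_insert_self k _),
    ← Finset.mul_prod_erase (insert k m.support) (fun i => ((m i)! : ℂ))
      (Finset.mem_insert_self k _)]
  have he : ∀ i ∈ (insert k m.support).erase k, ((((m + Finsupp.single k 1 : ℕ →₀ ℕ) i)! : ℕ) : ℂ) = ((m i)! : ℂ) :=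
    fun i hi => by
      simp [Ne.symm (Finset.ne_of_mem_erase hi)]
  rw [Finset.prod_congr rfl he]
  simp only [Finsupp.add_apply, Finsupp.single_eq_same, Nat.factorial_succ]
  push_cast
  ring

/-- The value of a differential polynomial on the solution of the KdV hierarchy with the initial
data `C / (x - 1)²`, as a Taylor series in the times. -/
def flowSeries (C : ℂ) (P : DiffPoly) : TimeSeries :=
  fun m => evalInit C (kdvIter (Finsupp.toMultiset m) P) / multiFactorial m

theorem coeff_flowSeries (C : ℂ) (P : DiffPoly) (m : ℕ →₀ ℕ) :
    MvPowerSeries.coeff m (flowSeries C P) =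
      evalInit C (kdvIter (Finsupp.toMultiset m) P) / multiFactorial m := rfl

theorem constantCoeff_flowSeries (C : ℂ) (P : DiffPoly) :
    MvPowerSeries.constantCoeff (flowSeries C P) = evalInit C P := by
  rw [← MvPowerSeries.coeff_zero_eq_constantCoeff_apply, coeff_flowSeries]
  simp [multiFactorial, kdvIter_zero]

theorem dt_flowSeries (C : ℂ) (k : ℕ) (P : DiffPoly) :
    dt k (flowSeries C P) = flowSeries C (kdv k P) := by
  ext m
  have h1 : (m k : ℂ) + 1 ≠ 0 := Nat.cast_add_one_ne_zero _
  rw [coeff_dt, coeff_flowSeries, coeff_flowSeries, multiFactorial_add_single,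
    Finsupp.toMultiset_add, Finsupp.toMultiset_single, one_smul, add_comm, Multiset.singleton_add,
    kdvIter_cons, kdvIter_kdv]
  field_simp [multiFactorial_ne_zero m]

theorem flowSeries_add (C : ℂ) (P Q : DiffPoly) :
    flowSeries C (P + Q) = flowSeries C P + flowSeries C Q := by
  ext m
  rw [map_add, coeff_flowSeries, coeff_flowSeries, coeff_flowSeries, kdvIter_add, map_add, add_div]

theorem flowSeries_smul (C : ℂ) (c : ℚ) (P : DiffPoly) :
    flowSeries C (c • P) = c • flowSeries C P := by
  ext m
  rw [show MvPowerSeries.coeff m (c • flowSeries C P) =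
    c • MvPowerSeries.coeff m (flowSeries C P) from rfl, coeff_flowSeries, coeff_flowSeries,
    kdvIter_smul, map_smul, smul_div_assoc]

/-- The order zero coefficients agree because evaluation is multiplicative. A ∂/∂tₖ of the defect is
a sum of two defects of the same kind, as the flows are derivations, so induction on the total
degree applies to all pairs P, Q at once. -/
theorem flowSeries_mul (C : ℂ) (P Q : DiffPoly) :
    flowSeries C (P * Q) = flowSeries C P * flowSeries C Q := by
  rw [← sub_eq_zero]
  ext m
  rw [map_zero]
  induction hd : m.degree generalizing m P Q with
  | zero =>
    rw [(Finsupp.degree_eq_zero_iff m).1 hd, MvPowerSeries.coeff_zero_eq_constantCoeff_apply,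
      map_sub, map_mul, constantCoeff_flowSeries, constantCoeff_flowSeries,
      constantCoeff_flowSeries, map_mul, sub_self]
  | succ d ih =>
    obtain ⟨k, hk⟩ : ∃ k, m k ≠ 0 := by
      by_contra! hc
      have : m = 0 := Finsupp.ext hc
      simp [this] at hd
    obtain ⟨n, rfl⟩ : ∃ n, m = n + Finsupp.single k 1 :=
      ⟨m - Finsupp.single k 1, (tsub_add_cancel_of_le
        (Finsupp.single_le_iff.2 (Nat.one_le_iff_ne_zero.2 hk))).symm⟩
    have hn : n.degree = d := by simpa using hd
    have h := coeff_dt k (flowSeries C (P * Q) - flowSeries C P * flowSeries C Q) n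
    rw [dt_sub, dt_mul, dt_flowSeries, dt_flowSeries, dt_flowSeries, derivation_mul, flowSeries_add,
      add_sub_add_comm, map_add, ih _ _ n hn, ih _ _ n hn, add_zero] at h
    exact (mul_eq_zero.1 h.symm).resolve_right (Nat.cast_add_one_ne_zero _)

theorem flowSeries_one (C : ℂ) : flowSeries C 1 = 1 := by
  refine timeSeries_ext (fun k => ?_) ?_
  · rw [dt_flowSeries, Derivation.map_one_eq_zero, ← map_one MvPowerSeries.C, dt_C]
    simpa using flowSeries_smul C 0 0
  · rw [constantCoeff_flowSeries, map_one, map_one]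

/-- `flowSeries` as an algebra homomorphism. -/
def flowHom (C : ℂ) : DiffPoly →ₐ[ℚ] TimeSeries :=
  AlgHom.ofLinearMap
    { toFun := flowSeries C
      map_add' := flowSeries_add C
      map_smul' := flowSeries_smul C } (flowSeries_one C) (flowSeries_mul C)

/-- Both are algebra homomorphisms, and since D₀ = ∂ they send uᵢ to the same x-derivative. -/
theorem evalJet_flowSeries (C : ℂ) (P : DiffPoly) :
    evalJet (flowSeries C (u 0)) P = flowSeries C P := by
  have h : evalJet (flowSeries C (u 0)) = flowHom C := by
    refine MvPolynomial.algHom_ext fun i => ?_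
    rw [evalJet, MvPolynomial.aeval_X]
    change _ = flowSeries C (u i)
    induction i with
    | zero => rfl
    | succ i ih => rw [Function.iterate_succ_apply', ih, dt_flowSeries, kdv_zero, del_u]
  rw [h]
  rfl

/-! ### The solution with initial data C/(x-1)². -/

theorem X_sub_one_sq_inv :
    ((PowerSeries.X - 1 : PowerSeries ℂ) ^ 2)⁻¹ = PowerSeries.mk fun m => (m : ℂ) + 1 := by
  rw [PowerSeries.inv_eq_iff_mul_eq_one (by simp)]
  have h : (PowerSeries.mk fun m => (m : ℂ) + 1) * (1 - PowerSeries.X) = PowerSeries.mk 1 := by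
    ext m
    rw [mul_sub, mul_one, map_sub]
    cases m with
    | zero => simp
    | succ m => simp [PowerSeries.coeff_succ_mul_X]
  rw [show (PowerSeries.X - 1 : PowerSeries ℂ) ^ 2 = (1 - PowerSeries.X) * (1 - PowerSeries.X) by
    ring, ← mul_assoc, h, PowerSeries.mk_one_mul_one_sub_eq_one]

theorem coeff_bgwInitial (C : ℂ) (m : ℕ) :
    PowerSeries.coeff m (bgwInitial C) = C * ((m : ℂ) + 1) := by
  rw [bgwInitial, X_sub_one_sq_inv, PowerSeries.coeff_C_mul, PowerSeries.coeff_mk]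

theorem isBGWSolution_flowSeries (C : ℂ) : IsBGWSolution kdv C (flowSeries C (u 0)) := by
  refine ⟨fun k => by rw [evalJet_flowSeries, dt_flowSeries], ?_⟩
  ext m
  rw [initialData, PowerSeries.coeff_mk, coeff_bgwInitial, coeff_flowSeries, multiFactorial,
    Finsupp.prod_single_index (by simp), Finsupp.toMultiset_single]
  have h : kdvIter (m • {0}) (u 0) = u m := by
    induction m with
    | zero => simp [kdvIter_zero]
    | succ m ih =>
      rw [succ_nsmul', Multiset.singleton_add, kdvIter_cons, ih, kdv_zero, del_u]
  rw [h, evalInit_u, Nat.factorial_succ]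
  have : (m ! : ℂ) ≠ 0 := by exact_mod_cast (Nat.factorial_pos _).ne'
  push_cast
  field_simp

/-- A differential polynomial is evaluated at the origin of any solution with the given initial
data by `evalInit`. -/
theorem constantCoeff_evalJet {D : ℕ → Derivation ℚ DiffPoly DiffPoly} {C : ℂ} {U : TimeSeries}
    (h : IsBGWSolution D C U) (P : DiffPoly) :
    MvPowerSeries.constantCoeff (evalJet U P) = evalInit C P := by
  -- Only the restriction to the x-axis enters the x-derivatives at the origin. Hence values at t =
  -- 0 are the same for every solution with this initial data, and no uniqueness of solutions is
  -- needed.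
  have hU : ∀ i m, MvPowerSeries.coeff (Finsupp.single 0 m) ((dt 0)^[i] U) =
      C * (((m + i + 1)! : ℂ) / (m ! : ℂ)) := by
    intro i
    induction i with
    | zero =>
      intro m
      have h1 := congrArg (PowerSeries.coeff m) h.2
      rw [initialData, PowerSeries.coeff_mk, coeff_bgwInitial] at h1
      have : (m ! : ℂ) ≠ 0 := by exact_mod_cast (Nat.factorial_pos _).ne'
      rw [Function.iterate_zero, id, h1, add_zero, Nat.factorial_succ]
      push_cast
      field_simp
    | succ i ih =>
      intro m
      rw [Function.iterate_succ_apply', coeff_dt, ← Finsupp.single_add, ih,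
        show m + 1 + i + 1 = m + (i + 1) + 1 by ring, Nat.factorial_succ m]
      have : (m ! : ℂ) ≠ 0 := by exact_mod_cast (Nat.factorial_pos _).ne'
      have h1 : (m : ℂ) + 1 ≠ 0 := Nat.cast_add_one_ne_zero _
      push_cast
      rw [Finsupp.single_eq_same]
      field_simp
  induction P using MvPolynomial.induction_on with
  | C a =>
    rw [← MvPolynomial.algebraMap_eq, AlgHom.commutes, AlgHom.commutes]
    exact RingHom.congr_fun (Subsingleton.elim
      ((MvPowerSeries.constantCoeff (σ := ℕ) (R := ℂ)).comp (algebraMap ℚ TimeSeries))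
      (algebraMap ℚ ℂ)) a
  | add p q hp hq => rw [map_add, map_add, map_add, hp, hq]
  | mul_X p i hp =>
    rw [map_mul, map_mul, map_mul, hp, show (MvPolynomial.X i : DiffPoly) = u i from rfl,
      evalInit_u]
    congr 1
    have := hU i 0
    rw [Finsupp.single_zero, MvPowerSeries.coeff_zero_eq_constantCoeff_apply] at this
    rw [u, evalJet, MvPolynomial.aeval_X, this]
    simp

/-! ### The logarithm of the tau-function -/

/-- The Poincaré lemma for formal power series in the times. -/
theorem exists_potential {H : ℕ → TimeSeries} (hH : ∀ p q, dt q (H p) = dt p (H q)) (c : ℂ) :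
    ∃ F : TimeSeries, (∀ p, dt p F = H p) ∧ MvPowerSeries.constantCoeff F = c := by
  classical
  -- The coefficient at m ≠ 0 is read off from Hₚ for some chosen index p with m p ≠ 0; closedness
  -- makes the choice irrelevant. The constant term is free.
  set F : TimeSeries := fun m => if h : ∃ i, m i ≠ 0 then
    MvPowerSeries.coeff (m - Finsupp.single h.choose 1) (H h.choose) / (m h.choose : ℂ) else c
    with hF
  have hFm : ∀ m : ℕ →₀ ℕ, (∃ i, m i ≠ 0) → ∃ p, m p ≠ 0 ∧ MvPowerSeries.coeff m F =
      MvPowerSeries.coeff (m - Finsupp.single p 1) (H p) / (m p : ℂ) := fun m h =>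
    ⟨h.choose, h.choose_spec, dif_pos h⟩
  refine ⟨F, fun q => ?_, ?_⟩
  · ext n
    rw [coeff_dt]
    obtain ⟨p, hp, h⟩ := hFm (n + Finsupp.single q 1) ⟨q, by simp⟩
    rw [h]
    have hq0 : (n q : ℂ) + 1 ≠ 0 := Nat.cast_add_one_ne_zero _
    by_cases hpq : p = q
    · subst hpq
      rw [add_tsub_cancel_right]
      simp only [Finsupp.add_apply, Finsupp.single_eq_same]
      push_cast
      field_simp
    · have hnp : n p ≠ 0 := by
        simpa [Finsupp.single_apply, Ne.symm hpq] using hp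
      obtain ⟨n', rfl⟩ : ∃ n', n = n' + Finsupp.single p 1 :=
        ⟨n - Finsupp.single p 1, (tsub_add_cancel_of_le
          (Finsupp.single_le_iff.2 (Nat.one_le_iff_ne_zero.2 hnp))).symm⟩
      have h := congrArg (MvPowerSeries.coeff n') (hH p q)
      rw [coeff_dt, coeff_dt] at h
      rw [add_right_comm, add_tsub_cancel_right]
      simp only [Finsupp.add_apply, Finsupp.single_eq_same, Finsupp.single_apply, if_neg hpq,
        if_neg (Ne.symm hpq), add_zero] at hq0 ⊢
      have hp0 : (n' p : ℂ) + 1 ≠ 0 := Nat.cast_add_one_ne_zero _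
      push_cast
      field_simp
      linear_combination h
  · rw [← MvPowerSeries.coeff_zero_eq_constantCoeff_apply]
    exact dif_neg (by simp)

/-- The operator `∑ (1 + 2 i) tᵢ ∂/∂tᵢ`. -/
def scaling (F : TimeSeries) : TimeSeries :=
  fun m => (((Finsupp.toMultiset m).map fun k => 2 * k + 1).sum : ℕ) * MvPowerSeries.coeff m F

theorem coeff_scaling (F : TimeSeries) (m : ℕ →₀ ℕ) : MvPowerSeries.coeff m (scaling F) =
    (((Finsupp.toMultiset m).map fun k => 2 * k + 1).sum : ℕ) * MvPowerSeries.coeff m F := by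
  rfl

theorem scalingSum_dt (F : TimeSeries) : scalingSum (fun i => dt i F) = scaling F := by
  ext m
  rw [coeff_scaling]
  change ∑ i ∈ m.support, _ = _
  have h : (((Finsupp.toMultiset m).map fun k => 2 * k + 1).sum : ℕ) =
      ∑ i ∈ m.support, m i * (2 * i + 1) := by
    rw [Finset.sum_multiset_map_count, Finsupp.toFinset_toMultiset]
    simp [Finsupp.count_toMultiset]
  rw [h, Nat.cast_sum, Finset.sum_mul]
  refine Finset.sum_congr rfl fun i hi => ?_
  obtain ⟨n, rfl⟩ : ∃ n, m = Finsupp.single i 1 + n :=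
    ⟨m - Finsupp.single i 1, (add_tsub_cancel_of_le
      (Finsupp.single_le_iff.2 (Nat.one_le_iff_ne_zero.2 (Finsupp.mem_support_iff.1 hi)))).symm⟩
  rw [MvPowerSeries.X, MvPowerSeries.coeff_add_monomial_mul, coeff_dt, add_comm n]
  simp only [Finsupp.add_apply, Finsupp.single_eq_same]
  push_cast
  ring

theorem dt_scaling (p : ℕ) (F : TimeSeries) :
    dt p (scaling F) = scaling (dt p F) + MvPowerSeries.C (2 * (p : ℂ) + 1) * dt p F := by
  ext n
  rw [map_add, MvPowerSeries.coeff_C_mul, coeff_dt, coeff_scaling, coeff_scaling, coeff_dt,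
    Finsupp.toMultiset_add, Multiset.map_add, Multiset.sum_add, Finsupp.toMultiset_single, one_smul,
    Multiset.map_singleton, Multiset.sum_singleton]
  push_cast
  ring

theorem constantCoeff_scaling (F : TimeSeries) :
    MvPowerSeries.constantCoeff (scaling F) = 0 := by
  rw [← MvPowerSeries.coeff_zero_eq_constantCoeff_apply, coeff_scaling]
  simp

/-- The coefficient at m is the value of an iterated flow. There ∂ equals the Euler derivation,
whose commutators with the flows sum up to exactly the weight Σ (2k+1) that defines the scaling
operator. -/
theorem scaling_flowSeries (C : ℂ) (P : DiffPoly) :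
    scaling (flowSeries C P) = flowSeries C (del P) - flowSeries C (euler P) := by
  ext m
  rw [map_sub, coeff_scaling, coeff_flowSeries, coeff_flowSeries, coeff_flowSeries, ← kdv_zero,
    kdvIter_kdv, kdv_zero, evalInit_del, euler_kdvIter, map_add, map_mul, map_natCast]
  ring

theorem flowSeries_natCast_mul (C : ℂ) (n : ℕ) (P : DiffPoly) :
    flowSeries C ((n : DiffPoly) * P) = MvPowerSeries.C (n : ℂ) * flowSeries C P := by
  rw [flowSeries_mul, map_natCast, show flowSeries C (n : DiffPoly) = n from
    map_natCast (flowHom C) n]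

/-- The derivatives of the string equation at the origin. -/
theorem onePoint_eq {D : ℕ → Derivation ℚ DiffPoly DiffPoly} {Ω : ℕ → ℕ → DiffPoly} {C : ℂ}
    {U F : TimeSeries} (hU : IsBGWSolution D C U) (hF : IsLogTau Ω U F) (hs : StringEquation C F)
    (p : ℕ) : (2 * (p : ℂ) + 1) * onePoint F p = evalInit C (Ω p 0) := by
  rw [StringEquation, scalingSum_dt] at hs
  have h := congrArg (fun f => MvPowerSeries.constantCoeff (dt p f)) hs
  simp only [dt_add, dt_C, add_zero, dt_scaling, map_add, constantCoeff_scaling, zero_add, map_mul,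
    MvPowerSeries.constantCoeff_C, hF p 0, constantCoeff_evalJet hU] at h
  exact h

/-- The Poincaré lemma is applied twice, first for the gradient H of log τ and then for log τ
itself. The string equation is checked by differentiating it twice: the weight 2p + 2q + 2 of
Ω_{p,q} cancels the shifts 2p + 1 and 2q + 1 of the scaling operator. -/
theorem exists_logTau (C : ℂ) :
    ∃ F, IsLogTau tau (flowSeries C (u 0)) F ∧ StringEquation C F := by
  have hτ := isCanonicalTauStructure_tau
  -- The constant of Hₚ is the only one that satisfies the t_p-derivative of the string equation at
  -- the origin. For p = 0 it equals C, as the undifferentiated equation requires.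
  have h1 : ∀ p, ∃ H : TimeSeries, (∀ q, dt q H = flowSeries C (tau p q)) ∧
      MvPowerSeries.constantCoeff H = evalInit C (tau p 0) / (2 * (p : ℂ) + 1) := fun p =>
    exists_potential (fun q r => by rw [dt_flowSeries, dt_flowSeries, hτ.closed]) _
  choose H hH hc using h1
  obtain ⟨F, hF, -⟩ := exists_potential (H := H) (fun p q => by rw [hH, hH, hτ.symm]) 0
  refine ⟨F, fun p q => by rw [hF, hH, evalJet_flowSeries, hτ.symm], ?_⟩
  rw [StringEquation, scalingSum_dt]
  have hp : ∀ p : ℕ, (2 * (p : ℂ) + 1) ≠ 0 := fun p => by exact_mod_cast Nat.succ_ne_zero (2 * p)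
  refine timeSeries_ext (fun p => ?_) ?_
  · rw [dt_add, dt_C, add_zero, dt_scaling, hF, hF, hH]
    refine timeSeries_ext (fun q => ?_) ?_
    · rw [dt_add, dt_scaling, dt_C_mul, hH, scaling_flowSeries, euler_tau, dt_flowSeries,
        hτ.symm 0 p, hτ.closed p 0 q, kdv_zero]
      have e := flowSeries_natCast_mul C (2 * p + 2 * q + 2) (tau p q)
      push_cast at e
      rw [e]
      simp only [map_add, map_mul, map_one, map_ofNat]
      ring
    · rw [map_add, constantCoeff_scaling, zero_add, map_mul, MvPowerSeries.constantCoeff_C, hc,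
        constantCoeff_flowSeries, hτ.symm 0 p]
      field_simp [hp p]
  · rw [map_add, constantCoeff_scaling, zero_add, MvPowerSeries.constantCoeff_C, hF, hc,
      hτ.zero_zero, evalInit_u]
    simp

/-! ### The coefficients `aₖ(α)` -/

theorem a_zero (α : ℂ) : a 0 α = 1 := by simp [a]

/-- Passing from k to k + 1 adds the factors α - k - 1/2 and α + k + 1/2 at the two ends of the
rising factorial; only α² remains. -/
theorem a_succ (k : ℕ) (α : ℂ) :
    a (k + 1) α = a k α * ((α ^ 2 - ((k : ℂ) + 1 / 2) ^ 2) / (2 * ((k : ℂ) + 1))) := by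
  have h1 : (k : ℂ) + 1 ≠ 0 := Nat.cast_add_one_ne_zero k
  have h2 : (k ! : ℂ) ≠ 0 := Nat.cast_ne_zero.2 (Nat.factorial_ne_zero k)
  have e : (ascPochhammer ℂ (2 * (k + 1))).eval (α - ((k + 1 : ℕ) : ℂ) + 1 / 2) =
      (ascPochhammer ℂ (2 * k)).eval (α - (k : ℂ) + 1 / 2) * (α ^ 2 - ((k : ℂ) + 1 / 2) ^ 2) := by
    rw [show 2 * (k + 1) = 2 * k + 1 + 1 by ring, ascPochhammer_succ_eval, ascPochhammer_succ_left,
      Polynomial.eval_mul, Polynomial.eval_comp]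
    simp only [Polynomial.eval_X, Polynomial.eval_add, Polynomial.eval_one]
    push_cast
    rw [show α - ((k : ℂ) + 1) + 1 / 2 + 1 = α - (k : ℂ) + 1 / 2 by ring]
    ring
  rw [a, a, e, Nat.factorial_succ]
  push_cast
  field_simp
  ring

theorem a_succ_of_sq {C α : ℂ} (hα : α ^ 2 = 1 / 4 - 2 * C) (k : ℕ) :
    ((k : ℂ) + 1) * a (k + 1) α = -(C + (k : ℂ) * ((k : ℂ) + 1) / 2) * a k α := by
  have h1 : (k : ℂ) + 1 ≠ 0 := Nat.cast_add_one_ne_zero k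
  rw [a_succ, hα]
  field_simp
  ring

theorem a_eq_prod {C α : ℂ} (hα : α ^ 2 = 1 / 4 - 2 * C) (k : ℕ) : a k α =
    (-1) ^ k / (k ! : ℂ) * ∏ j ∈ Finset.Icc 1 k, (C + (j.choose 2 : ℂ)) := by
  induction k with
  | zero => simp [a_zero]
  | succ k ih =>
    have h1 : (k : ℂ) + 1 ≠ 0 := Nat.cast_add_one_ne_zero k
    have h2 : (k ! : ℂ) ≠ 0 := Nat.cast_ne_zero.2 (Nat.factorial_ne_zero k)
    refine mul_left_cancel₀ h1 ?_
    rw [a_succ_of_sq hα, ih, Finset.prod_Icc_succ_top (by omega), Nat.factorial_succ,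
      Nat.cast_choose_two]
    push_cast
    field_simp
    ring

theorem exists_polynomial_a_sq (k : ℕ) :
    ∃ q : Polynomial ℚ, ∀ β : ℂ, a k β = Polynomial.aeval (β ^ 2) q := by
  induction k with
  | zero => exact ⟨1, fun β => by simp [a_zero]⟩
  | succ k ih =>
    obtain ⟨q, hq⟩ := ih
    refine ⟨q * ((Polynomial.X - Polynomial.C (((k : ℚ) + 1 / 2) ^ 2)) *
      Polynomial.C (1 / (2 * ((k : ℚ) + 1)))), fun β => ?_⟩
    rw [a_succ, hq]
    simp only [map_mul, map_sub, Polynomial.aeval_X, Polynomial.aeval_C, eq_ratCast]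
    push_cast
    ring

theorem exists_polynomial_a (k : ℕ) : ∃ q : Polynomial ℚ, ∀ B β : ℂ, β ^ 2 = 1 / 4 - 2 * B →
    a k β = Polynomial.aeval B q := by
  obtain ⟨q, hq⟩ := exists_polynomial_a_sq k
  refine ⟨q.comp (Polynomial.C (1 / 4) - 2 * Polynomial.X), fun B β h => ?_⟩
  rw [hq, h, Polynomial.aeval_comp, map_sub, map_mul, map_ofNat]
  simp

/-! ### The one-point correlators -/

/-- At the initial data each ∂ in the Lenard recursion acts by a weight: 2k on b_k, 2k + 1 on ∂b_k,
2k + 2 on ∂²b_k. The differential recursion becomes a two-term one. -/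
theorem evalInit_b_succ (C : ℂ) (k : ℕ) : ((k : ℂ) + 1) * evalInit C (b (k + 1)) =
    (2 * (k : ℂ) + 1) * (C + (k : ℂ) * ((k : ℂ) + 1) / 2) * evalInit C (b k) := by
  have e0 : ∀ j, evalInit C (del (b j)) = 2 * (j : ℂ) * evalInit C (b j) := fun j => by
    rw [evalInit_del, euler_b, map_mul, map_mul, map_ofNat, map_natCast]
  have hn : del (2 * (k : DiffPoly)) = 0 := by exact_mod_cast del.map_natCast (2 * k)
  have e1 : evalInit C (del (del (b k))) =
      (2 * (k : ℂ) + 1) * (2 * (k : ℂ)) * evalInit C (b k) := by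
    rw [evalInit_del, euler_del, euler_b, del_mul, hn]
    simp only [map_add, map_mul, map_natCast, map_ofNat, e0, zero_mul, zero_add]
    ring
  have e2 : evalInit C (del (del (del (b k)))) =
      (2 * (k : ℂ) + 2) * (2 * (k : ℂ) + 1) * (2 * (k : ℂ)) * evalInit C (b k) := by
    rw [evalInit_del, euler_del, euler_del, euler_b]
    simp only [map_add, del_mul, hn, map_mul, map_natCast, map_ofNat, e1, zero_mul, zero_add]
    ring
  have h := congrArg (evalInit C) (four_mul_del_b_succ k)
  simp only [map_add, map_mul, map_ofNat, e0, e2, evalInit_u] at h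
  simp only [Nat.factorial] at h
  push_cast at h
  linear_combination h / 8

theorem evalInit_b {C α : ℂ} (hα : α ^ 2 = 1 / 4 - 2 * C) (k : ℕ) : evalInit C (b (k + 1)) =
    (((2 * k + 1)‼ : ℕ) : ℂ) * (-1) ^ (k + 1) * a (k + 1) α := by
  induction k with
  | zero =>
    have h1 := evalInit_b_succ C 0
    have h2 := a_succ_of_sq hα 0
    simp only [b_zero, a_zero, map_one] at h1 h2
    simp at h1 h2
    simp [h1, h2]
  | succ k ih =>
    have h1 : ((k + 1 : ℕ) : ℂ) + 1 ≠ 0 := Nat.cast_add_one_ne_zero _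
    refine mul_left_cancel₀ h1 ?_
    rw [evalInit_b_succ, ih, show 2 * (k + 1) + 1 = 2 * k + 1 + 2 by ring,
      Nat.doubleFactorial_add_two]
    have h2 := a_succ_of_sq hα (k + 1)
    push_cast at h2 ⊢
    rw [pow_succ (-1 : ℂ) (k + 1)]
    linear_combination ((2 * k + 1 + 2) * (((2 * k + 1)‼ : ℕ) : ℂ) * (-1) ^ (k + 1)) * h2

theorem a_eq_onePoint {C α : ℂ} (hα : α ^ 2 = 1 / 4 - 2 * C) {U F : TimeSeries}
    (hU : IsBGWSolution kdv C U) (hF : IsLogTau tau U F) (hs : StringEquation C F) {k : ℕ}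
    (hk : 1 ≤ k) : a k α = (-1) ^ k * (2 * (k : ℂ) - 1) * onePoint F (k - 1) := by
  obtain ⟨p, rfl⟩ : ∃ p, k = p + 1 := ⟨k - 1, by omega⟩
  have h := onePoint_eq hU hF hs p
  have hd : (((2 * p + 1)‼ : ℕ) : ℂ) ≠ 0 := Nat.cast_ne_zero.2 (Nat.doubleFactorial_pos _).ne'
  rw [tau, map_smul, scaledTau, evalInit_b hα, Algebra.smul_def] at h
  simp only [map_mul, map_inv₀, map_natCast] at h
  rw [Nat.add_sub_cancel]
  have hs1 : ((-1 : ℂ) ^ (p + 1)) * (-1) ^ (p + 1) = 1 := by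
    rw [← mul_pow]; norm_num
  push_cast
  rw [show (2 * ((p : ℂ) + 1) - 1) = 2 * (p : ℂ) + 1 by ring, mul_assoc, h]
  simp only [mul_zero, zero_add, show (1‼ : ℕ) = 1 from rfl, Nat.cast_one, inv_one, mul_one]
  field_simp
  linear_combination -a (p + 1) α * hs1

/-! ### The amplitude at the origin -/

/-- The derivation `θ = ζ d/dζ`. -/
def theta : Derivation ℂ (PowerSeries ℂ) (PowerSeries ℂ) :=
  (PowerSeries.X : PowerSeries ℂ) • PowerSeries.derivative ℂ

theorem coeff_theta (f : PowerSeries ℂ) (k : ℕ) :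
    PowerSeries.coeff k (theta f) = (k : ℂ) * PowerSeries.coeff k f := by
  rw [theta, Derivation.smul_apply, smul_eq_mul]
  cases k with
  | zero => simp
  | succ k =>
    rw [PowerSeries.coeff_succ_X_mul, PowerSeries.coeff_derivative]
    push_cast
    ring

theorem theta_mul (f g : PowerSeries ℂ) : theta (f * g) = theta f * g + f * theta g := by
  rw [Derivation.leibniz, smul_eq_mul, smul_eq_mul]; ring

theorem theta_X : theta PowerSeries.X = PowerSeries.X := by
  rw [theta, Derivation.smul_apply, PowerSeries.derivative_X, smul_eq_mul, mul_one]

/-- The amplitude of the wave function at `x = 0`. -/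
def phi (α : ℂ) : PowerSeries ℂ := PowerSeries.mk fun k => a k α

/-- The amplitude of the dual wave function at `x = 0`. -/
def phiDual (α : ℂ) : PowerSeries ℂ := PowerSeries.rescale (-1) (phi α)

theorem coeff_phi (α : ℂ) (k : ℕ) : PowerSeries.coeff k (phi α) = a k α :=
  PowerSeries.coeff_mk _ _

theorem coeff_phiDual (α : ℂ) (k : ℕ) :
    PowerSeries.coeff k (phiDual α) = (-1) ^ k * a k α := by
  rw [phiDual, PowerSeries.coeff_rescale, coeff_phi]

/-- The amplitude depends on ζ/(1-x) only, so at x = 0 the operators ∂ₓ and ∂ₓ² act as θ and θ² + θ.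
This is ζ times the Schrödinger equation there. -/
theorem theta_phi {C α : ℂ} (hα : α ^ 2 = 1 / 4 - 2 * C) :
    PowerSeries.X * (theta (theta (phi α)) + theta (phi α) + 2 * PowerSeries.C C * phi α)
      + 2 * theta (phi α) = 0 := by
  rw [show (2 : PowerSeries ℂ) = PowerSeries.C 2 from (map_ofNat PowerSeries.C 2).symm]
  ext k
  rw [map_zero, map_add, PowerSeries.coeff_C_mul, coeff_theta, coeff_phi]
  cases k with
  | zero => simp
  | succ k =>
    rw [PowerSeries.coeff_succ_X_mul, map_add, map_add, ← map_mul, PowerSeries.coeff_C_mul,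
      coeff_theta, coeff_theta, coeff_phi]
    push_cast
    linear_combination 2 * a_succ_of_sq hα k

theorem theta_phiDual {C α : ℂ} (hα : α ^ 2 = 1 / 4 - 2 * C) :
    PowerSeries.X * (theta (theta (phiDual α)) + theta (phiDual α)
      + 2 * PowerSeries.C C * phiDual α) - 2 * theta (phiDual α) = 0 := by
  rw [show (2 : PowerSeries ℂ) = PowerSeries.C 2 from (map_ofNat PowerSeries.C 2).symm]
  ext k
  rw [map_zero, map_sub, PowerSeries.coeff_C_mul, coeff_theta, coeff_phiDual]
  cases k with
  | zero => simp
  | succ k =>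
    rw [PowerSeries.coeff_succ_X_mul, map_add, map_add, ← map_mul, PowerSeries.coeff_C_mul,
      coeff_theta, coeff_theta, coeff_phiDual, pow_succ]
    push_cast
    linear_combination 2 * (-1) ^ k * a_succ_of_sq hα k

/-- The Wronskian of the wave functions. -/
theorem wronskian_phi {C α : ℂ} (hα : α ^ 2 = 1 / 4 - 2 * C) :
    2 * (phi α * phiDual α)
      + PowerSeries.X * (theta (phi α) * phiDual α - phi α * theta (phiDual α)) = 2 := by
  set W := 2 * (phi α * phiDual α)
      + PowerSeries.X * (theta (phi α) * phiDual α - phi α * theta (phiDual α)) with hW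
  have h2 : theta 2 = 0 := theta.map_natCast 2
  -- The two Schrödinger equations make W constant in ζ; its constant term is 2.
  have h : theta W = 0 := by
    rw [hW]
    simp only [map_add, map_sub, theta_mul, theta_X, h2]
    linear_combination phiDual α * theta_phi hα - phi α * theta_phiDual hα
  ext k
  cases k with
  | zero =>
    rw [hW, map_add, PowerSeries.coeff_zero_X_mul, add_zero,
      show (2 : PowerSeries ℂ) = PowerSeries.C 2 from (map_ofNat PowerSeries.C 2).symm,
      PowerSeries.coeff_C_mul, PowerSeries.coeff_zero_eq_constantCoeff_apply, map_mul,
      ← PowerSeries.coeff_zero_eq_constantCoeff_apply, ← PowerSeries.coeff_zero_eq_constantCoeff_apply,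
      coeff_phi, coeff_phiDual, a_zero]
    simp
  | succ k =>
    have h' := congrArg (PowerSeries.coeff (k + 1)) h
    rw [coeff_theta, map_zero] at h'
    rw [(mul_eq_zero.1 h').resolve_left (Nat.cast_ne_zero.2 (Nat.succ_ne_zero k)),
      show (2 : PowerSeries ℂ) = PowerSeries.C 2 from (map_ofNat PowerSeries.C 2).symm,
      PowerSeries.coeff_C, if_neg (Nat.succ_ne_zero k)]

theorem rescale_phi_mul_phiDual (α : ℂ) :
    PowerSeries.rescale (-1) (phi α * phiDual α) = phi α * phiDual α := by
  rw [map_mul, phiDual, PowerSeries.rescale_rescale, mul_comm (PowerSeries.rescale _ _)]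
  norm_num

theorem coeff_phi_mul_phiDual_of_odd (α : ℂ) {k : ℕ} (hk : Odd k) :
    PowerSeries.coeff k (phi α * phiDual α) = 0 := by
  have h := congrArg (PowerSeries.coeff k) (rescale_phi_mul_phiDual α)
  rw [PowerSeries.coeff_rescale, hk.neg_one_pow] at h
  linear_combination -h / 2

/-! ### The pair of wave functions -/

/-- The series `(1 - x)⁻¹`. -/
def geom : PowerSeries ℂ := (1 - PowerSeries.X)⁻¹

theorem derivative_geom : PowerSeries.derivative ℂ geom = geom ^ 2 := by
  rw [geom, PowerSeries.derivative_inv', map_sub, Derivation.map_one_eq_zero,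
    PowerSeries.derivative_X]
  ring

theorem bgwInitial_eq (C : ℂ) : bgwInitial C = PowerSeries.C C * geom ^ 2 := by
  rw [bgwInitial, geom, show (PowerSeries.X - 1 : PowerSeries ℂ) ^ 2 = (1 - PowerSeries.X) ^ 2 by
    ring]
  congr 1
  rw [PowerSeries.inv_eq_iff_mul_eq_one (by simp), ← mul_pow, PowerSeries.inv_mul_cancel _ (by simp),
    one_pow]

theorem derivative_geom_pow (c : ℂ) (k : ℕ) :
    PowerSeries.derivative ℂ (PowerSeries.C c * geom ^ k) =
      PowerSeries.C ((k : ℂ) * c) * geom ^ (k + 1) := by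
  rw [Derivation.leibniz, PowerSeries.derivative_C, smul_zero, add_zero, Derivation.leibniz_pow,
    derivative_geom, smul_eq_mul, smul_eq_mul, nsmul_eq_mul, map_mul, map_natCast]
  cases k with
  | zero => simp
  | succ k => rw [Nat.add_sub_cancel]; ring

/-- The homogeneous series `∑ₖ cₖ (1 - x)⁻ᵏ ζᵏ`. -/
def homSeries : PowerSeries ℂ →+* PowerSeries (PowerSeries ℂ) :=
  (PowerSeries.rescale geom).comp (PowerSeries.map PowerSeries.C)

theorem coeff_homSeries (f : PowerSeries ℂ) (k : ℕ) : PowerSeries.coeff k (homSeries f) =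
    PowerSeries.C (PowerSeries.coeff k f) * geom ^ k := by
  rw [homSeries, RingHom.comp_apply, PowerSeries.coeff_rescale, PowerSeries.coeff_map, mul_comm]

theorem bgwPsi_eq (α : ℂ) :
    bgwPsi α = HahnSeries.ofPowerSeries ℤ (PowerSeries ℂ) (homSeries (phi α)) := by
  rw [bgwPsi]
  congr 1
  ext1 k
  rw [PowerSeries.coeff_mk, coeff_homSeries, coeff_phi, geom]

theorem coeff_ofPowerSeries_natCast {R : Type*} [CommRing R] (f : PowerSeries R) (k : ℕ) :
    (HahnSeries.ofPowerSeries ℤ R f).coeff (k : ℤ) = PowerSeries.coeff k f :=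
  LaurentSeries.coeff_coe_powerSeries f k

theorem coeff_ofPowerSeries_neg {R : Type*} [CommRing R] (f : PowerSeries R) {k : ℤ} (hk : k < 0) :
    (HahnSeries.ofPowerSeries ℤ R f).coeff k = 0 := by
  rw [PowerSeries.coeff_coe, if_pos hk]

theorem reflect_bgwPsi (α : ℂ) : reflect (bgwPsi α) =
    HahnSeries.ofPowerSeries ℤ (PowerSeries ℂ) (homSeries (phiDual α)) := by
  ext1
  funext k
  change k.negOnePow • (bgwPsi α).coeff k = _
  rw [bgwPsi_eq]
  rcases lt_or_ge k 0 with h | h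
  · rw [coeff_ofPowerSeries_neg _ h, coeff_ofPowerSeries_neg _ h, smul_zero]
  · obtain ⟨n, rfl⟩ := Int.eq_ofNat_of_zero_le h
    rw [coeff_ofPowerSeries_natCast, coeff_ofPowerSeries_natCast, coeff_homSeries, coeff_homSeries,
      coeff_phi, coeff_phiDual]
    rcases Nat.even_or_odd n with hn | hn
    · rw [Int.negOnePow_even _ (by exact_mod_cast hn), one_smul, hn.neg_one_pow, one_mul]
    · rw [Int.negOnePow_odd _ (by exact_mod_cast hn), hn.neg_one_pow, Units.neg_smul, one_smul,
        neg_one_mul, map_neg, neg_mul]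

/-! ### The Schrödinger equation and the residue condition, coefficient by coefficient. -/

theorem coeff_C_mul_amplitude (c : PowerSeries ℂ) (w : Amplitude) (k : ℤ) :
    (HahnSeries.C c * w).coeff k = c * w.coeff k := by
  rw [HahnSeries.C_mul_eq_smul, HahnSeries.coeff_smul, smul_eq_mul]

theorem coeff_zA_mul (w : Amplitude) (k : ℤ) : (zA * w).coeff k = w.coeff (k + 1) := by
  have h := HahnSeries.coeff_single_mul_add (r := (1 : PowerSeries ℂ)) (x := w) (a := k + 1)
    (b := -1)
  rw [one_mul, add_neg_cancel_right] at h
  exact h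

/-- The coefficientwise derivative of an amplitude. -/
abbrev dAmp (w : Amplitude) : Amplitude := w.map (PowerSeries.derivative ℂ)

theorem coeff_dAmp (w : Amplitude) (k : ℤ) :
    (dAmp w).coeff k = PowerSeries.derivative ℂ (w.coeff k) := rfl

theorem coeff_dx (ε : ℤ) (w : Amplitude) (k : ℤ) : (dx ε w).coeff k =
    PowerSeries.derivative ℂ (w.coeff k) + ε • w.coeff (k + 1) := by
  rw [dx, HahnSeries.coeff_add, HahnSeries.coeff_smul, coeff_zA_mul, coeff_dAmp]

/-- With ε² = 1 the term z²w produced by the exponential on the left cancels the right-hand side. -/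
theorem schroedinger_of_coeff {f : PowerSeries ℂ} {ε : ℤ} (hε : ε * ε = 1) {w : Amplitude}
    (h : ∀ k, PowerSeries.derivative ℂ (PowerSeries.derivative ℂ (w.coeff k))
      + 2 * ε • PowerSeries.derivative ℂ (w.coeff (k + 1)) + 2 * f * w.coeff k = 0) :
    dx ε (dx ε w) + HahnSeries.C (2 * f) * w = zA ^ 2 * w := by
  ext1
  funext k
  have hz : (zA ^ 2 * w : Amplitude) = zA * (zA * w) := by rw [pow_two, mul_assoc]
  rw [hz, HahnSeries.coeff_add, coeff_C_mul_amplitude, coeff_zA_mul, coeff_zA_mul,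
    coeff_dx, coeff_dx, coeff_dx, map_add, map_zsmul, smul_add, smul_smul, hε, one_smul]
  linear_combination h k

theorem isWave_bgwPsi {C α : ℂ} (hα : α ^ 2 = 1 / 4 - 2 * C) :
    IsWave (bgwInitial C) 1 (bgwPsi α) where
  coeff_zero := by
    rw [bgwPsi_eq, ← Nat.cast_zero, coeff_ofPowerSeries_natCast, coeff_homSeries, coeff_phi, a_zero]
    simp
  coeff_neg k hk := by rw [bgwPsi_eq, coeff_ofPowerSeries_neg _ hk]
  schroedinger := by
    refine schroedinger_of_coeff (by norm_num) fun k => ?_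
    rw [bgwPsi_eq]
    rcases lt_or_ge k 0 with h | h
    · rw [coeff_ofPowerSeries_neg _ h]
      -- For k = -1 the equation involves the derivative of the coefficient of ζ⁰, which is constant
      -- in x.
      rcases eq_or_ne k (-1) with h1 | h1
      · rw [h1, neg_add_cancel, ← Nat.cast_zero (R := ℤ), coeff_ofPowerSeries_natCast,
          coeff_homSeries, derivative_geom_pow]
        simp
      · rw [coeff_ofPowerSeries_neg _ (show k + 1 < 0 by omega)]
        simp
    · obtain ⟨n, rfl⟩ := Int.eq_ofNat_of_zero_le h
      have e := congrArg (PowerSeries.C (R := ℂ)) (a_succ_of_sq hα n)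
      rw [show (n : ℤ) + 1 = ((n + 1 : ℕ) : ℤ) by push_cast; rfl, coeff_ofPowerSeries_natCast,
        coeff_ofPowerSeries_natCast, coeff_homSeries, coeff_homSeries, derivative_geom_pow,
        derivative_geom_pow, derivative_geom_pow, coeff_phi, coeff_phi, bgwInitial_eq, one_smul]
      have e' : PowerSeries.C ((n + 1 : ℕ) * ((n : ℂ) * a n α) + 2 * ((n + 1 : ℕ) * a (n + 1) α)
          + 2 * C * a n α) = 0 := by
        rw [← map_zero PowerSeries.C]
        congr 1
        push_cast
        linear_combination 2 * a_succ_of_sq hα n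
      simp only [map_add, map_mul, map_ofNat] at e' ⊢
      linear_combination geom ^ (n + 2) * e'

theorem isWave_reflect {f : PowerSeries ℂ} {w : Amplitude} (h : IsWave f 1 w) :
    IsWave f (-1) (reflect w) where
  coeff_zero := by
    change (0 : ℤ).negOnePow • w.coeff 0 = 1
    rw [h.coeff_zero, Int.negOnePow_zero, one_smul]
  coeff_neg k hk := by
    change k.negOnePow • w.coeff k = 0
    rw [h.coeff_neg k hk, smul_zero]
  schroedinger := by
    refine schroedinger_of_coeff (by norm_num) fun k => ?_
    have hk := congrArg (fun w : Amplitude => w.coeff k) h.schroedinger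
    simp only [HahnSeries.coeff_add, coeff_C_mul_amplitude, pow_two, mul_assoc, coeff_zA_mul,
      coeff_dx, map_add, one_smul] at hk
    change PowerSeries.derivative ℂ (PowerSeries.derivative ℂ (k.negOnePow • w.coeff k))
      + 2 * (-1 : ℤ) • PowerSeries.derivative ℂ ((k + 1).negOnePow • w.coeff (k + 1))
      + 2 * f * (k.negOnePow • w.coeff k) = 0
    rw [Int.negOnePow_succ]
    rcases Int.even_or_odd k with hp | hp
    · rw [Int.negOnePow_even _ hp]
      simp only [Units.neg_smul, one_smul, neg_smul, map_neg, neg_neg]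
      linear_combination hk
    · rw [Int.negOnePow_odd _ hp]
      simp only [Units.neg_smul, one_smul, neg_smul, map_neg, neg_neg]
      linear_combination -hk

/-- The module generated by `w` and `∂ₓ w` over the polynomials in `z²`. -/
inductive WaveModule (w : Amplitude) : Amplitude → Prop
  | base : WaveModule w w
  | base_dx : WaveModule w (dx 1 w)
  | add {g h : Amplitude} : WaveModule w g → WaveModule w h → WaveModule w (g + h)
  | smul (c : PowerSeries ℂ) {g : Amplitude} : WaveModule w g → WaveModule w (HahnSeries.C c * g)
  | z_sq {g : Amplitude} : WaveModule w g → WaveModule w (zA * (zA * g))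

theorem dx_add (ε : ℤ) (g h : Amplitude) : dx ε (g + h) = dx ε g + dx ε h := by
  ext1
  funext k
  simp only [coeff_dx, HahnSeries.coeff_add, map_add, smul_add]
  ring

theorem dx_C_mul (ε : ℤ) (c : PowerSeries ℂ) (g : Amplitude) : dx ε (HahnSeries.C c * g) =
    HahnSeries.C (PowerSeries.derivative ℂ c) * g + HahnSeries.C c * dx ε g := by
  ext1
  funext k
  simp only [coeff_dx, HahnSeries.coeff_add, coeff_C_mul_amplitude, Derivation.leibniz, smul_eq_mul,
    zsmul_eq_mul]
  ring

theorem dx_zA_mul (ε : ℤ) (g : Amplitude) : dx ε (zA * g) = zA * dx ε g := by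
  ext1
  funext k
  simp only [coeff_dx, coeff_zA_mul]

/-- The Schrödinger equation replaces ∂ₓ²w by (z² - 2f)w, so the module contains all ∂ₓⁱw, and two
generators suffice for the residue condition. -/
theorem WaveModule.dx {f : PowerSeries ℂ} {w : Amplitude} (hw : IsWave f 1 w) {g : Amplitude}
    (hg : WaveModule w g) : WaveModule w (dx 1 g) := by
  induction hg with
  | base => exact base_dx
  | base_dx =>
    have h := hw.schroedinger
    have e : KdV.dx 1 (KdV.dx 1 w) = zA * (zA * w) + HahnSeries.C (-(2 * f)) * w := by
      rw [map_neg]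
      linear_combination h
    rw [e]
    exact base.z_sq.add (base.smul _)
  | add _ _ hg hh => rw [dx_add]; exact hg.add hh
  | smul c hg' hg => rw [dx_C_mul]; exact (hg'.smul _).add (hg.smul _)
  | z_sq _ hg => rw [dx_zA_mul, dx_zA_mul]; exact hg.z_sq

/-- Multiplication by z² moves the coefficient of ζ^{k+2} to ζ^k and preserves parity. For this
reason all odd exponents are carried along, although the residue is the one at 1. -/
theorem WaveModule.coeff_mul_eq_zero {w ws : Amplitude}
    (h0 : ∀ k : ℕ, Odd k → (w * ws).coeff k = 0) (h1 : ∀ k : ℕ, Odd k → (KdV.dx 1 w * ws).coeff k = 0)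
    {g : Amplitude} (hg : WaveModule w g) (k : ℕ) (hk : Odd k) : (g * ws).coeff k = 0 := by
  induction hg generalizing k with
  | base => exact h0 k hk
  | base_dx => exact h1 k hk
  | add _ _ hg hh => rw [add_mul, HahnSeries.coeff_add, hg k hk, hh k hk, add_zero]
  | smul c _ hg => rw [mul_assoc, coeff_C_mul_amplitude, hg k hk, mul_zero]
  | z_sq _ hg =>
    rw [mul_assoc, mul_assoc, coeff_zA_mul, coeff_zA_mul]
    have := hg (k + 2) (hk.add_even even_two)
    push_cast at this
    rwa [add_assoc, show (1 : ℤ) + 1 = 2 by norm_num]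

theorem coeff_derivative_homSeries (f : PowerSeries ℂ) :
    dAmp (HahnSeries.ofPowerSeries ℤ (PowerSeries ℂ) (homSeries f)) =
      HahnSeries.ofPowerSeries ℤ (PowerSeries ℂ) (PowerSeries.C geom * homSeries (theta f)) := by
  ext1
  funext k
  rw [coeff_dAmp]
  rcases lt_or_ge k 0 with h | h
  · rw [coeff_ofPowerSeries_neg _ h, coeff_ofPowerSeries_neg _ h, map_zero]
  · obtain ⟨n, rfl⟩ := Int.eq_ofNat_of_zero_le h
    rw [coeff_ofPowerSeries_natCast, coeff_ofPowerSeries_natCast, coeff_homSeries,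
      PowerSeries.coeff_C_mul, coeff_homSeries, derivative_geom_pow, coeff_theta]
    ring

theorem homSeries_X : homSeries PowerSeries.X = PowerSeries.C geom * PowerSeries.X := by
  rw [homSeries, RingHom.comp_apply, PowerSeries.map_X, PowerSeries.rescale_X]

theorem zA_mul_X :
    zA * HahnSeries.ofPowerSeries ℤ (PowerSeries ℂ) PowerSeries.X = 1 := by
  rw [HahnSeries.ofPowerSeries_X, zA, HahnSeries.single_mul_single]
  simp

theorem isWavePair_bgwPsi {C α : ℂ} (hα : α ^ 2 = 1 / 4 - 2 * C) :
    IsWavePair (bgwInitial C) (bgwPsi α) (reflect (bgwPsi α)) where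
  wave := isWave_bgwPsi hα
  dual := isWave_reflect (isWave_bgwPsi hα)
  residue := by
    have hm : ∀ i : ℕ, WaveModule (bgwPsi α) ((dx 1)^[i] (bgwPsi α)) := fun i => by
      induction i with
      | zero => exact WaveModule.base
      | succ i ih =>
        rw [Function.iterate_succ_apply']
        exact ih.dx (isWave_bgwPsi hα)
    intro i
    refine WaveModule.coeff_mul_eq_zero (fun k hk => ?_) (fun k hk => ?_) (hm i) 1 odd_one
    · rw [reflect_bgwPsi, bgwPsi_eq, ← map_mul, ← map_mul, coeff_ofPowerSeries_natCast,
        coeff_homSeries, coeff_phi_mul_phiDual_of_odd α hk, map_zero, zero_mul]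
    · have hW := congrArg homSeries (wronskian_phi hα)
      set ι := HahnSeries.ofPowerSeries ℤ (PowerSeries ℂ)
      -- Adding the Wronskian 2z to ∂ₓ(ψψ*). As ψψ* is even in ζ and z sits at exponent -1, no odd
      -- exponent k ≥ 0 occurs.
      have key : 2 * (dx 1 (bgwPsi α) * reflect (bgwPsi α)) = 2 * zA +
          ι (PowerSeries.C geom * homSeries (theta (phi α * phiDual α))) := by
        have hW' := congrArg ι hW
        have hd := coeff_derivative_homSeries (phi α)
        unfold dAmp at hd
        rw [dx, one_smul, reflect_bgwPsi, bgwPsi_eq, hd, theta_mul]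
        simp only [map_add, map_sub, map_mul, map_ofNat, homSeries_X] at hW' ⊢
        have hz := zA_mul_X
        linear_combination zA * hW' - ι (PowerSeries.C geom) *
          (ι (homSeries (theta (phi α))) * ι (homSeries (phiDual α))
            - ι (homSeries (phi α)) * ι (homSeries (theta (phiDual α)))) * hz
      have hk' := congrArg (fun w : Amplitude => w.coeff k) key
      have hk0 : (zA : Amplitude).coeff k = 0 := by
        rw [zA, HahnSeries.coeff_single_of_ne (by omega)]
      simp only [HahnSeries.coeff_add, two_mul, ι, coeff_ofPowerSeries_natCast,
        PowerSeries.coeff_C_mul, coeff_homSeries, coeff_theta,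
        coeff_phi_mul_phiDual_of_odd α hk, hk0] at hk'
      simp only [mul_zero, map_zero, zero_mul, ← two_mul] at hk'
      exact (mul_eq_zero.1 hk').resolve_left (by
        intro h
        have := congrArg (PowerSeries.constantCoeff (R := ℂ)) h
        rw [map_ofNat, map_zero] at this
        exact two_ne_zero this)

/-! ### Power series in the square of a variable -/

section SumAt

variable {σ : Type*} {R : Type*} [CommRing R]

/-- The sum `∑_q ζᵢ^{2q} g_q`. -/
def sumAt (i : σ) (g : ℕ → MvPowerSeries σ R) : MvPowerSeries σ R := fun m =>
  ∑ q ∈ Finset.range (m i / 2 + 1), MvPowerSeries.coeff (m - Finsupp.single i (2 * q)) (g q)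

theorem coeff_sumAt (i : σ) (g : ℕ → MvPowerSeries σ R) (m : σ →₀ ℕ) :
    MvPowerSeries.coeff m (sumAt i g) =
      ∑ q ∈ Finset.range (m i / 2 + 1), MvPowerSeries.coeff (m - Finsupp.single i (2 * q)) (g q) :=
  rfl

theorem coeff_X_sq_mul (i : σ) (f : MvPowerSeries σ R) (m : σ →₀ ℕ) :
    MvPowerSeries.coeff m (MvPowerSeries.X i ^ 2 * f) =
      if 2 ≤ m i then MvPowerSeries.coeff (m - Finsupp.single i 2) f else 0 := by
  rw [MvPowerSeries.X_pow_eq, MvPowerSeries.coeff_monomial_mul, one_mul]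
  simp only [Finsupp.single_le_iff]

theorem sumAt_eq (i : σ) (g : ℕ → MvPowerSeries σ R) :
    sumAt i g = g 0 + MvPowerSeries.X i ^ 2 * sumAt i (fun q => g (q + 1)) := by
  ext m
  rw [map_add, coeff_X_sq_mul, coeff_sumAt, Finset.sum_range_succ', add_comm]
  congr 1
  · simp
  · split_ifs with h
    · rw [coeff_sumAt]
      have e : (m - Finsupp.single i 2 : σ →₀ ℕ) i / 2 + 1 = m i / 2 := by
        rw [Finsupp.tsub_apply, Finsupp.single_eq_same]
        omega
      rw [e]
      refine Finset.sum_congr rfl fun q _ => ?_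
      rw [tsub_tsub, ← Finsupp.single_add, mul_add, mul_one, add_comm 2]
    · rw [show m i / 2 = 0 by omega, Finset.range_zero, Finset.sum_empty]

theorem eq_zero_of_forall_X_sq_pow_dvd (i : σ) {f : MvPowerSeries σ R}
    (h : ∀ N, (MvPowerSeries.X i ^ 2) ^ N ∣ f) : f = 0 := by
  ext m
  have h1 := h (m i + 1)
  rw [← pow_mul, MvPowerSeries.X_pow_dvd_iff] at h1
  rw [h1 m (by omega), map_zero]

/-- Solutions of F_k = g_k + ζᵢ²F_{k+1} are unique: the difference of two is divisible by every
power of ζᵢ². -/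
theorem eq_sumAt (i : σ) {F g : ℕ → MvPowerSeries σ R}
    (h : ∀ k, F k = g k + MvPowerSeries.X i ^ 2 * F (k + 1)) : F 0 = sumAt i g := by
  have key : ∀ N k, (MvPowerSeries.X i ^ 2) ^ N ∣ F k - sumAt i (fun q => g (q + k)) := by
    intro N
    induction N with
    | zero => simp
    | succ N ih =>
      intro k
      have e : F k - sumAt i (fun q => g (q + k)) =
          MvPowerSeries.X i ^ 2 * (F (k + 1) - sumAt i (fun q => g (q + (k + 1)))) := by
        rw [sumAt_eq, h k]
        simp only [zero_add, add_assoc, add_comm 1 k]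
        ring
      rw [e, pow_succ']
      exact mul_dvd_mul_left _ (ih _)
  exact sub_eq_zero.1 (eq_zero_of_forall_X_sq_pow_dvd i fun N => key N 0)

/-- No continuity is required of Φ: compatibility with ζᵢ² preserves the recursion that determines
the infinite sum. -/
theorem map_sumAt {R' : Type*} [CommRing R'] (Φ : MvPowerSeries σ R →+ MvPowerSeries σ R') (i : σ)
    (hΦ : ∀ f, Φ (MvPowerSeries.X i ^ 2 * f) = MvPowerSeries.X i ^ 2 * Φ f)
    (g : ℕ → MvPowerSeries σ R) : Φ (sumAt i g) = sumAt i (fun q => Φ (g q)) := by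
  have h := eq_sumAt i (F := fun k => Φ (sumAt i fun q => g (q + k))) (g := fun q => Φ (g q))
    fun k => by
      rw [sumAt_eq, map_add, hΦ]
      simp only [zero_add, add_assoc, add_comm 1 k]
  exact h

theorem sumAt_mul_left (i : σ) (f : MvPowerSeries σ R) (g : ℕ → MvPowerSeries σ R) :
    sumAt i (fun q => f * g q) = f * sumAt i g :=
  (map_sumAt (AddMonoidHom.mulLeft f) i
    (fun h => by simp only [AddMonoidHom.coe_mulLeft]; ring) g).symm

theorem sumAt_mul_right (i : σ) (f : MvPowerSeries σ R) (g : ℕ → MvPowerSeries σ R) :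
    sumAt i (fun q => g q * f) = sumAt i g * f := by
  simp only [mul_comm _ f, sumAt_mul_left]

theorem sumAt_add (i : σ) (g h : ℕ → MvPowerSeries σ R) :
    sumAt i (fun q => g q + h q) = sumAt i g + sumAt i h := by
  ext m
  simp only [coeff_sumAt, map_add, Finset.sum_add_distrib]

theorem sumAt_sub (i : σ) (g h : ℕ → MvPowerSeries σ R) :
    sumAt i (fun q => g q - h q) = sumAt i g - sumAt i h := by
  ext m
  simp only [coeff_sumAt, map_sub, Finset.sum_sub_distrib]

theorem sumAt_zero (i : σ) : sumAt i (fun _ => (0 : MvPowerSeries σ R)) = 0 := by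
  ext m
  simp only [coeff_sumAt, map_zero, Finset.sum_const_zero]

theorem map_map_sumAt {R' : Type*} [CommRing R'] (f : R →+* R') (i : σ)
    (g : ℕ → MvPowerSeries σ R) :
    MvPowerSeries.map f (sumAt i g) = sumAt i (fun q => MvPowerSeries.map f (g q)) :=
  map_sumAt (MvPowerSeries.map f : MvPowerSeries σ R →+* MvPowerSeries σ R').toAddMonoidHom i
    (fun h => by
      change MvPowerSeries.map f _ = _ * MvPowerSeries.map f h
      rw [map_mul, map_pow, MvPowerSeries.map_X]) g

theorem coeffDer_X_sq_mul [Algebra ℚ R] (δ : Derivation ℚ R R) (i : σ) (f : MvPowerSeries σ R) :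
    coeffDer δ (MvPowerSeries.X i ^ 2 * f) = MvPowerSeries.X i ^ 2 * coeffDer δ f := by
  rw [Derivation.leibniz, Derivation.leibniz_pow, coeffDer_X]
  simp

theorem coeffDer_sumAt [Algebra ℚ R] (δ : Derivation ℚ R R) (i : σ)
    (g : ℕ → MvPowerSeries σ R) :
    coeffDer δ (sumAt i g) = sumAt i (fun q => coeffDer δ (g q)) :=
  map_sumAt (coeffDer δ : Derivation ℚ (MvPowerSeries σ R) (MvPowerSeries σ R)).toLinearMap.toAddMonoidHom i
    (coeffDer_X_sq_mul δ i) g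

/-- If no `g_q` involves `ζᵢ`, then the coefficients of `∑_q ζᵢ^{2q} g_q` are those of the `g_q`. -/
theorem coeff_sumAt_of_indep (i : σ) {g : ℕ → MvPowerSeries σ R}
    (h : ∀ q m, m i ≠ 0 → MvPowerSeries.coeff m (g q) = 0) (m : σ →₀ ℕ) :
    MvPowerSeries.coeff m (sumAt i g) =
      if Even (m i) then MvPowerSeries.coeff (m.erase i) (g (m i / 2)) else 0 := by
  rw [coeff_sumAt, Finset.sum_range_succ, Finset.sum_eq_zero, zero_add]
  · split_ifs with he
    · rw [Nat.two_mul_div_two_of_even he]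
      congr 2
      ext x
      classical
      rw [Finsupp.tsub_apply, Finsupp.erase_apply, Finsupp.single_apply]
      by_cases hx : i = x
      · subst hx; simp
      · rw [if_neg hx, if_neg (Ne.symm hx), tsub_zero]
    · refine h _ _ ?_
      rw [Nat.not_even_iff] at he
      rw [Finsupp.tsub_apply, Finsupp.single_eq_same]
      omega
  · intro q hq
    rw [Finset.mem_range] at hq
    refine h _ _ ?_
    rw [Finsupp.tsub_apply, Finsupp.single_eq_same]
    omega

/-! ### Substitution of ζᵢ² into power series in one variable. -/

theorem hasSubst_X_sq (i : σ) :
    PowerSeries.HasSubst (MvPowerSeries.X i ^ 2 : MvPowerSeries σ R) :=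
  PowerSeries.HasSubst.of_constantCoeff_zero (by simp)

/-- The series `f(ζᵢ²)`. -/
def atSq (i : σ) : PowerSeries R →+* MvPowerSeries σ R :=
  (PowerSeries.substAlgHom (R := R) (hasSubst_X_sq (R := R) i)).toRingHom

theorem atSq_apply (i : σ) (f : PowerSeries R) :
    atSq i f = PowerSeries.subst (MvPowerSeries.X i ^ 2 : MvPowerSeries σ R) f := by
  change PowerSeries.substAlgHom (R := R) (hasSubst_X_sq (R := R) i) f = _
  rw [PowerSeries.coe_substAlgHom]

theorem atSq_X (i : σ) : atSq i (PowerSeries.X : PowerSeries R) = MvPowerSeries.X i ^ 2 := by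
  rw [atSq_apply, PowerSeries.subst_X (hasSubst_X_sq i)]

theorem atSq_C (i : σ) (r : R) : atSq i (PowerSeries.C r) = MvPowerSeries.C r := by
  rw [atSq_apply, PowerSeries.subst_C]

theorem atSq_eq (i : σ) (f : PowerSeries R) :
    atSq i f = sumAt i (fun q => MvPowerSeries.C (PowerSeries.coeff q f)) := by
  have h := eq_sumAt i (F := fun k => atSq i (PowerSeries.mk fun n => PowerSeries.coeff (n + k) f))
    (g := fun q => MvPowerSeries.C (PowerSeries.coeff q f)) fun k => by
      rw [← atSq_X, ← atSq_C i, ← map_mul, ← map_add]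
      congr 1
      ext n
      cases n with
      | zero => simp
      | succ n =>
        rw [map_add, PowerSeries.coeff_succ_X_mul, PowerSeries.coeff_mk, PowerSeries.coeff_mk,
          PowerSeries.coeff_C, if_neg n.succ_ne_zero, zero_add, add_assoc, add_comm 1 k]
  rw [← h]
  congr 1
  ext n
  simp

theorem coeffDer_atSq [Algebra ℚ R] (δ : Derivation ℚ R R) (i : σ) (f : PowerSeries R) :
    coeffDer δ (atSq i f) = atSq i (coeffDer (σ := Unit) δ f) := by
  rw [atSq_eq, coeffDer_sumAt, atSq_eq]
  simp only [coeffDer_C]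
  rfl

theorem map_atSq {R' : Type*} [CommRing R'] (f : R →+* R') (i : σ) (g : PowerSeries R) :
    MvPowerSeries.map f (atSq i g) = atSq i (PowerSeries.map f g) := by
  rw [atSq_eq, map_map_sumAt, atSq_eq]
  simp only [MvPowerSeries.map_C, PowerSeries.coeff_map]

end SumAt

/-! ### Products of matrices along paths -/

section PathProd

variable {σ : Type*} {n : Type*} [Fintype n] {S : Type*} [CommRing S]

/-- The product of the matrices `A` along the path `a → l → c`, the last vertex excluded, with
the weights `N` of its edges. -/
def pathProd (N : σ → σ → S) (A : σ → Matrix n n S) : σ → List σ → σ → Matrix n n S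
  | a, [], c => N a c • A a
  | a, b :: l, c => N a b • (A a * pathProd N A b l c)

/-- The product of the weights `K` of the edges of the path `a → l → c`. -/
def pathWeight (K : σ → σ → S) : σ → List σ → σ → S
  | a, [], c => K a c
  | a, b :: l, c => K a b * pathWeight K b l c

theorem map_mul_derivation [Algebra ℚ S] (δ : Derivation ℚ S S) (A B : Matrix n n S) :
    (A * B).map δ = A.map δ * B + A * B.map δ := by
  ext i j
  simp only [Matrix.map_apply, Matrix.mul_apply, Matrix.add_apply, map_sum, Derivation.leibniz,
    smul_eq_mul, Finset.sum_add_distrib]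
  rw [add_comm]
  congr 1
  exact Finset.sum_congr rfl fun _ _ => mul_comm _ _

theorem map_smul_derivation {ι : Type*} [Algebra ℚ S] {δ : Derivation ℚ S S} {c : S} (hc : δ c = 0)
    (A : Matrix ι ι S) : (c • A).map δ = c • A.map δ := by
  ext i j
  simp only [Matrix.map_apply, Matrix.smul_apply, Derivation.leibniz, smul_eq_mul, hc, mul_zero,
    add_zero]

theorem sum_map_smul_mul {N : σ → σ → S} {A : σ → Matrix n n S} (a b c : σ) (L : List (List σ)) :
    (L.map fun l => pathProd N A a (b :: l) c).sum =
      N a b • (A a * (L.map fun l => pathProd N A b l c).sum) := by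
  simp only [pathProd]
  rw [← List.sum_map_mul_left, List.smul_sum, List.map_map]
  rfl

/-- A derivation that acts on the vertex matrices by the commutator with a further vertex `k`
inserts `k` into the edges of a path. -/
theorem map_derivation_pathProd [Algebra ℚ S] (δ : Derivation ℚ S S) {N : σ → σ → S}
    {A : σ → Matrix n n S} {Q : Matrix n n S} {Δ : S} {k : σ} (hN : ∀ i j, δ (N i j) = 0)
    (hanti : ∀ i, i ≠ k → N k i = -N i k)
    (hthree : ∀ i j, i ≠ j → i ≠ k → j ≠ k → N i j * (N k j + N i k) = N i k * N k j)
    (hA : ∀ i, i ≠ k → Δ • (A i).map δ =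
      N k i • (A k * A i - A i * A k) + Δ • (Q * A i - A i * Q)) (c : σ) (hc : c ≠ k)
    (l : List σ) : ∀ a, a ≠ k → k ∉ l → List.IsChain (· ≠ ·) (a :: (l ++ [c])) →
    Δ • (pathProd N A a l c).map δ =
      Δ • (Q * pathProd N A a l c - pathProd N A a l c * Q)
        + (N k a • (A k * pathProd N A a l c) - N k c • (pathProd N A a l c * A k))
        + ((List.permutations'Aux k l).map fun l' => pathProd N A a l' c).sum := by
  induction l with
  | nil =>
    intro a ha _ hch
    have hac : a ≠ c := by simpa using hch
    simp only [pathProd, List.permutations'Aux, List.map_cons, List.map_nil, List.sum_cons,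
      List.sum_nil, add_zero]
    rw [map_smul_derivation (hN _ _), smul_comm, hA a ha]
    have h1 := hanti a ha
    have h2 := hthree a c hac ha hc
    ext x y
    simp only [Matrix.smul_apply, Matrix.add_apply, Matrix.sub_apply, smul_eq_mul,
      Matrix.mul_smul, Matrix.smul_mul]
    -- The three-term relation merges the commutator term A_a A_k with the boundary term at c into
    -- the insertion of k between a and c.
    linear_combination ((A a * A k) x y) * h2 + (-N a c * (A a * A k) x y) * h1
  | cons b l ih =>
    intro a ha hk hch
    rw [List.mem_cons, not_or] at hk
    rw [List.cons_append, List.isChain_cons_cons] at hch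
    have hbk : b ≠ k := Ne.symm hk.1
    have e := ih b hbk hk.2 hch.2
    rw [List.permutations'Aux, List.map_cons, List.sum_cons, List.map_map]
    rw [show ((fun l' => pathProd N A a l' c) ∘ List.cons b) =
      fun l => pathProd N A a (b :: l) c from rfl, sum_map_smul_mul]
    generalize ((List.permutations'Aux k l).map fun l' => pathProd N A b l' c).sum = Z at e ⊢
    rw [pathProd, pathProd, pathProd]
    generalize pathProd N A b l c = P at e ⊢
    rw [map_smul_derivation (hN _ _), map_mul_derivation, smul_comm, smul_add, ← Matrix.smul_mul,
      ← Matrix.mul_smul, hA a ha, e]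
    have h1 := hanti a ha
    have h2 := hthree a b hch.1 ha hbk
    simp only [Matrix.mul_add, Matrix.add_mul, Matrix.mul_sub, Matrix.sub_mul, Matrix.mul_smul,
      Matrix.smul_mul, Matrix.mul_assoc]
    ext x y
    simp only [Matrix.smul_apply, Matrix.add_apply, Matrix.sub_apply, smul_eq_mul]
    -- Here -A_a A_k from the commutator at a meets the left boundary term A_k P of the shorter
    -- path; by the three-term relation they merge into the insertion of k between a and b.
    linear_combination ((A a * (A k * P)) x y) * h2 - N a b * (A a * (A k * P)) x y * h1

/-- When the path closes up, the two boundary terms of `map_derivation_pathProd` have equal trace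
and cancel, and the gauge commutator has trace zero. Only the insertions remain. -/
theorem derivation_trace_pathProd [Algebra ℚ S] (δ : Derivation ℚ S S) {N : σ → σ → S}
    {A : σ → Matrix n n S} {Q : Matrix n n S} {Δ : S} {k : σ} (hN : ∀ i j, δ (N i j) = 0)
    (hanti : ∀ i, i ≠ k → N k i = -N i k)
    (hthree : ∀ i j, i ≠ j → i ≠ k → j ≠ k → N i j * (N k j + N i k) = N i k * N k j)
    (hA : ∀ i, i ≠ k → Δ • (A i).map δ =
      N k i • (A k * A i - A i * A k) + Δ • (Q * A i - A i * Q)) {a : σ} (ha : a ≠ k)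
    {l : List σ} (hk : k ∉ l) (hch : List.IsChain (· ≠ ·) (a :: (l ++ [a]))) :
    Δ * δ (pathProd N A a l a).trace =
      ((List.permutations'Aux k l).map fun l' => (pathProd N A a l' a).trace).sum := by
  have h := congrArg Matrix.trace
    (map_derivation_pathProd δ hN hanti hthree hA a ha l a ha hk hch)
  have e1 : ((pathProd N A a l a).map δ).trace = δ (pathProd N A a l a).trace := by
    simp only [Matrix.trace, map_sum]
    rfl
  have e2 : ∀ L : List (Matrix n n S), L.sum.trace = (L.map Matrix.trace).sum := fun L =>
    map_list_sum (Matrix.traceAddMonoidHom n S) L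
  rw [Matrix.trace_smul, e1, Matrix.trace_add, Matrix.trace_add, Matrix.trace_smul,
    Matrix.trace_sub, Matrix.trace_sub, Matrix.trace_smul, Matrix.trace_smul,
    Matrix.trace_mul_comm Q, Matrix.trace_mul_comm (A k), sub_self, sub_self, smul_zero, zero_add,
    zero_add, e2, List.map_map] at h
  exact h

theorem map_pathProd {S' : Type*} [CommRing S'] (f : S →+* S') (N : σ → σ → S)
    (A : σ → Matrix n n S) (c : σ) (l : List σ) : ∀ a, (pathProd N A a l c).map f =
      pathProd (fun i j => f (N i j)) (fun i => (A i).map f) a l c := by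
  induction l with
  | nil =>
    intro a
    ext x y
    simp [pathProd]
  | cons b l ih =>
    intro a
    rw [pathProd, pathProd, ← ih b, ← Matrix.map_mul]
    ext x y
    exact map_mul f _ _

/-- For matrices of rank one the trace along a closed path is a product over its edges. -/
theorem trace_pathProd_vecMulVec (N : σ → σ → S) (v w : σ → n → S) (a : σ) (l : List σ) :
    (pathProd N (fun i => Matrix.vecMulVec (w i) (v i)) a l a).trace =
      pathWeight (fun i j => N i j * (v i ⬝ᵥ w j)) a l a := by
  have key : ∀ (l : List σ) (b c : σ), ∃ r : n → S,
      pathProd N (fun i => Matrix.vecMulVec (w i) (v i)) b l c = Matrix.vecMulVec (w b) r ∧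
        r ⬝ᵥ w c = pathWeight (fun i j => N i j * (v i ⬝ᵥ w j)) b l c := by
    intro l
    induction l with
    | nil =>
      intro b c
      refine ⟨N b c • v b, ?_, ?_⟩
      · rw [pathProd, Matrix.vecMulVec_smul]
      · rw [pathWeight, smul_dotProduct, smul_eq_mul]
    | cons d l ih =>
      intro b c
      obtain ⟨r, hr, hr'⟩ := ih d c
      refine ⟨(N b d * (v b ⬝ᵥ w d)) • r, ?_, ?_⟩
      · rw [pathProd, hr, Matrix.vecMulVec_mul_vecMulVec, Matrix.vecMulVec_smul, mul_smul,
          Matrix.vecMulVec_smul, Matrix.vecMulVec_smul]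
      · rw [pathWeight, smul_dotProduct, hr', smul_eq_mul]
  obtain ⟨r, hr, hr'⟩ := key l a a
  rw [hr, Matrix.trace_vecMulVec, dotProduct_comm, hr']

end PathProd

/-! ### The generating series of the flows and of the resolvent -/

section Correlator

variable {σ : Type*}

/-- The derivation `∑_q ζᵢ^{2q} E_q`, with `E_q` acting on the coefficients. -/
def nabla (i : σ) : Derivation ℚ (MvPowerSeries σ DiffPoly) (MvPowerSeries σ DiffPoly) :=
  Derivation.mk'
    (AddMonoidHom.toRatLinearMap (AddMonoidHom.mk' (fun f => sumAt i fun q => coeffDer (flow q) f)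
      fun f g => by simp only [map_add, sumAt_add]))
    fun f g => by
      change sumAt i (fun q => coeffDer (flow q) (f * g)) = _
      simp only [Derivation.leibniz, smul_eq_mul, sumAt_add, sumAt_mul_left]
      rfl

theorem nabla_apply (i : σ) (f : MvPowerSeries σ DiffPoly) :
    nabla i f = sumAt i fun q => coeffDer (flow q) f := rfl

theorem nabla_X (i j : σ) : nabla i (MvPowerSeries.X j) = 0 := by
  simp only [nabla_apply, coeffDer_X, sumAt_zero]

theorem nabla_delS (i : σ) (f : MvPowerSeries σ DiffPoly) : nabla i (delS f) = delS (nabla i f) := by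
  rw [nabla_apply, nabla_apply, delS, coeffDer_sumAt]
  congr 1
  funext q
  exact coeffDer_comm (flow_del q) f

/-- The resolvent `b(ζᵢ²)`. -/
def bAt (i : σ) : MvPowerSeries σ DiffPoly := atSq i bSeries

theorem delS_bAt (i : σ) : delS (bAt i) = atSq i (delP bSeries) := coeffDer_atSq _ _ _

theorem delS_delS_bAt (i : σ) : delS (delS (bAt i)) = atSq i (delP (delP bSeries)) := by
  rw [delS_bAt]
  exact coeffDer_atSq _ _ _

theorem delS_X (i : σ) : delS (MvPowerSeries.X i : MvPowerSeries σ DiffPoly) = 0 := coeffDer_X _ _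

theorem delS_C (P : DiffPoly) : delS (MvPowerSeries.C P : MvPowerSeries σ DiffPoly) =
    MvPowerSeries.C (del P) := coeffDer_C _ _

theorem delS_mul (f g : MvPowerSeries σ DiffPoly) : delS (f * g) = delS f * g + f * delS g := by
  rw [Derivation.leibniz, smul_eq_mul, smul_eq_mul]; ring

theorem delS_X_sq (i : σ) : delS (MvPowerSeries.X i ^ 2 : MvPowerSeries σ DiffPoly) = 0 := by
  rw [pow_two, delS_mul, delS_X]; ring

theorem bAt_lenard (i : σ) :
    4 * (1 - 2 * MvPowerSeries.C (u 0) * MvPowerSeries.X i ^ 2) * delS (bAt i) =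
      MvPowerSeries.X i ^ 2 * delS (delS (delS (bAt i)))
        + 4 * MvPowerSeries.X i ^ 2 * MvPowerSeries.C (u 1) * bAt i := by
  have h := congrArg (atSq i) bSeries_lenard
  simp only [map_mul, map_add, map_sub, map_one, map_ofNat, atSq_X, atSq_C] at h
  rw [delS_delS_bAt, delS_bAt, show delS (atSq i (delP (delP bSeries))) =
    atSq i (delP (delP (delP bSeries))) from coeffDer_atSq _ _ _]
  exact h

theorem bAt_eq (i : σ) : bAt i = sumAt i fun q => MvPowerSeries.C (b q) := by
  rw [bAt, atSq_eq]
  simp only [bSeries, PowerSeries.coeff_mk]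

theorem delS_bAt_eq (i : σ) : delS (bAt i) = sumAt i fun q => MvPowerSeries.C (del (b q)) := by
  rw [bAt_eq, delS, coeffDer_sumAt]
  simp only [coeffDer_C]

theorem X_sq_mul_sumAt_b_succ (i : σ) :
    MvPowerSeries.X i ^ 2 * sumAt i (fun q => MvPowerSeries.C (b (q + 1))) = bAt i - 1 := by
  rw [bAt_eq, sumAt_eq i fun q => MvPowerSeries.C (b q), b_zero, map_one]
  ring

theorem X_sq_mul_sumAt_del_b_succ (i : σ) :
    MvPowerSeries.X i ^ 2 * sumAt i (fun q => MvPowerSeries.C (del (b (q + 1)))) =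
      delS (bAt i) := by
  rw [delS_bAt_eq, sumAt_eq i fun q => MvPowerSeries.C (del (b q)), b_zero,
    Derivation.map_one_eq_zero, map_zero, zero_add]

theorem X_sq_mul_nabla_u (i : σ) :
    MvPowerSeries.X i ^ 2 * nabla i (MvPowerSeries.C (u 0)) = delS (bAt i) := by
  rw [← X_sq_mul_sumAt_del_b_succ, nabla_apply]
  simp only [coeffDer_C, flow_u_zero]

/-- The action of the flows on the resolvent. -/
theorem sub_mul_nabla_bAt (k i : σ) :
    (MvPowerSeries.X i ^ 2 - MvPowerSeries.X k ^ 2) * nabla k (bAt i) =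
      MvPowerSeries.X i ^ 2 * (bAt k * delS (bAt i) - delS (bAt k) * bAt i) := by
  have hs : ∀ q, MvPowerSeries.X i ^ 2 * coeffDer (flow (q + 1)) (bAt i) =
      coeffDer (flow q) (bAt i) + MvPowerSeries.X i ^ 2 *
        (MvPowerSeries.C (b (q + 1)) * delS (bAt i)
          - MvPowerSeries.C (del (b (q + 1))) * bAt i) := fun q => by
    have h := congrArg (atSq i) (X_mul_flow_bSeries_succ q)
    simp only [map_mul, map_add, map_sub, atSq_X, atSq_C] at h
    rw [bAt, coeffDer_atSq, coeffDer_atSq, delS, coeffDer_atSq]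
    exact h
  -- The term q = 0 is ∂; the remaining terms are lowered by one index with `hs`, which reproduces
  -- ∇ₖ with the factor ζₖ².
  have h1 : MvPowerSeries.X i ^ 2 * nabla k (bAt i) = MvPowerSeries.X i ^ 2 * delS (bAt i)
      + MvPowerSeries.X k ^ 2 * (sumAt k fun q =>
        MvPowerSeries.X i ^ 2 * coeffDer (flow (q + 1)) (bAt i)) := by
    rw [nabla_apply, sumAt_eq, flow_zero, sumAt_mul_left]
    ring
  simp only [hs, sumAt_add, sumAt_sub, sumAt_mul_left, sumAt_mul_right] at h1
  rw [← nabla_apply] at h1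
  linear_combination h1 + MvPowerSeries.X i ^ 2 * delS (bAt i) * X_sq_mul_sumAt_b_succ k
    - MvPowerSeries.X i ^ 2 * bAt i * X_sq_mul_sumAt_del_b_succ k

/-! ### The generating series of the tau-structure -/

/-- The series `∑ Ω_{p,q,…} ζᵢ^{2p} ζⱼ^{2q} ⋯` for the list `[i, j, …]`. -/
def corr : List σ → MvPowerSeries σ DiffPoly
  | [] => 0
  | [_] => 0
  | [i, j] => sumAt i fun q => sumAt j fun p => MvPowerSeries.C (scaledTau q p)
  | i :: j :: k :: l => nabla i (corr (j :: k :: l))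

/-- This is the generating form of ∂Ω_{p,q} ∝ flow_q(b_{p+1}); the shift p + 1 accounts for ζⱼ², and
b₀ = 1 is killed by the flows. -/
theorem X_sq_mul_delS_corr (i j : σ) :
    MvPowerSeries.X j ^ 2 * delS (corr [i, j]) = nabla i (bAt j) := by
  rw [corr, delS, coeffDer_sumAt, ← sumAt_mul_left, nabla_apply]
  congr 1
  funext q
  rw [coeffDer_sumAt]
  simp only [coeffDer_C, scaledTau_symm q, del_scaledTau]
  rw [eq_add_of_sub_eq (X_sq_mul_sumAt_b_succ j).symm, map_add, Derivation.map_one_eq_zero,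
    add_zero, coeffDer_X_sq_mul, coeffDer_sumAt]
  simp only [coeffDer_C]

open scoped Classical in
-- Each ∇ prepends one index. Distinctness of the labels ensures that the series acted upon does not
-- involve the new variable, so no two exponents of the same variable mix.
theorem coeff_corr {l : List σ} (hl : l.Nodup) (m : σ →₀ ℕ) :
    MvPowerSeries.coeff m (corr l) = if (∀ x, Even (m x)) ∧ ∀ x, x ∉ l → m x = 0 then
      multiOmega flow scaledTau (l.map fun x => m x / 2) else 0 := by
  induction l generalizing m with
  | nil => simp [corr, multiOmega]
  | cons i l ih =>
    rw [List.nodup_cons] at hl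
    have hmap : l.map (fun x => (m.erase i) x / 2) = l.map (fun x => m x / 2) :=
      List.map_congr_left fun x hx => by
        rw [Finsupp.erase_ne (fun h : x = i => hl.1 (h ▸ hx))]
    have hcond : (Even (m i) ∧ (∀ x, Even ((m.erase i) x)) ∧ ∀ x, x ∉ l → (m.erase i) x = 0) ↔
        (∀ x, Even (m x)) ∧ ∀ x, x ∉ i :: l → m x = 0 := by
      constructor
      · rintro ⟨h1, h2, h3⟩
        refine ⟨fun x => ?_, fun x hx => ?_⟩
        · by_cases hx : x = i
          · rw [hx]; exact h1
          · rw [← Finsupp.erase_ne hx]; exact h2 x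
        · rw [List.mem_cons, not_or] at hx
          rw [← Finsupp.erase_ne hx.1]; exact h3 x hx.2
      · rintro ⟨h1, h2⟩
        refine ⟨h1 i, fun x => ?_, fun x hx => ?_⟩
        · by_cases hxi : x = i
          · simp [hxi]
          · rw [Finsupp.erase_ne hxi]; exact h1 x
        · by_cases hxi : x = i
          · simp [hxi]
          · rw [Finsupp.erase_ne hxi]; exact h2 x (by simp [hxi, hx])
    match l, hl, ih, hmap, hcond with
    | [], _, _, _, _ => simp [corr, multiOmega]
    | [j], hl, _, _, _ =>
      have hij : i ≠ j := fun h => hl.1 (by simp [h])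
      have h0 : ∀ (q : ℕ) (m : σ →₀ ℕ), MvPowerSeries.coeff m
          (sumAt j fun p => MvPowerSeries.C (scaledTau q p)) =
          if Even (m j) then if m.erase j = 0 then scaledTau q (m j / 2) else 0 else 0 := by
        intro q m
        rw [coeff_sumAt_of_indep j (fun p m hm => ?_), MvPowerSeries.coeff_C]
        rw [MvPowerSeries.coeff_C, if_neg]
        intro h
        exact hm (by rw [h]; rfl)
      rw [corr, coeff_sumAt_of_indep i]
      · rw [h0, Finsupp.erase_ne hij.symm]
        simp only [List.map_cons, List.map_nil, multiOmega]
        rw [← ite_and, ← ite_and]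
        congr 1
        rw [eq_iff_iff]
        have he : (m.erase i).erase j = 0 ↔ ∀ x, x ∉ [i, j] → m x = 0 := by
          rw [Finsupp.ext_iff]
          simp only [Finsupp.erase_apply, Finsupp.coe_zero, Pi.zero_apply, List.mem_cons,
            List.not_mem_nil, or_false, not_or]
          refine forall_congr' fun x => ?_
          by_cases h1 : x = j <;> by_cases h2 : x = i <;> simp [h1, h2]
        rw [he]
        constructor
        · rintro ⟨⟨h1, h2⟩, h3⟩
          refine ⟨fun x => ?_, h3⟩
          by_cases hx : x ∈ [i, j]
          · simp only [List.mem_cons, List.not_mem_nil, or_false] at hx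
            rcases hx with rfl | rfl
            · exact h1
            · exact h2
          · rw [h3 x hx]; exact Even.zero
        · rintro ⟨h1, h2⟩
          exact ⟨⟨h1 i, h1 j⟩, h2⟩
      · intro q m hm
        rw [h0, if_neg (c := m.erase j = 0), ite_self]
        intro h
        have := DFunLike.congr_fun h i
        rw [Finsupp.erase_ne hij] at this
        exact hm this
    | j :: k :: l, hl, ih, hmap, hcond =>
      rw [corr, nabla_apply, coeff_sumAt_of_indep i]
      · rw [coeff_coeffDer, ih hl.2, hmap, List.map_cons (f := fun x => m x / 2) (a := i)]
        rw [List.map_cons, List.map_cons, multiOmega]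
        simp only [← hcond, ite_and, apply_ite (flow (m i / 2)), map_zero]
      · intro q m hm
        rw [coeff_coeffDer, ih hl.2, if_neg, map_zero]
        exact fun h => hm (h.2 i hl.1)

end Correlator

/-! ### The Lax matrices -/

section Lax

variable {σ : Type*}

theorem nabla_C_C (k : σ) (c : ℚ) :
    nabla k (MvPowerSeries.C (MvPolynomial.C c) : MvPowerSeries σ DiffPoly) = 0 := by
  rw [nabla_apply]
  have h : ∀ q, flow q (MvPolynomial.C c) = 0 := fun q => by
    rw [← MvPolynomial.algebraMap_eq, Derivation.map_algebraMap]
  simp only [coeffDer_C, h, map_zero, sumAt_zero]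

/-- Half of the derivative of the resolvent. -/
def pAt (i : σ) : MvPowerSeries σ DiffPoly :=
  MvPowerSeries.C (MvPolynomial.C (1 / 2)) * delS (bAt i)

theorem two_mul_pAt (i : σ) : 2 * pAt i = delS (bAt i) := by
  have h : (2 : MvPowerSeries σ DiffPoly) * MvPowerSeries.C (MvPolynomial.C (1 / 2)) = 1 := by
    rw [← map_ofNat (MvPowerSeries.C (σ := σ) (R := DiffPoly)) 2, ← map_mul, two_mul_C_half,
      map_one]
  rw [pAt, ← mul_assoc, h, one_mul]

theorem delS_pAt (i : σ) : delS (pAt i) =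
    MvPowerSeries.C (MvPolynomial.C (1 / 2)) * delS (delS (bAt i)) := by
  rw [pAt, delS_mul, delS_C, del_C, map_zero, zero_mul, zero_add]

theorem mvPowerSeries_two_ne_zero : (2 : MvPowerSeries σ DiffPoly) ≠ 0 := fun h => by
  have h1 := congrArg (MvPowerSeries.constantCoeff (σ := σ) (R := DiffPoly)) h
  rw [map_ofNat, map_zero] at h1
  exact two_ne_zero h1

theorem pAt_lenard (i : σ) :
    4 * (1 - 2 * MvPowerSeries.C (u 0) * MvPowerSeries.X i ^ 2) * pAt i =
      MvPowerSeries.X i ^ 2 * delS (delS (pAt i))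
        + 2 * MvPowerSeries.X i ^ 2 * MvPowerSeries.C (u 1) * bAt i := by
  refine mul_left_cancel₀ mvPowerSeries_two_ne_zero ?_
  have h := bAt_lenard i
  have h1 : delS (delS (delS (bAt i))) = 2 * delS (delS (pAt i)) := by
    rw [← two_mul_pAt, two_mul, two_mul, map_add, map_add]
  rw [h1, ← two_mul_pAt] at h
  linear_combination h

theorem sub_mul_nabla_delS_bAt (k i : σ) :
    (MvPowerSeries.X i ^ 2 - MvPowerSeries.X k ^ 2) * nabla k (delS (bAt i)) =
      MvPowerSeries.X i ^ 2 * (bAt k * delS (delS (bAt i)) - delS (delS (bAt k)) * bAt i) := by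
  have h := congrArg delS (sub_mul_nabla_bAt k i)
  simp only [delS_mul, map_sub, delS_X_sq, ← nabla_delS] at h
  linear_combination h

theorem sub_mul_nabla_pAt (k i : σ) :
    (MvPowerSeries.X i ^ 2 - MvPowerSeries.X k ^ 2) * nabla k (pAt i) =
      MvPowerSeries.X i ^ 2 * (bAt k * delS (pAt i) - delS (pAt k) * bAt i) := by
  have e : nabla k (pAt i) =
      MvPowerSeries.C (MvPolynomial.C (1 / 2)) * nabla k (delS (bAt i)) := by
    rw [pAt, Derivation.leibniz, nabla_C_C, smul_zero, add_zero, smul_eq_mul]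
  rw [e, delS_pAt, delS_pAt]
  linear_combination MvPowerSeries.C (MvPolynomial.C (1 / 2)) * sub_mul_nabla_delS_bAt k i

theorem sub_mul_nabla_delS_pAt (k i : σ) :
    (MvPowerSeries.X i ^ 2 - MvPowerSeries.X k ^ 2) * nabla k (delS (pAt i)) =
      MvPowerSeries.X i ^ 2 * (2 * pAt k * delS (pAt i) + bAt k * delS (delS (pAt i))
        - delS (delS (pAt k)) * bAt i - 2 * delS (pAt k) * pAt i) := by
  have h := congrArg delS (sub_mul_nabla_pAt k i)
  simp only [delS_mul, map_sub, delS_X_sq, ← nabla_delS, ← two_mul_pAt] at h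
  linear_combination h

/-- The Lax matrix at `ζᵢ`, of trace `2 ζᵢ` and determinant zero. -/
def lax (i : σ) : Matrix (Fin 2) (Fin 2) (MvPowerSeries σ DiffPoly) :=
  !![MvPowerSeries.X i - MvPowerSeries.X i ^ 2 * pAt i,
      (1 - 2 * MvPowerSeries.C (u 0) * MvPowerSeries.X i ^ 2) * bAt i
        - MvPowerSeries.X i ^ 2 * delS (pAt i);
    MvPowerSeries.X i ^ 2 * bAt i, MvPowerSeries.X i + MvPowerSeries.X i ^ 2 * pAt i]

/-- The gauge term in the evolution of the Lax matrices. -/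
def gauge (k : σ) : Matrix (Fin 2) (Fin 2) (MvPowerSeries σ DiffPoly) :=
  !![pAt k, 2 * MvPowerSeries.C (u 0) * bAt k + delS (pAt k); -bAt k, -pAt k]

theorem X_sq_ne_zero (k : σ) : (MvPowerSeries.X k ^ 2 : MvPowerSeries σ DiffPoly) ≠ 0 :=
  pow_ne_zero 2 fun h => by
    have h1 := congrArg (MvPowerSeries.coeff (Finsupp.single k 1)) h
    rw [MvPowerSeries.coeff_index_single_self_X, map_zero] at h1
    exact one_ne_zero h1

theorem nabla_X_sq_mul (k i : σ) (f : MvPowerSeries σ DiffPoly) :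
    nabla k (MvPowerSeries.X i ^ 2 * f) = MvPowerSeries.X i ^ 2 * nabla k f := by
  rw [Derivation.leibniz, Derivation.leibniz_pow, nabla_X]
  simp

/-- The diagonal and lower left entries are the evolution of ∂b and of b. The upper right entry also
contains u₀ and ∂²b, whose evolution brings in third derivatives of b; the Lenard relations at both
points remove them. -/
theorem nabla_lax (k i : σ) :
    (MvPowerSeries.X k ^ 2 - MvPowerSeries.X i ^ 2 : MvPowerSeries σ DiffPoly) •
        (lax i).map (nabla k) = (lax k * lax i - lax i * lax k)
      + (MvPowerSeries.X k ^ 2 - MvPowerSeries.X i ^ 2 : MvPowerSeries σ DiffPoly) •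
        (gauge k * lax i - lax i * gauge k) := by
  have r1 := sub_mul_nabla_bAt k i
  rw [← two_mul_pAt, ← two_mul_pAt] at r1
  have r2 := sub_mul_nabla_pAt k i
  have r3 := sub_mul_nabla_delS_pAt k i
  have r4 := X_sq_mul_nabla_u k
  rw [← two_mul_pAt] at r4
  have l1 := pAt_lenard i
  have l2 := pAt_lenard k
  have e12 : nabla k ((1 - 2 * MvPowerSeries.C (u 0) * MvPowerSeries.X i ^ 2) * bAt i
        - MvPowerSeries.X i ^ 2 * delS (pAt i)) =
      (1 - 2 * MvPowerSeries.C (u 0) * MvPowerSeries.X i ^ 2) * nabla k (bAt i)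
        - 2 * MvPowerSeries.X i ^ 2 * bAt i * nabla k (MvPowerSeries.C (u 0))
        - MvPowerSeries.X i ^ 2 * nabla k (delS (pAt i)) := by
    rw [show (1 - 2 * MvPowerSeries.C (u 0) * MvPowerSeries.X i ^ 2) * bAt i
        - MvPowerSeries.X i ^ 2 * delS (pAt i) = bAt i
        - MvPowerSeries.X i ^ 2 * (MvPowerSeries.C (u 0) * bAt i)
        - MvPowerSeries.X i ^ 2 * (MvPowerSeries.C (u 0) * bAt i)
        - MvPowerSeries.X i ^ 2 * delS (pAt i) by ring, map_sub, map_sub, map_sub,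
      nabla_X_sq_mul, nabla_X_sq_mul, Derivation.leibniz, smul_eq_mul, smul_eq_mul]
    ring
  refine Matrix.ext fun x y => ?_
  fin_cases x <;> fin_cases y <;>
    simp only [lax, gauge, Matrix.mul_apply, Fin.sum_univ_two, Matrix.smul_apply, Matrix.add_apply,
      Matrix.sub_apply, Matrix.map_apply, smul_eq_mul, Matrix.of_apply, Matrix.cons_val',
      Matrix.cons_val_zero, Matrix.cons_val_one, Matrix.cons_val_fin_one, Fin.zero_eta,
      Fin.mk_one, Fin.isValue]
  · rw [map_sub, nabla_X, nabla_X_sq_mul]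
    linear_combination MvPowerSeries.X i ^ 2 * r2
  · rw [e12]
    -- The evolution of u₀ is known in the form ζₖ²∇ₖu₀ = ∂b(ζₖ²), hence the extra factor.
    refine mul_left_cancel₀ (X_sq_ne_zero k) ?_
    linear_combination
      (-MvPowerSeries.X k ^ 2 * (1 - 2 * MvPowerSeries.C (u 0) * MvPowerSeries.X i ^ 2)) * r1
      - 2 * MvPowerSeries.X i ^ 2 * bAt i * (MvPowerSeries.X k ^ 2 - MvPowerSeries.X i ^ 2) * r4
      + MvPowerSeries.X k ^ 2 * MvPowerSeries.X i ^ 2 * r3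
      - MvPowerSeries.X k ^ 2 * MvPowerSeries.X i ^ 2 * bAt k * l1
      + MvPowerSeries.X i ^ 2 * MvPowerSeries.X i ^ 2 * bAt i * l2
  · rw [nabla_X_sq_mul]
    linear_combination -MvPowerSeries.X i ^ 2 * r1
  · rw [map_add, nabla_X, nabla_X_sq_mul]
    linear_combination -MvPowerSeries.X i ^ 2 * r2

/-! ### The two-point series -/

theorem eq_of_delS_eq {f g : MvPowerSeries σ DiffPoly} (h : delS f = delS g)
    (hc : MvPowerSeries.map MvPolynomial.constantCoeff f =
      MvPowerSeries.map MvPolynomial.constantCoeff g) : f = g := by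
  ext1 m
  refine eq_of_del_eq ?_ ?_
  · exact congrArg (MvPowerSeries.coeff m) h
  · rw [← MvPowerSeries.coeff_map, ← MvPowerSeries.coeff_map, hc]

theorem map_constantCoeff_delS (f : MvPowerSeries σ DiffPoly) :
    MvPowerSeries.map MvPolynomial.constantCoeff (delS f) = 0 := by
  ext m
  rw [MvPowerSeries.coeff_map, coeff_coeffDer, constantCoeff_del, map_zero]

theorem map_constantCoeff_bAt (i : σ) :
    MvPowerSeries.map MvPolynomial.constantCoeff (bAt i) = 1 := by
  rw [eq_add_of_sub_eq (X_sq_mul_sumAt_b_succ i).symm, map_add, map_mul, map_map_sumAt]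
  simp only [MvPowerSeries.map_C, constantCoeff_b_succ, map_zero, sumAt_zero, mul_zero, map_one,
    zero_add]

theorem map_constantCoeff_corr_pair (i j : σ) :
    MvPowerSeries.map MvPolynomial.constantCoeff (corr [i, j]) = 0 := by
  rw [corr, map_map_sumAt]
  simp only [map_map_sumAt, MvPowerSeries.map_C, constantCoeff_scaledTau, map_zero, sumAt_zero]

/-- Both sides have the same ∂, by the evolution of b and the Lenard relations, and both vanish when
all uᵢ are zero: there the trace is (ζᵢ + ζⱼ)², which is where the correction term comes from. -/
theorem sub_sq_mul_corr_pair (i j : σ) :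
    (MvPowerSeries.X i ^ 2 - MvPowerSeries.X j ^ 2) ^ 2 * corr [i, j] =
      (lax j * lax i).trace - (MvPowerSeries.X i + MvPowerSeries.X j) ^ 2 := by
  have ht : (lax j * lax i).trace = 2 * MvPowerSeries.X i * MvPowerSeries.X j
      + 2 * (MvPowerSeries.X i ^ 2 * pAt i) * (MvPowerSeries.X j ^ 2 * pAt j)
      + ((1 - 2 * MvPowerSeries.C (u 0) * MvPowerSeries.X i ^ 2) * bAt i
        - MvPowerSeries.X i ^ 2 * delS (pAt i)) * (MvPowerSeries.X j ^ 2 * bAt j)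
      + ((1 - 2 * MvPowerSeries.C (u 0) * MvPowerSeries.X j ^ 2) * bAt j
        - MvPowerSeries.X j ^ 2 * delS (pAt j)) * (MvPowerSeries.X i ^ 2 * bAt i) := by
    simp only [lax, Matrix.trace_fin_two, Matrix.mul_apply, Fin.sum_univ_two, Matrix.of_apply,
      Matrix.cons_val', Matrix.cons_val_zero, Matrix.cons_val_one, Matrix.cons_val_fin_one]
    ring
  have hp : ∀ i : σ, MvPowerSeries.map MvPolynomial.constantCoeff (pAt i) = 0 := fun i => by
    rw [pAt, map_mul, map_constantCoeff_delS, mul_zero]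
  rw [ht]
  refine eq_of_delS_eq (mul_left_cancel₀ (X_sq_ne_zero j) ?_) ?_
  · have d2 : delS (2 : MvPowerSeries σ DiffPoly) = 0 := by exact_mod_cast (delS).map_natCast 2
    have d1 : delS (1 : MvPowerSeries σ DiffPoly) = 0 := Derivation.map_one_eq_zero _
    have hb : ∀ i : σ, delS (bAt i) = 2 * pAt i := fun i => (two_mul_pAt i).symm
    have h1 := X_sq_mul_delS_corr i j
    have h2 := sub_mul_nabla_bAt i j
    have l1 := pAt_lenard i
    have l2 := pAt_lenard j
    simp only [pow_two, delS_mul, map_sub, map_add, delS_X, delS_C, del_u, d1, d2, hb] at *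
    linear_combination
      (MvPowerSeries.X i * MvPowerSeries.X i - MvPowerSeries.X j * MvPowerSeries.X j)
        * (MvPowerSeries.X i * MvPowerSeries.X i - MvPowerSeries.X j * MvPowerSeries.X j) * h1
      + (MvPowerSeries.X j * MvPowerSeries.X j - MvPowerSeries.X i * MvPowerSeries.X i) * h2
      - MvPowerSeries.X j * MvPowerSeries.X j * MvPowerSeries.X j * MvPowerSeries.X j * bAt j * l1
      - MvPowerSeries.X j * MvPowerSeries.X j * MvPowerSeries.X i * MvPowerSeries.X i * bAt i * l2
  · simp only [map_mul, map_sub, map_add, map_pow, map_one, map_ofNat, MvPowerSeries.map_X,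
      MvPowerSeries.map_C, constantCoeff_u, map_constantCoeff_bAt, hp, map_constantCoeff_delS,
      map_constantCoeff_corr_pair, map_zero]
    ring

end Lax

/-! ### The `n`-point series -/

theorem X_sq_sub_X_sq_ne_zero {σ : Type*} {R : Type*} [CommRing R] [Nontrivial R] {i j : σ} (h : i ≠ j) :
    (MvPowerSeries.X i ^ 2 - MvPowerSeries.X j ^ 2 : MvPowerSeries σ R) ≠ 0 := fun e => by
  classical
  have h1 := congrArg (MvPowerSeries.coeff (Finsupp.single i 2)) e
  rw [map_sub, MvPowerSeries.coeff_X_pow, MvPowerSeries.coeff_X_pow, if_pos rfl, if_neg, sub_zero,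
    map_zero] at h1
  · exact one_ne_zero h1
  · intro hs
    have h2 := DFunLike.congr_fun hs i
    rw [Finsupp.single_eq_same, Finsupp.single_eq_of_ne h] at h2
    omega

theorem derivation_prod_X_sq_sub {σ : Type*} {S : Type*} [CommRing S] [Algebra ℚ S] (δ : Derivation ℚ S S)
    {x : σ → S} (hδ : ∀ i, δ (x i) = 0) (s : Finset (σ × σ)) :
    δ (∏ p ∈ s, (x p.1 ^ 2 - x p.2 ^ 2)) = 0 := by
  refine Finset.prod_induction _ (fun f => δ f = 0) (fun f g hf hg => ?_)
    (Derivation.map_one_eq_zero _) fun p _ => ?_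
  · rw [Derivation.leibniz, hf, hg, smul_zero, smul_zero, add_zero]
  · rw [map_sub, Derivation.leibniz_pow, Derivation.leibniz_pow, hδ, hδ]
    simp

theorem corr_cons {σ : Type*} (k : σ) {l : List σ} (h : 2 ≤ l.length) :
    corr (k :: l) = nabla k (corr l) := by
  match l, h with
  | _ :: _ :: _, _ => rfl

theorem isChain_ne_closed {σ : Type*} {a : σ} {l : List σ} (h : (a :: l).Nodup) (hl : l ≠ []) :
    List.IsChain (· ≠ ·) (a :: (l ++ [a])) := by
  rw [← List.cons_append]
  refine List.IsChain.append (List.Pairwise.isChain h) (List.isChain_singleton a) ?_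
  intro x hx y hy
  simp only [List.head?_cons, Option.mem_def, Option.some.injEq] at hy
  subst hy
  rw [List.getLast?_cons_of_ne_nil hl] at hx
  rintro rfl
  exact (List.nodup_cons.1 h).1 (List.mem_of_getLast? hx)

/-! ### Clearing the denominators ζᵢ² - ζⱼ². -/

section Cofactor

variable {σ : Type*} [Fintype σ] [DecidableEq σ] {R : Type*} [CommRing R]

/-- The product of the differences `ζᵢ² - ζⱼ²` over all ordered pairs `i ≠ j`. -/
def discr (σ : Type*) [Fintype σ] [DecidableEq σ] (R : Type*) [CommRing R] : MvPowerSeries σ R :=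
  ∏ p ∈ (Finset.univ : Finset σ).offDiag, (MvPowerSeries.X p.1 ^ 2 - MvPowerSeries.X p.2 ^ 2)

/-- The quotient of `discr` by `ζᵢ² - ζⱼ²`. -/
def cofactor (i j : σ) : MvPowerSeries σ R :=
  ∏ p ∈ (Finset.univ : Finset σ).offDiag.erase (i, j),
    (MvPowerSeries.X p.1 ^ 2 - MvPowerSeries.X p.2 ^ 2)

theorem cofactor_mul {i j : σ} (h : i ≠ j) :
    cofactor i j * (MvPowerSeries.X i ^ 2 - MvPowerSeries.X j ^ 2) = discr σ R :=
  Finset.prod_erase_mul (Finset.univ : Finset σ).offDiag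
    (fun p => (MvPowerSeries.X p.1 ^ 2 - MvPowerSeries.X p.2 ^ 2 : MvPowerSeries σ R))
    (a := (i, j)) (by simp [h])

theorem discr_ne_zero [IsDomain R] : discr σ R ≠ 0 :=
  Finset.prod_ne_zero_iff.2 fun _ hp => X_sq_sub_X_sq_ne_zero (Finset.mem_offDiag.1 hp).2.2

theorem map_discr {R' : Type*} [CommRing R'] (f : R →+* R') :
    MvPowerSeries.map f (discr σ R) = discr σ R' := by
  simp only [discr, map_prod, map_sub, map_pow, MvPowerSeries.map_X]

theorem map_cofactor {R' : Type*} [CommRing R'] (f : R →+* R') (i j : σ) :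
    MvPowerSeries.map f (cofactor i j) = cofactor i j := by
  simp only [cofactor, map_prod, map_sub, map_pow, MvPowerSeries.map_X]

theorem cofactor_swap [IsDomain R] {i j : σ} (h : i ≠ j) :
    cofactor i j = -(cofactor j i : MvPowerSeries σ R) := by
  refine mul_right_cancel₀ (X_sq_sub_X_sq_ne_zero h) ?_
  rw [cofactor_mul h, ← cofactor_mul h.symm]
  ring

/-- After division by the square of the discriminant this is the partial fraction identity 1/(x-y) ·
(1/(z-y) + 1/(x-z)) = 1/((x-z)(z-y)) at the squares of the variables. -/
theorem cofactor_three_term [IsDomain R] {i j k : σ} (hij : i ≠ j) (hik : i ≠ k) (hjk : j ≠ k) :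
    cofactor i j * (cofactor k j + cofactor i k) =
      (cofactor i k * cofactor k j : MvPowerSeries σ R) := by
  refine mul_right_cancel₀ (X_sq_sub_X_sq_ne_zero hik) ?_
  refine mul_right_cancel₀ (X_sq_sub_X_sq_ne_zero hjk.symm) ?_
  have h1 := cofactor_mul (R := R) hik
  have h2 := cofactor_mul (R := R) hjk.symm
  have h3 := cofactor_mul (R := R) hij
  generalize (cofactor i j : MvPowerSeries σ R) = x at *
  generalize (cofactor i k : MvPowerSeries σ R) = y at *
  generalize (cofactor k j : MvPowerSeries σ R) = z at *
  linear_combination x * (MvPowerSeries.X i ^ 2 - MvPowerSeries.X k ^ 2) * h2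
    + x * (MvPowerSeries.X k ^ 2 - MvPowerSeries.X j ^ 2) * h1
    - y * (MvPowerSeries.X i ^ 2 - MvPowerSeries.X k ^ 2) * h2 - discr σ R * h1 + discr σ R * h3

end Cofactor

/-! ### The n-point series as a sum of traces over cyclic orders. -/

section NPoint

variable {σ : Type*} [Fintype σ] [DecidableEq σ]

theorem nabla_cofactor (k i j : σ) : nabla k (cofactor i j) = 0 :=
  derivation_prod_X_sq_sub _ (nabla_X k) _

theorem nabla_discr (k : σ) : nabla k (discr σ DiffPoly) = 0 :=
  derivation_prod_X_sq_sub _ (nabla_X k) _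

theorem discr_smul_nabla_lax {k i : σ} (h : i ≠ k) :
    discr σ DiffPoly • (lax i).map (nabla k) =
      (cofactor k i : MvPowerSeries σ DiffPoly) • (lax k * lax i - lax i * lax k)
        + discr σ DiffPoly • (gauge k * lax i - lax i * gauge k) := by
  rw [← cofactor_mul h.symm, mul_smul, mul_smul, nabla_lax, smul_add]

/-- The determinantal formula, with cleared denominators. -/
theorem discr_pow_mul_corr (l : List σ) {i a : σ} (h : (l ++ [i, a]).Nodup) :
    discr σ DiffPoly ^ (l.length + 2) * corr (l ++ [i, a]) =
      -((l ++ [i]).permutations'.map fun l' => (pathProd cofactor lax a l' a).trace).sum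
        - if l = [] then (cofactor i a * (MvPowerSeries.X i + MvPowerSeries.X a)) ^ 2 else 0 := by
  induction l with
  | nil =>
    have hia : i ≠ a := by simpa using h
    simp only [List.nil_append, List.permutations',
      List.flatMap_cons, List.flatMap_nil, List.permutations'Aux, List.append_nil, List.map_cons,
      List.map_nil, List.sum_cons, List.sum_nil, add_zero, pathProd, Matrix.mul_smul,
      Matrix.trace_smul, smul_eq_mul, List.length_nil, zero_add, if_true]
    have h1 := sub_sq_mul_corr_pair i a
    rw [← cofactor_mul (R := DiffPoly) hia]
    -- A closed path with two vertices carries both cofactors, of opposite sign; this explains the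
    -- minus sign in front of the sum.
    rw [cofactor_swap hia.symm]
    linear_combination cofactor i a ^ 2 * h1
  | cons k l ih =>
    rw [List.cons_append, List.nodup_cons] at h
    have e := congrArg (nabla k) (ih h.2)
    have hd : nabla k (discr σ DiffPoly ^ (l.length + 2) * corr (l ++ [i, a])) =
        discr σ DiffPoly ^ (l.length + 2) * nabla k (corr (l ++ [i, a])) := by
      rw [Derivation.leibniz, Derivation.leibniz_pow, nabla_discr]
      simp
    -- The two-point correction contains no uᵢ, so it dies under the first ∇ₖ and is absent for n ≥
    -- 3.
    have hz : nabla k (if l = [] then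
        (cofactor i a * (MvPowerSeries.X i + MvPowerSeries.X a)) ^ 2 else 0) = 0 := by
      split_ifs
      · rw [Derivation.leibniz_pow, Derivation.leibniz, nabla_cofactor, map_add, nabla_X, nabla_X]
        simp
      · exact map_zero _
    have hka : a ≠ k := fun h' => h.1 (by simp [h'])
    -- Inserting k in all places of all orderings is how `permutations'` enumerates the orderings of
    -- the longer list; a stays the fixed base point of the closed paths.
    have hmain : ∀ l' ∈ (l ++ [i]).permutations',
        discr σ DiffPoly * nabla k (pathProd cofactor lax a l' a).trace =
          ((List.permutations'Aux k l').map fun l' => (pathProd cofactor lax a l' a).trace).sum := by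
      intro l' hl'
      rw [List.mem_permutations'] at hl'
      have hperm : List.Perm (a :: l') (l ++ [i, a]) := by
        refine (List.Perm.cons a hl').trans ?_
        rw [show l ++ [i, a] = (l ++ [i]) ++ [a] by simp]
        exact (List.perm_append_singleton a (l ++ [i])).symm
      refine derivation_trace_pathProd (nabla k) (nabla_cofactor k)
        (fun i hi => cofactor_swap hi.symm) (fun i j hij hik hjk => cofactor_three_term hij hik hjk)
        (fun i hi => discr_smul_nabla_lax hi) hka (fun hk => h.1 ?_)
        (isChain_ne_closed (hperm.nodup_iff.2 h.2) ?_)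
      · exact hperm.subset (List.mem_cons_of_mem a hk)
      · rintro rfl
        simpa using hl'.length_eq
    rw [hd, map_sub, hz, sub_zero, map_neg, map_list_sum, List.map_map] at e
    rw [List.cons_append, corr_cons k (by simp), List.length_cons, if_neg (List.cons_ne_nil k l),
      sub_zero, show l.length + 1 + 2 = (l.length + 2) + 1 by ring, pow_succ', mul_assoc, e,
      List.cons_append, List.permutations',
      List.map_flatMap, mul_neg, ← List.sum_map_mul_left, List.flatMap_def, List.sum_flatten,
      List.map_map]
    congr 2
    exact List.map_congr_left hmain

end NPoint

/-! ### The resolvent at the initial data -/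

/-- The value at the initial data of the series `f(ζ²)`. -/
def evalSq (C : ℂ) : PowerSeries DiffPoly →+* PowerSeries ℂ :=
  (PowerSeries.substAlgHom (R := ℂ)
      (PowerSeries.HasSubst.X_pow (R := ℂ) two_ne_zero)).toRingHom.comp
    (PowerSeries.map (evalInit C : DiffPoly →+* ℂ))

theorem evalSq_apply (C : ℂ) (f : PowerSeries DiffPoly) : evalSq C f =
    PowerSeries.subst (PowerSeries.X ^ 2 : PowerSeries ℂ)
      (PowerSeries.map (evalInit C : DiffPoly →+* ℂ) f) := by
  change PowerSeries.substAlgHom (R := ℂ) (PowerSeries.HasSubst.X_pow (R := ℂ) two_ne_zero) _ = _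
  rw [PowerSeries.coe_substAlgHom]

theorem coeff_evalSq (C : ℂ) (f : PowerSeries DiffPoly) (k : ℕ) : PowerSeries.coeff k (evalSq C f) =
    if 2 ∣ k then evalInit C (PowerSeries.coeff (k / 2) f) else 0 := by
  rw [evalSq_apply, PowerSeries.coeff_subst_X_pow two_ne_zero, PowerSeries.coeff_map]
  rfl

theorem evalSq_X (C : ℂ) : evalSq C PowerSeries.X = PowerSeries.X ^ 2 := by
  rw [evalSq_apply, PowerSeries.map_X, PowerSeries.subst_X (PowerSeries.HasSubst.X_pow two_ne_zero)]

theorem evalSq_C (C : ℂ) (P : DiffPoly) :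
    evalSq C (PowerSeries.C P) = PowerSeries.C (evalInit C P) := by
  rw [evalSq_apply, PowerSeries.map_C, PowerSeries.subst_C]
  rfl

/-- The weight 2k of b_k is also the exponent of ζ attached to it, so ∂ becomes θ. A second ∂ acts
by 2k + 1, which gives θ² + θ in the next lemma. -/
theorem evalSq_delP_bSeries (C : ℂ) : evalSq C (delP bSeries) = theta (evalSq C bSeries) := by
  ext k
  rw [coeff_theta, coeff_evalSq, coeff_evalSq, coeff_delP]
  split_ifs with h
  · obtain ⟨n, rfl⟩ := h
    rw [Nat.mul_div_cancel_left n two_pos, bSeries, PowerSeries.coeff_mk, evalInit_del, euler_b,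
      map_mul, map_mul, map_ofNat, map_natCast, Nat.cast_mul, Nat.cast_ofNat]
  · rw [mul_zero]

theorem evalSq_delP_delP_bSeries (C : ℂ) : evalSq C (delP (delP bSeries)) =
    theta (theta (evalSq C bSeries)) + theta (evalSq C bSeries) := by
  ext k
  rw [map_add, ← evalSq_delP_bSeries, coeff_theta, coeff_evalSq, coeff_evalSq, coeff_delP]
  split_ifs with h
  · obtain ⟨n, rfl⟩ := h
    rw [Nat.mul_div_cancel_left n two_pos, coeff_delP, bSeries, PowerSeries.coeff_mk, evalInit_del,
      euler_del, euler_b, ← Nat.cast_ofNat, mul_assoc, del_natCast_mul, del_natCast_mul]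
    simp only [map_add, map_mul, map_natCast]
    push_cast
    ring
  · rw [mul_zero, zero_add]

/-- Subtracting the equations, 4(f + g)(f - g) equals ζ² times an expression linear in f - g, θ(f -
g) and θ²(f - g). So the order of vanishing of f - g can always be raised. -/
theorem eq_of_quadratic {c : ℂ} {f g : PowerSeries ℂ} (hf0 : PowerSeries.constantCoeff f = 1)
    (hg0 : PowerSeries.constantCoeff g = 1)
    (hf : 4 * (1 - 2 * PowerSeries.C c * PowerSeries.X ^ 2) * f ^ 2
      - 2 * PowerSeries.X ^ 2 * f * (theta (theta f) + theta f)
      + PowerSeries.X ^ 2 * theta f ^ 2 = 4)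
    (hg : 4 * (1 - 2 * PowerSeries.C c * PowerSeries.X ^ 2) * g ^ 2
      - 2 * PowerSeries.X ^ 2 * g * (theta (theta g) + theta g)
      + PowerSeries.X ^ 2 * theta g ^ 2 = 4) : f = g := by
  refine sub_eq_zero.1 (powerSeries_eq_zero_of_dvd (f := 4 * (f + g)) ?_ fun n hn => ?_)
  · rw [map_mul, map_add, hf0, hg0, map_ofNat]
    norm_num
  · have ht : ∀ h : PowerSeries ℂ, PowerSeries.X ^ n ∣ h → PowerSeries.X ^ n ∣ theta h := by
      intro h hh
      rw [PowerSeries.X_pow_dvd_iff] at hh ⊢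
      intro m hm
      rw [coeff_theta, hh m hm, mul_zero]
    have h1 := ht _ hn
    have h2 := ht _ h1
    have e : 4 * (f + g) * (f - g) = PowerSeries.X * (PowerSeries.X *
        ((f - g) * (8 * PowerSeries.C c * (f + g) + 2 * (theta (theta f) + theta f))
          + theta (f - g) * (2 * g - (theta f + theta g)) + theta (theta (f - g)) * (2 * g))) := by
      rw [map_sub, map_sub]
      linear_combination hf - hg
    rw [e, pow_succ']
    refine mul_dvd_mul_left _ (Dvd.dvd.mul_left ?_ _)
    exact dvd_add (dvd_add (hn.mul_right _) (h1.mul_right _)) (h2.mul_right _)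

/-- Modulo the two Schrödinger equations the left side is the square of the Wronskian, which equals
2. -/
theorem phi_mul_phiDual_quadratic {C α : ℂ} (hα : α ^ 2 = 1 / 4 - 2 * C) :
    4 * (1 - 2 * PowerSeries.C C * PowerSeries.X ^ 2) * (phi α * phiDual α) ^ 2
      - 2 * PowerSeries.X ^ 2 * (phi α * phiDual α)
        * (theta (theta (phi α * phiDual α)) + theta (phi α * phiDual α))
      + PowerSeries.X ^ 2 * theta (phi α * phiDual α) ^ 2 = 4 := by
  have h1 := theta_phi hα
  have h2 := theta_phiDual hα
  have h3 := wronskian_phi hα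
  simp only [theta_mul, map_add] at *
  linear_combination -2 * PowerSeries.X * (phi α * phiDual α) * (phiDual α * h1 + phi α * h2)
    + (2 * (phi α * phiDual α)
      + PowerSeries.X * (theta (phi α) * phiDual α - phi α * theta (phiDual α)) + 2) * h3

/-- The resolvent at the initial data is the product of the two wave amplitudes, because both have
constant term 1 and solve the same quadratic equation. This is the link between the correlators and
ψ, ψ*. -/
theorem evalSq_bSeries {C α : ℂ} (hα : α ^ 2 = 1 / 4 - 2 * C) :
    evalSq C bSeries = phi α * phiDual α := by
  refine eq_of_quadratic (c := C) ?_ ?_ ?_ (phi_mul_phiDual_quadratic hα)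
  · rw [← PowerSeries.coeff_zero_eq_constantCoeff_apply, coeff_evalSq, if_pos (dvd_zero 2), bSeries,
      PowerSeries.coeff_mk, Nat.zero_div, b_zero, map_one]
  · rw [map_mul, ← PowerSeries.coeff_zero_eq_constantCoeff_apply,
      ← PowerSeries.coeff_zero_eq_constantCoeff_apply, coeff_phi, coeff_phiDual, a_zero]
    norm_num
  · have h := congrArg (evalSq C) bSeries_quadratic
    simp only [map_add, map_sub, map_mul, map_pow, map_one, map_ofNat, evalSq_X, evalSq_C,
      evalSq_delP_bSeries, evalSq_delP_delP_bSeries, evalInit_u] at h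
    simpa using h

/-! ### The Lax matrices at the initial data -/

section Eval

variable {σ : Type*}

/-- The series `f(ζᵢ)`. -/
def atVar {R : Type*} [CommRing R] (i : σ) : PowerSeries R →+* MvPowerSeries σ R :=
  (PowerSeries.substAlgHom (R := R) (PowerSeries.HasSubst.X i)).toRingHom

theorem atVar_apply {R : Type*} [CommRing R] (i : σ) (f : PowerSeries R) :
    atVar i f = PowerSeries.subst (MvPowerSeries.X i : MvPowerSeries σ R) f := by
  change PowerSeries.substAlgHom (R := R) (PowerSeries.HasSubst.X i) f = _
  rw [PowerSeries.coe_substAlgHom]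

theorem atVar_X {R : Type*} [CommRing R] (i : σ) :
    atVar i (PowerSeries.X : PowerSeries R) = MvPowerSeries.X i := by
  rw [atVar_apply, PowerSeries.subst_X (PowerSeries.HasSubst.X i)]

theorem atVar_C {R : Type*} [CommRing R] (i : σ) (r : R) :
    atVar i (PowerSeries.C r) = MvPowerSeries.C r := by
  rw [atVar_apply, PowerSeries.subst_C]

theorem map_evalInit_atSq (C : ℂ) (i : σ) (f : PowerSeries DiffPoly) :
    MvPowerSeries.map (evalInit C : DiffPoly →+* ℂ) (atSq i f) = atVar i (evalSq C f) := by
  rw [map_atSq, atSq_apply, evalSq_apply, atVar_apply,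
    PowerSeries.subst_comp_subst_apply (PowerSeries.HasSubst.X_pow two_ne_zero)
      (PowerSeries.HasSubst.X i), PowerSeries.subst_pow (PowerSeries.HasSubst.X i),
    PowerSeries.subst_X (PowerSeries.HasSubst.X i)]

/-- The amplitude of `z⁻¹ ∂ₓ ψ` at `x = 0`. -/
def chi (α : ℂ) : PowerSeries ℂ := phi α + PowerSeries.X * theta (phi α)

/-- The amplitude of `z⁻¹ ∂ₓ ψ*` at `x = 0`. -/
def chiDual (α : ℂ) : PowerSeries ℂ := -phiDual α + PowerSeries.X * theta (phiDual α)

/-- The vector `ζ (ψ, ∂ₓ ψ)` at `x = 0`. -/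
def waveVec (α : ℂ) (i : σ) : Fin 2 → MvPowerSeries σ ℂ :=
  ![atVar i (PowerSeries.X * phi α), atVar i (chi α)]

/-- The vector `ζ (-∂ₓ ψ*, ψ*)` at `x = 0`. -/
def waveVecDual (α : ℂ) (i : σ) : Fin 2 → MvPowerSeries σ ℂ :=
  ![-atVar i (chiDual α), atVar i (PowerSeries.X * phiDual α)]

/-- At the initial data the Lax matrix has rank one. -/
theorem map_evalInit_lax {C α : ℂ} (hα : α ^ 2 = 1 / 4 - 2 * C) (i : σ) :
    (lax i).map (MvPowerSeries.map (evalInit C : DiffPoly →+* ℂ)) =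
      Matrix.vecMulVec (waveVecDual α i) (waveVec α i) := by
  have hb := map_evalInit_atSq C i bSeries
  have hb1 := map_evalInit_atSq C i (delP bSeries)
  have hb2 := map_evalInit_atSq C i (delP (delP bSeries))
  rw [evalSq_delP_delP_bSeries, evalSq_bSeries hα] at hb2
  rw [evalSq_delP_bSeries, evalSq_bSeries hα] at hb1
  rw [evalSq_bSeries hα] at hb
  have h1 := theta_phi hα
  have h2 := theta_phiDual hα
  have h3 := wronskian_phi hα
  have hh : (2 : PowerSeries ℂ) * PowerSeries.C (1 / 2) = 1 := by
    rw [← map_ofNat PowerSeries.C 2, ← map_mul]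
    norm_num
  have h20 : (2 : PowerSeries ℂ) ≠ 0 := fun h => by simp [h] at hh
  have hhalf : evalInit C (MvPolynomial.C (1 / 2)) = 1 / 2 := by
    rw [← MvPolynomial.algebraMap_eq, AlgHom.commutes]
    simp
  have hC : ∀ P : DiffPoly, MvPowerSeries.map (evalInit C : DiffPoly →+* ℂ)
      (MvPowerSeries.C P : MvPowerSeries σ DiffPoly) =
      atVar i (PowerSeries.C (evalInit C P)) := fun P => by
    rw [MvPowerSeries.map_C, atVar_C]
    rfl
  have hu : MvPowerSeries.map (evalInit C : DiffPoly →+* ℂ)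
      (MvPowerSeries.C (u 0) : MvPowerSeries σ DiffPoly) = atVar i (PowerSeries.C C) := by
    rw [hC, evalInit_u]
    simp
  have hp : MvPowerSeries.map (evalInit C : DiffPoly →+* ℂ) (pAt i) =
      atVar i (PowerSeries.C (1 / 2)) * atVar i (theta (phi α * phiDual α)) := by
    rw [pAt, map_mul, hC, hhalf, delS_bAt, hb1]
  have hq : MvPowerSeries.map (evalInit C : DiffPoly →+* ℂ) (delS (pAt i)) =
      atVar i (PowerSeries.C (1 / 2)) *
        atVar i (theta (theta (phi α * phiDual α)) + theta (phi α * phiDual α)) := by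
    rw [delS_pAt, map_mul, hC, hhalf, delS_delS_bAt, hb2]
  have hX : MvPowerSeries.map (evalInit C : DiffPoly →+* ℂ) (MvPowerSeries.X i) =
      atVar i PowerSeries.X := by
    rw [MvPowerSeries.map_X, atVar_X]
  have hB : MvPowerSeries.map (evalInit C : DiffPoly →+* ℂ) (bAt i) =
      atVar i (phi α * phiDual α) := hb
  -- The diagonal entries are half the Wronskian relation plus or minus half of θ(φφ*). The upper
  -- right entry uses both Schrödinger equations; the lower left one is immediate.
  have e11 : PowerSeries.X - PowerSeries.X ^ 2 *
      (PowerSeries.C (1 / 2) * theta (phi α * phiDual α)) =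
      -chiDual α * (PowerSeries.X * phi α) := by
    refine mul_left_cancel₀ h20 ?_
    rw [chiDual, theta_mul]
    linear_combination -PowerSeries.X * h3 - PowerSeries.X ^ 2 *
      (theta (phi α) * phiDual α + phi α * theta (phiDual α)) * hh
  have e12 : (1 - 2 * PowerSeries.C C * PowerSeries.X ^ 2) * (phi α * phiDual α)
      - PowerSeries.X ^ 2 * (PowerSeries.C (1 / 2) *
        (theta (theta (phi α * phiDual α)) + theta (phi α * phiDual α))) =
      -chiDual α * chi α := by
    refine mul_left_cancel₀ h20 ?_
    rw [chiDual, chi]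
    simp only [theta_mul, map_add]
    linear_combination -PowerSeries.X * (phiDual α * h1 + phi α * h2)
      - PowerSeries.X ^ 2 * (theta (theta (phi α)) * phiDual α
        + 2 * theta (phi α) * theta (phiDual α) + phi α * theta (theta (phiDual α))
        + theta (phi α) * phiDual α + phi α * theta (phiDual α)) * hh
  have e21 : PowerSeries.X ^ 2 * (phi α * phiDual α) =
      PowerSeries.X * phiDual α * (PowerSeries.X * phi α) := by ring
  have e22 : PowerSeries.X + PowerSeries.X ^ 2 *
      (PowerSeries.C (1 / 2) * theta (phi α * phiDual α)) =
      PowerSeries.X * phiDual α * chi α := by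
    refine mul_left_cancel₀ h20 ?_
    rw [chi, theta_mul]
    linear_combination -PowerSeries.X * h3 + PowerSeries.X ^ 2 *
      (theta (phi α) * phiDual α + phi α * theta (phiDual α)) * hh
  replace e11 := congrArg (atVar i) e11
  replace e12 := congrArg (atVar i) e12
  replace e21 := congrArg (atVar i) e21
  replace e22 := congrArg (atVar i) e22
  refine Matrix.ext fun x y => ?_
  fin_cases x <;> fin_cases y <;>
    simp only [lax, waveVec, waveVecDual, Matrix.vecMulVec_apply, Matrix.map_apply,
      Matrix.of_apply, Matrix.cons_val', Matrix.cons_val_zero, Matrix.cons_val_one,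
      Matrix.cons_val_fin_one, Fin.zero_eta, Fin.mk_one, Fin.isValue, map_add, map_sub, map_mul,
      map_pow, map_neg, map_one, map_ofNat, hX, hu, hp, hq, hB] at e11 e12 e21 e22 ⊢
  exacts [e11, e12, e21, e22]

end Eval

/-! ### The kernel -/

theorem zeta_ne_zero {n : ℕ} (j : Fin n) : zeta j ≠ 0 := by
  rw [zeta]
  refine (map_ne_zero_iff _ (IsFractionRing.injective _ _)).2 fun h => ?_
  have h1 := congrArg (MvPowerSeries.coeff (Finsupp.single j 1)) h
  rw [MvPowerSeries.coeff_index_single_self_X, map_zero] at h1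
  exact one_ne_zero h1

/-- Makes evaluation of a Laurent series independent of how it is written as a power of ζ times a
power series; in particular the order used in `laurentAt` need not be computed. -/
theorem zpow_mul_atVar_eq {n : ℕ} (j : Fin n) {k m : ℤ} {p q : PowerSeries ℂ}
    (h : HahnSeries.single k (1 : ℂ) * HahnSeries.ofPowerSeries ℤ ℂ p =
      HahnSeries.single m (1 : ℂ) * HahnSeries.ofPowerSeries ℤ ℂ q) :
    zeta j ^ k * algebraMap _ (ZField n) (atVar j p) =
      zeta j ^ m * algebraMap _ (ZField n) (atVar j q) := by
  wlog hkm : k ≤ m generalizing k m p q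
  · exact (this h.symm (le_of_not_ge hkm)).symm
  obtain ⟨d, rfl⟩ := Int.le.dest hkm
  have h1 : p = PowerSeries.X ^ d * q := by
    refine HahnSeries.ofPowerSeries_injective (Γ := ℤ) ?_
    have h2 := congrArg (HahnSeries.single (-k) (1 : ℂ) * ·) h
    simp only [← mul_assoc, HahnSeries.single_mul_single] at h2
    rw [neg_add_cancel, neg_add_cancel_left, one_mul, ← HahnSeries.C_apply, map_one, one_mul] at h2
    rw [h2, map_mul, HahnSeries.ofPowerSeries_X_pow]
  rw [h1, map_mul, map_mul, map_pow, map_pow, atVar_X, zpow_add₀ (zeta_ne_zero j), zpow_natCast,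
    mul_assoc]
  rfl

theorem laurentAt_eq {n : ℕ} (j : Fin n) (k : ℤ) (p : PowerSeries ℂ) :
    laurentAt j (HahnSeries.single k (1 : ℂ) * HahnSeries.ofPowerSeries ℤ ℂ p) =
      zeta j ^ k * algebraMap _ (ZField n) (atVar j p) := by
  rw [laurentAt, ← atVar_apply]
  exact zpow_mul_atVar_eq j (LaurentSeries.single_order_mul_powerSeriesPart _)

theorem coeff_atZero (w : Amplitude) (k : ℤ) :
    (atZero w).coeff k = PowerSeries.constantCoeff (w.coeff k) := rfl

theorem constantCoeff_geom : PowerSeries.constantCoeff geom = 1 := by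
  rw [geom, PowerSeries.constantCoeff_inv]
  simp

theorem atZero_homSeries (f : PowerSeries ℂ) :
    atZero (HahnSeries.ofPowerSeries ℤ (PowerSeries ℂ) (homSeries f)) =
      HahnSeries.single 0 (1 : ℂ) * HahnSeries.ofPowerSeries ℤ ℂ f := by
  rw [← HahnSeries.C_apply, map_one, one_mul]
  ext k
  rw [coeff_atZero]
  rcases lt_or_ge k 0 with h | h
  · rw [coeff_ofPowerSeries_neg _ h, coeff_ofPowerSeries_neg _ h, map_zero]
  · obtain ⟨n, rfl⟩ := Int.eq_ofNat_of_zero_le h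
    rw [coeff_ofPowerSeries_natCast, coeff_ofPowerSeries_natCast, coeff_homSeries, map_mul, map_pow,
      constantCoeff_geom, PowerSeries.constantCoeff_C, one_pow, mul_one]

/-- At x = 0 the coefficient derivative of a homogeneous series is θ, and z = ζ⁻¹ is factored out in
front of both terms. -/
theorem atZero_dx_homSeries (ε : ℤ) (f : PowerSeries ℂ) :
    atZero (dx ε (HahnSeries.ofPowerSeries ℤ (PowerSeries ℂ) (homSeries f))) =
      HahnSeries.single (-1) (1 : ℂ) *
        HahnSeries.ofPowerSeries ℤ ℂ (ε • f + PowerSeries.X * theta f) := by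
  have hs : ∀ (g : LaurentSeries ℂ) (k : ℤ),
      (HahnSeries.single (-1) (1 : ℂ) * g).coeff k = g.coeff (k + 1) := fun g k => by
    have h := HahnSeries.coeff_single_mul_add (r := (1 : ℂ)) (x := g) (a := k + 1) (b := -1)
    rwa [one_mul, add_neg_cancel_right] at h
  ext k
  rw [hs, coeff_atZero, coeff_dx, map_add, map_zsmul, ← coeff_dAmp, coeff_derivative_homSeries,
    ← coeff_atZero, ← coeff_atZero, atZero_homSeries, ← HahnSeries.C_apply, map_one, one_mul,
    coeff_atZero]
  rcases lt_or_ge (k + 1) 0 with h | h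
  · rw [coeff_ofPowerSeries_neg _ h, coeff_ofPowerSeries_neg _ h,
      coeff_ofPowerSeries_neg _ (by omega), map_zero, smul_zero, zero_add]
  · obtain ⟨n, hn⟩ := Int.eq_ofNat_of_zero_le h
    rw [hn, coeff_ofPowerSeries_natCast, coeff_ofPowerSeries_natCast, map_add, map_zsmul]
    cases n with
    | zero =>
      rw [coeff_ofPowerSeries_neg _ (by omega), map_zero, PowerSeries.coeff_zero_X_mul]
      ring
    | succ n =>
      rw [show k = (n : ℤ) by push_cast at hn; omega, coeff_ofPowerSeries_natCast,
        PowerSeries.coeff_C_mul, coeff_homSeries, map_mul, map_mul, map_pow, constantCoeff_geom,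
        PowerSeries.constantCoeff_C, PowerSeries.coeff_succ_X_mul]
      ring

/-- The denominator is zⱼ² - zᵢ² = (ζᵢ² - ζⱼ²)/(ζᵢ²ζⱼ²), and each vector `waveVec`, `waveVecDual`
absorbs one ζ to become a power series. One factor ζᵢζⱼ is left, and the sign comes from the order
of the two products. -/
theorem kernelD_bgwPsi (α : ℂ) {n : ℕ} {i j : Fin n} (h : i ≠ j) :
    kernelD (bgwPsi α) (reflect (bgwPsi α)) i j =
      -(algebraMap (MvPowerSeries (Fin n) ℂ) (ZField n) (discr (Fin n) ℂ))⁻¹ * zeta i * zeta j *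
        algebraMap (MvPowerSeries (Fin n) ℂ) (ZField n) (cofactor i j * (waveVec α i ⬝ᵥ waveVecDual α j)) := by
  have hi := zeta_ne_zero i
  have hj := zeta_ne_zero j
  have hd : algebraMap (MvPowerSeries (Fin n) ℂ) (ZField n) (discr (Fin n) ℂ) =
      algebraMap (MvPowerSeries (Fin n) ℂ) (ZField n) (cofactor i j) * (zeta i ^ 2 - zeta j ^ 2) := by
    rw [← cofactor_mul h, map_mul, map_sub, map_pow, map_pow]
    rfl
  have hd0 : algebraMap (MvPowerSeries (Fin n) ℂ) (ZField n) (discr (Fin n) ℂ) ≠ 0 :=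
    (map_ne_zero_iff _ (IsFractionRing.injective _ _)).2 discr_ne_zero
  rw [hd] at hd0
  have hc := left_ne_zero_of_mul hd0
  have hz := right_ne_zero_of_mul hd0
  have hz' : zvar j ^ 2 - zvar i ^ 2 = (zeta i ^ 2 - zeta j ^ 2) / (zeta i ^ 2 * zeta j ^ 2) := by
    rw [zvar, zvar]
    field_simp
  rw [kernelD, reflect_bgwPsi, bgwPsi_eq, atZero_homSeries, atZero_homSeries, atZero_dx_homSeries,
    atZero_dx_homSeries, laurentAt_eq, laurentAt_eq, laurentAt_eq, laurentAt_eq, one_smul, neg_smul,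
    one_smul, ← chi, ← chiDual, hz', hd]
  simp only [waveVec, waveVecDual, dotProduct, Fin.sum_univ_two, Matrix.cons_val_zero,
    Matrix.cons_val_one, Matrix.cons_val_fin_one, map_mul, map_add, map_neg, atVar_X, zpow_zero,
    one_mul, zpow_neg, zpow_one]
  rw [show algebraMap (MvPowerSeries (Fin n) ℂ) (ZField n) (MvPowerSeries.X i) = zeta i from rfl,
    show algebraMap (MvPowerSeries (Fin n) ℂ) (ZField n) (MvPowerSeries.X j) = zeta j from rfl]
  field_simp
  ring

/-- Each inner vertex lies on two edges and contributes the square of its factor; the two ends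
contribute theirs once. On a closed path every vertex thus contributes a square. -/
theorem pathWeight_eq {σ R S : Type*} [CommRing R] [CommRing S] (f : R →+* S) {K : σ → σ → S}
    {κ : σ → σ → R} {t : S} {x : σ → S} (h : ∀ i j, i ≠ j → K i j = t * x i * x j * f (κ i j))
    (c : σ) (l : List σ) : ∀ a, List.IsChain (· ≠ ·) (a :: (l ++ [c])) →
    pathWeight K a l c =
      t ^ (l.length + 1) * (x a * x c * (l.map fun i => x i ^ 2).prod) * f (pathWeight κ a l c) := by
  induction l with
  | nil =>
    intro a ha
    rw [pathWeight, pathWeight, h a c (by simpa using ha)]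
    simp
    ring
  | cons b l ih =>
    intro a ha
    rw [List.cons_append, List.isChain_cons_cons] at ha
    rw [pathWeight, pathWeight, h a b ha.1, ih b ha.2, List.map_cons, List.prod_cons, map_mul,
      List.length_cons]
    ring

/-! ### The generating series of the correlators -/

theorem multiOmega_kdv (l : List ℕ) (h : 2 ≤ l.length) :
    multiOmega kdv tau l =
      ((l.map fun p => (((2 * p + 1)‼ : ℕ) : ℚ)).prod)⁻¹ • multiOmega flow scaledTau l := by
  induction l with
  | nil => simp at h
  | cons p l ih =>
    match l, h, ih with
    | [q], _, _ =>
      simp only [multiOmega, tau, List.map_cons, List.map_nil, List.prod_cons, List.prod_nil,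
        mul_one, mul_inv]
    | q :: r :: l, _, ih =>
      rw [multiOmega, ih (by simp), kdv_apply, Derivation.map_smul, smul_smul, multiOmega,
        List.map_cons (a := p), List.prod_cons, mul_inv]

theorem correlator_mul_prod {C : ℂ} {U : TimeSeries} (hU : IsBGWSolution kdv C U) {n : ℕ}
    (hn : 2 ≤ n) (p : Fin n → ℕ) :
    correlator kdv tau U p * ∏ j, (((2 * p j + 1)‼ : ℕ) : ℂ) =
      evalInit C (multiOmega flow scaledTau (List.ofFn p)) := by
  have h0 : (((List.ofFn p).map fun p => (((2 * p + 1)‼ : ℕ) : ℚ)).prod) =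
      ∏ j, (((2 * p j + 1)‼ : ℕ) : ℚ) := by
    rw [List.map_ofFn, List.prod_ofFn]
    rfl
  have h1 : (∏ j, (((2 * p j + 1)‼ : ℕ) : ℂ)) ≠ 0 :=
    Finset.prod_ne_zero_iff.2 fun j _ => Nat.cast_ne_zero.2 (Nat.doubleFactorial_pos _).ne'
  rw [correlator, constantCoeff_evalJet hU, multiOmega_kdv _ (by simpa using hn), map_smul, h0,
    Algebra.smul_def, map_inv₀, map_prod]
  simp only [map_natCast]
  field_simp

theorem generatingSeries_correlator {C : ℂ} {U : TimeSeries} (hU : IsBGWSolution kdv C U) {n : ℕ}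
    (hn : 2 ≤ n) :
    generatingSeries (fun p : Fin n → ℕ => correlator kdv tau U p) =
      (∏ j, MvPowerSeries.X j ^ 2) *
        MvPowerSeries.map (evalInit C : DiffPoly →+* ℂ) (corr (List.finRange n)) := by
  have hX : (∏ j : Fin n, (MvPowerSeries.X j : MvPowerSeries (Fin n) ℂ) ^ 2) =
      MvPowerSeries.monomial (Finsupp.equivFunOnFinite.symm fun _ => 2) 1 := by
    have h : ∀ s : Finset (Fin n), ∏ j ∈ s, (MvPowerSeries.X j : MvPowerSeries (Fin n) ℂ) ^ 2 =
        MvPowerSeries.monomial (∑ j ∈ s, Finsupp.single j 2) 1 := by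
      intro s
      induction s using Finset.induction_on with
      | empty => simp
      | insert j s hj ih =>
        rw [Finset.prod_insert hj, Finset.sum_insert hj, ih, MvPowerSeries.X_pow_eq,
          MvPowerSeries.monomial_mul_monomial, one_mul]
    rw [h]
    congr 2
    ext i
    simp [Finsupp.finsetSum_apply, Finsupp.single_apply]
  ext m
  rw [hX, MvPowerSeries.coeff_monomial_mul, one_mul, MvPowerSeries.coeff_map,
    coeff_corr (List.nodup_finRange n)]
  change (if _ then _ else _) = _
  -- The condition with truncated subtraction says that m j is even and at least 2; for m j = 0 it
  -- reads 0 = 2 and fails.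
  have hiff : (∀ j, m j = 2 * (m j / 2 - 1) + 2) ↔
      (Finsupp.equivFunOnFinite.symm fun _ : Fin n => 2) ≤ m ∧
        ((∀ x, Even ((m - (Finsupp.equivFunOnFinite.symm fun _ : Fin n => 2) : Fin n →₀ ℕ) x)) ∧
          ∀ x, x ∉ List.finRange n →
            (m - (Finsupp.equivFunOnFinite.symm fun _ : Fin n => 2) : Fin n →₀ ℕ) x = 0) := by
    simp only [Finsupp.le_def, Finsupp.tsub_apply, Finsupp.equivFunOnFinite_symm_apply_apply,
      List.mem_finRange, not_true_eq_false, false_imp_iff, implies_true, and_true]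
    rw [← forall_and]
    refine forall_congr' fun j => ?_
    rw [Nat.even_iff]
    omega
  have hmap : (List.finRange n).map (fun x =>
      (m - (Finsupp.equivFunOnFinite.symm fun _ : Fin n => 2) : Fin n →₀ ℕ) x / 2) =
      List.ofFn fun j => m j / 2 - 1 := by
    rw [List.ofFn_eq_map]
    refine List.map_congr_left fun j _ => ?_
    rw [Finsupp.tsub_apply, Finsupp.equivFunOnFinite_symm_apply_apply]
    omega
  rw [hmap]
  by_cases hm : ∀ j, m j = 2 * (m j / 2 - 1) + 2
  · have hm' := hiff.1 hm
    rw [if_pos hm, if_pos hm'.1, if_pos hm'.2, correlator_mul_prod hU hn]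
    rfl
  · rw [if_neg hm]
    by_cases h1 : (Finsupp.equivFunOnFinite.symm fun _ : Fin n => 2) ≤ m
    · rw [if_pos h1, if_neg fun h2 => hm (hiff.2 ⟨h1, h2⟩), map_zero]
    · rw [if_neg h1]

/-! ### Sums over cyclic orders -/

theorem pathWeight_ofFn {σ R : Type*} [CommRing R] (K : σ → σ → R) {m : ℕ} (g : Fin (m + 2) → σ) :
    pathWeight K (g 0) (List.ofFn fun i : Fin m => g i.castSucc.succ) (g (Fin.last (m + 1))) =
      ∏ i : Fin (m + 1), K (g i.castSucc) (g i.succ) := by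
  induction m with
  | zero => simp [pathWeight]
  | succ m ih =>
    rw [List.ofFn_succ, pathWeight, Fin.prod_univ_succ]
    congr 1
    exact ih fun i => g i.succ

theorem exists_finRotate_pow_apply_zero {m : ℕ} (i : Fin (m + 1)) :
    ∃ j : ℕ, (finRotate (m + 1) ^ j) 0 = i := by
  induction i using Fin.induction with
  | zero => exact ⟨0, rfl⟩
  | succ i ih =>
    obtain ⟨j, hj⟩ := ih
    refine ⟨j + 1, ?_⟩
    rw [pow_succ', Equiv.Perm.mul_apply, hj, finRotate_apply, Fin.coeSucc_eq_succ]

/-- Every cyclic order of `Fin (m + 1)` is represented by a unique permutation that starts at a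
given element. -/
theorem bijective_mk_cyclicSubgroup {m : ℕ} (a : Fin (m + 1)) : Function.Bijective
    fun σ : {σ : Equiv.Perm (Fin (m + 1)) // σ 0 = a} =>
      (QuotientGroup.mk σ.1 : Equiv.Perm (Fin (m + 1)) ⧸ cyclicSubgroup (m + 1)) := by
  constructor
  · rintro ⟨σ, hσ⟩ ⟨τ, hτ⟩ h
    obtain ⟨k, hk⟩ := QuotientGroup.eq.1 h
    have h0 : (finRotate (m + 1) ^ k) 0 = 0 := by
      change finRotate (m + 1) ^ k = σ⁻¹ * τ at hk
      rw [hk, Equiv.Perm.mul_apply, hτ, ← hσ]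
      exact σ.symm_apply_apply 0
    have h1 : finRotate (m + 1) ^ k = 1 := by
      refine Equiv.ext fun i => ?_
      obtain ⟨j, rfl⟩ := exists_finRotate_pow_apply_zero i
      rw [← Equiv.Perm.mul_apply, ← zpow_natCast, ← zpow_add, add_comm k, zpow_add,
        Equiv.Perm.mul_apply, h0, Equiv.Perm.one_apply]
    refine Subtype.ext ?_
    change finRotate (m + 1) ^ k = σ⁻¹ * τ at hk
    rw [h1] at hk
    exact inv_mul_eq_one.1 hk.symm
  · intro q
    obtain ⟨σ, rfl⟩ := QuotientGroup.mk_surjective q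
    -- The representative is rotated until it starts at a.
    obtain ⟨j, hj⟩ := exists_finRotate_pow_apply_zero (σ⁻¹ a)
    refine ⟨⟨σ * finRotate (m + 1) ^ j, ?_⟩, ?_⟩
    · rw [Equiv.Perm.mul_apply, hj]
      exact σ.apply_symm_apply a
    · refine (QuotientGroup.eq.2 ?_).symm
      rw [inv_mul_cancel_left]
      exact ⟨j, zpow_natCast _ _⟩

/-- Appending σ(0) to the sequence of values turns the cyclic product into the weight of a closed
path; the wrap-around of `finRotate` is its last edge. -/
theorem cyclicProd_eq_pathWeight {m : ℕ} {R : Type} [CommRing R]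
    (K : Fin (m + 1) → Fin (m + 1) → R) (σ : Equiv.Perm (Fin (m + 1))) :
    cyclicProd K σ = pathWeight K (σ 0) (List.ofFn fun i : Fin m => σ i.succ) (σ 0) := by
  have h := pathWeight_ofFn K (Fin.snoc (α := fun _ => Fin (m + 1)) σ (σ 0))
  have e0 : (Fin.snoc (α := fun _ => Fin (m + 1)) σ (σ 0) : Fin (m + 2) → Fin (m + 1)) 0 = σ 0 :=
    Fin.snoc_castSucc (α := fun _ => Fin (m + 1)) (σ 0) σ 0
  simp only [e0, Fin.snoc_last, Fin.succ_castSucc, Fin.snoc_castSucc] at h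
  rw [h, cyclicProd]
  refine Finset.prod_congr rfl fun i _ => ?_
  congr 1
  refine Fin.lastCases ?_ (fun j => ?_) i
  · rw [finRotate_last, Fin.succ_last, Fin.snoc_last]
  · rw [Fin.succ_castSucc, Fin.snoc_castSucc, finRotate_apply, Fin.coeSucc_eq_succ]

/-- A coset of the cyclic group has a unique member starting at a, and such members correspond to
orderings of the other vertices. -/
theorem cyclicSum_eq {m : ℕ} {R : Type} [CommRing R] (K : Fin (m + 1) → Fin (m + 1) → R)
    {a : Fin (m + 1)} {l : List (Fin (m + 1))} (hl : (a :: l).Nodup) (hall : ∀ x, x ∈ a :: l) :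
    cyclicSum K = (l.permutations'.map fun l' => pathWeight K a l' a).sum := by
  have hnd : l.permutations'.Nodup :=
    (List.permutations_perm_permutations' l).nodup_iff.1 (List.nodup_permutations l hl.of_cons)
  rw [cyclicSum, ← finsum_eq_of_bijective _ (bijective_mk_cyclicSubgroup a) fun _ => rfl,
    finsum_eq_sum_of_fintype, ← List.sum_toFinset _ hnd]
  refine Finset.sum_nbij (fun σ => List.ofFn fun i : Fin m => σ.1 i.succ) ?_ ?_ ?_ ?_
  · rintro ⟨σ, hσ⟩ _
    rw [List.mem_toFinset, List.mem_permutations', List.perm_ext_iff_of_nodup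
      (List.nodup_ofFn.2 fun i j h => Fin.succ_injective _ (σ.injective h)) hl.of_cons]
    intro x
    rw [List.mem_ofFn']
    constructor
    · rintro ⟨i, rfl⟩
      refine (List.mem_cons.1 (hall _)).resolve_left fun h => ?_
      exact Fin.succ_ne_zero i (σ.injective (h.trans hσ.symm))
    · intro hx
      obtain ⟨i, rfl⟩ := σ.surjective x
      rcases Fin.eq_zero_or_eq_succ i with rfl | ⟨j, rfl⟩
      · rw [hσ] at hx
        exact absurd hx (List.nodup_cons.1 hl).1
      · exact ⟨j, rfl⟩
  · rintro ⟨σ, hσ⟩ _ ⟨τ, hτ⟩ _ h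
    refine Subtype.ext (Equiv.ext fun i => ?_)
    rcases Fin.eq_zero_or_eq_succ i with rfl | ⟨j, rfl⟩
    · exact hσ.trans hτ.symm
    · exact congrFun (List.ofFn_injective h) j
  · intro l' hl'
    rw [Finset.mem_coe, List.mem_toFinset, List.mem_permutations'] at hl'
    have hp : (a :: l').Nodup := (hl'.cons a).nodup_iff.2 hl
    have hlen : l'.length = m := by
      have h1 := (hl'.cons a).length_eq
      have h2 : (a :: l).length = m + 1 := by
        have h3 : (a :: l).toFinset = Finset.univ := by
          ext x
          simpa using hall x
        rw [← List.toFinset_card_of_nodup hl, h3, Finset.card_univ, Fintype.card_fin]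
      simp only [List.length_cons] at h1 h2
      omega
    have hc : m + 1 = (a :: l').length := by rw [List.length_cons, hlen]
    refine ⟨⟨Equiv.ofBijective (fun i => (a :: l').get (Fin.cast hc i))
      (Finite.injective_iff_bijective.1
        ((List.nodup_iff_injective_get.1 hp).comp (Fin.cast_injective hc))), rfl⟩,
      Finset.mem_coe.2 (Finset.mem_univ _), ?_⟩
    refine List.ext_getElem (by simp [hlen]) fun i h1 h2 => ?_
    simp
  · rintro ⟨σ, hσ⟩ _
    subst hσ
    exact cyclicProd_eq_pathWeight K σ

/-! ### The `n`-point function -/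

theorem exists_finRange_eq_append (n : ℕ) (hn : 2 ≤ n) :
    ∃ (l : List (Fin n)) (i a : Fin n), List.finRange n = l ++ [i, a] ∧ (l = [] ↔ n = 2) ∧
      (n = 2 → (i : ℕ) = 0 ∧ (a : ℕ) = 1) := by
  obtain ⟨k, rfl⟩ := Nat.exists_eq_add_of_le' hn
  refine ⟨(List.finRange k).map fun i => i.castSucc.castSucc, (Fin.last k).castSucc,
    Fin.last (k + 1), ?_, ?_, ?_⟩
  · rw [List.finRange_succ_last, List.finRange_succ_last]
    simp
  · simp
  · intro h
    obtain rfl : k = 0 := by omega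
    exact ⟨rfl, rfl⟩

theorem algebraMap_generatingSeries {C α : ℂ} (hα : α ^ 2 = 1 / 4 - 2 * C) {U : TimeSeries}
    (hU : IsBGWSolution kdv C U) {n : ℕ} (hn : 2 ≤ n) {i₀ i₁ : Fin n}
    (h₀ : (i₀ : ℕ) = 0) (h₁ : (i₁ : ℕ) = 1) :
    algebraMap (MvPowerSeries (Fin n) ℂ) (ZField n)
        (generatingSeries fun p : Fin n → ℕ => correlator kdv tau U p) =
      (-1) ^ (n - 1) *
          cyclicSum (fun i j : Fin n => kernelD (bgwPsi α) (reflect (bgwPsi α)) i j)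
        - (if n = 2 then 1 / (zvar i₀ - zvar i₁) ^ 2 else 0) := by
  obtain ⟨l, i, a, hfin, hl, h2⟩ := exists_finRange_eq_append n hn
  have hnd : (l ++ [i, a]).Nodup := hfin ▸ List.nodup_finRange n
  have hlen : l.length + 2 = n := by
    have h := congrArg List.length hfin
    rw [List.length_finRange] at h
    simpa using h.symm
  have hperm : List.Perm (a :: (l ++ [i])) (List.finRange n) := by
    rw [hfin, show l ++ [i, a] = (l ++ [i]) ++ [a] by simp]
    exact (List.perm_append_singleton a (l ++ [i])).symm
  have hcyc : cyclicSum (fun i j : Fin n => kernelD (bgwPsi α) (reflect (bgwPsi α)) i j) =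
      ((l ++ [i]).permutations'.map fun l' => pathWeight
        (fun i j : Fin n => kernelD (bgwPsi α) (reflect (bgwPsi α)) i j) a l' a).sum := by
    obtain ⟨m, rfl⟩ : ∃ m, n = m + 1 := ⟨n - 1, by omega⟩
    exact cyclicSum_eq _ (hperm.nodup_iff.2 (List.nodup_finRange _))
      fun x => hperm.mem_iff.2 (List.mem_finRange x)
  set f := algebraMap (MvPowerSeries (Fin n) ℂ) (ZField n) with hf
  set Δ := f (discr (Fin n) ℂ) with hΔ
  have hΔ0 : Δ ≠ 0 := (map_ne_zero_iff _ (IsFractionRing.injective _ _)).2 discr_ne_zero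
  set κ : Fin n → Fin n → MvPowerSeries (Fin n) ℂ := fun i j =>
    cofactor i j * (waveVec α i ⬝ᵥ waveVecDual α j) with hκ
  -- A closed path through all n vertices has n edges and collects every ζⱼ², so the prefactor is
  -- the same for all cyclic orders.
  have hpath : ∀ l' ∈ (l ++ [i]).permutations', pathWeight
      (fun i j : Fin n => kernelD (bgwPsi α) (reflect (bgwPsi α)) i j) a l' a =
      (-Δ⁻¹) ^ n * (∏ j, zeta j ^ 2) * f (pathWeight κ a l' a) := by
    intro l' hl'
    rw [List.mem_permutations'] at hl'
    have hp := (hl'.cons a).trans hperm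
    rw [pathWeight_eq f (fun i j hij => kernelD_bgwPsi α hij) a l' a
      (isChain_ne_closed (hp.nodup_iff.2 (List.nodup_finRange n)) ?_)]
    · congr 2
      · congr 1
        have h := hp.length_eq
        rwa [List.length_cons, List.length_finRange] at h
      · rw [Fin.prod_univ_def, ← (hp.map _).prod_eq, List.map_cons, List.prod_cons, pow_two (zeta a)]
    · rintro rfl
      simpa using hl'.length_eq
  have hmain := congrArg (MvPowerSeries.map (evalInit C : DiffPoly →+* ℂ))
    (discr_pow_mul_corr l hnd)
  have htr : ∀ l' : List (Fin n), MvPowerSeries.map (evalInit C : DiffPoly →+* ℂ)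
      (pathProd cofactor lax a l' a).trace = pathWeight κ a l' a := by
    intro l'
    rw [AddMonoidHom.map_trace, map_pathProd]
    simp only [map_cofactor, map_evalInit_lax hα]
    exact trace_pathProd_vecMulVec _ _ _ _ _
  rw [map_mul, map_pow, map_discr, map_sub, map_neg, map_list_sum, List.map_map, hlen] at hmain
  simp only [Function.comp_def, htr] at hmain
  have hmain' := congrArg f hmain
  rw [map_mul, map_pow, map_sub, map_neg, map_list_sum, List.map_map, ← hΔ] at hmain'
  rw [generatingSeries_correlator hU hn, hfin, map_mul, hcyc, List.map_congr_left hpath,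
    List.sum_map_mul_left, map_prod]
  simp only [map_pow]
  -- The n signs of the kernels and the sign (-1)^{n-1} combine to the single minus of the trace
  -- formula.
  have hs : ((-1 : ZField n)) ^ (n - 1) * (-Δ⁻¹) ^ n = -(Δ ^ n)⁻¹ := by
    obtain ⟨m, rfl⟩ : ∃ m, n = m + 1 := ⟨n - 1, by omega⟩
    rw [Nat.add_sub_cancel, neg_pow Δ⁻¹, ← mul_assoc, ← pow_add,
      show m + (m + 1) = 2 * m + 1 by ring, pow_succ, pow_mul]
    simp
  -- For n = 2 the correction is matched by zᵢ - zₐ = (ζₐ - ζᵢ)/(ζᵢζₐ), where ζᵢ + ζₐ arises as (ζᵢ²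
  -- - ζₐ²)/(ζᵢ - ζₐ).
  have hr : (∏ j, zeta j ^ 2) * f (MvPowerSeries.map (evalInit C : DiffPoly →+* ℂ)
      (if l = [] then (cofactor i a * (MvPowerSeries.X i + MvPowerSeries.X a)) ^ 2 else 0)) =
      Δ ^ n * (if n = 2 then 1 / (zvar i₀ - zvar i₁) ^ 2 else 0) := by
    by_cases h : n = 2
    · rw [if_pos (hl.2 h), if_pos h]
      obtain ⟨h0, h1⟩ : i = i₀ ∧ a = i₁ :=
        ⟨Fin.ext ((h2 h).1.trans h₀.symm), Fin.ext ((h2 h).2.trans h₁.symm)⟩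
      have hia : i ≠ a := by
        rw [h0, h1]
        intro e
        rw [e, h₁] at h₀
        exact one_ne_zero h₀
      have hprod : ∏ j : Fin n, zeta j ^ 2 = zeta i ^ 2 * zeta a ^ 2 := by
        rw [Fin.prod_univ_def, hfin, hl.2 h]
        simp
      rw [hprod, ← h0, ← h1]
      have hd : Δ = f (cofactor i a) * (zeta i ^ 2 - zeta a ^ 2) := by
        rw [hΔ, ← cofactor_mul hia, map_mul, map_sub, map_pow, map_pow]
        rfl
      have hpow : ∀ x : ZField n, x ^ n = x ^ 2 := fun x => by simp only [h]
      have hi := zeta_ne_zero i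
      have ha := zeta_ne_zero a
      have hne : zeta i ^ 2 - zeta a ^ 2 ≠ 0 := fun e => hΔ0 (by rw [hd, e, mul_zero])
      have hne' : zeta a - zeta i ≠ 0 := fun e => hne (by linear_combination -(zeta a + zeta i) * e)
      rw [map_pow, map_mul, map_add, map_cofactor, MvPowerSeries.map_X, MvPowerSeries.map_X,
        map_pow, map_mul, map_add, show f (MvPowerSeries.X i) = zeta i from rfl,
        show f (MvPowerSeries.X a) = zeta a from rfl, hd, hpow, zvar, zvar,
        show (zeta i)⁻¹ - (zeta a)⁻¹ = (zeta a - zeta i) / (zeta i * zeta a) by field_simp]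
      field_simp
      ring
    · rw [if_neg (fun e => h (hl.1 e)), if_neg h, map_zero, map_zero, mul_zero, mul_zero]
  have hX : ∀ j : Fin n, f (MvPowerSeries.X j) = zeta j := fun _ => rfl
  simp only [hX]
  refine mul_left_cancel₀ (pow_ne_zero n hΔ0) ?_
  rw [mul_sub, ← hr, mul_left_comm, hmain', ← mul_assoc ((-1) ^ (n - 1)), ← mul_assoc ((-1) ^ (n - 1)),
    hs, ← mul_assoc, ← mul_assoc, mul_neg (Δ ^ n), mul_inv_cancel₀ (pow_ne_zero n hΔ0)]
  simp only [Function.comp_def]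
  ring

end KdV

end

theorem theorem7 (C α : ℂ) (hα : α ^ 2 = 1 / 4 - 2 * C) :
    -- the closed form of `aₖ(α)`, and `aₖ(α) ∈ ℚ[α²] = ℚ[C]`
    (∀ k : ℕ, KdV.a k α =
      (-1) ^ k / (k.factorial : ℂ) * ∏ j ∈ Finset.Icc 1 k, (C + (j.choose 2 : ℂ))) ∧
    (∀ k : ℕ, ∃ q : Polynomial ℚ, ∀ β : ℂ, KdV.a k β = Polynomial.aeval (β ^ 2) q) ∧
    (∀ k : ℕ, ∃ q : Polynomial ℚ, ∀ B β : ℂ, β ^ 2 = 1 / 4 - 2 * B →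
      KdV.a k β = Polynomial.aeval B q) ∧
    -- the pair of wave functions
    KdV.IsWavePair (KdV.bgwInitial C) (KdV.bgwPsi α) (KdV.reflect (KdV.bgwPsi α)) ∧
    -- the KdV derivations, the canonical tau-structure, the generalized BGW solution and its
    -- normalized tau-function exist
    (∃ (D : ℕ → Derivation ℚ KdV.DiffPoly KdV.DiffPoly) (Ω : ℕ → ℕ → KdV.DiffPoly)
        (U F : KdV.TimeSeries),
      KdV.IsKdVDerivations D ∧ KdV.IsCanonicalTauStructure D Ω ∧ KdV.IsBGWSolution D C U ∧
        KdV.IsLogTau Ω U F ∧ KdV.StringEquation C F) ∧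
    ∀ (D : ℕ → Derivation ℚ KdV.DiffPoly KdV.DiffPoly) (Ω : ℕ → ℕ → KdV.DiffPoly)
        (U : KdV.TimeSeries),
      KdV.IsKdVDerivations D → KdV.IsCanonicalTauStructure D Ω → KdV.IsBGWSolution D C U →
      -- the one-point correlators
      (∀ F : KdV.TimeSeries, KdV.IsLogTau Ω U F → KdV.StringEquation C F →
        ∀ k : ℕ, 1 ≤ k →
          KdV.a k α = (-1) ^ k * (2 * (k : ℂ) - 1) * KdV.onePoint F (k - 1)) ∧
      -- the `n`-point correlators
      (∀ (n : ℕ) (hn : 2 ≤ n),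
        algebraMap (MvPowerSeries (Fin n) ℂ) (KdV.ZField n)
            (KdV.generatingSeries (fun p : Fin n → ℕ => KdV.correlator D Ω U p)) =
          (-1) ^ (n - 1) *
              KdV.cyclicSum
                (fun i j : Fin n =>
                  KdV.kernelD (KdV.bgwPsi α) (KdV.reflect (KdV.bgwPsi α)) i j)
            - (if n = 2 then
                1 / (KdV.zvar (⟨0, by omega⟩ : Fin n) - KdV.zvar (⟨1, by omega⟩ : Fin n)) ^ 2
              else 0)) := by
  refine ⟨KdV.a_eq_prod hα, KdV.exists_polynomial_a_sq, KdV.exists_polynomial_a,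
    KdV.isWavePair_bgwPsi hα, ?_, ?_⟩
  · obtain ⟨F, hF, hs⟩ := KdV.exists_logTau C
    exact ⟨KdV.kdv, KdV.tau, KdV.flowSeries C (KdV.u 0), F, KdV.isKdVDerivations_kdv,
      KdV.isCanonicalTauStructure_tau, KdV.isBGWSolution_flowSeries C, hF, hs⟩
  · intro D Ω U hD hΩ hU
    -- Uniqueness reduces arbitrary derivations and tau-structures to the constructed ones. The
    -- solution U stays arbitrary, as its values at the origin depend on the initial data only.
    obtain rfl : D = KdV.kdv := KdV.isKdVDerivations_unique hD KdV.isKdVDerivations_kdv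
    obtain rfl : Ω = KdV.tau :=
      KdV.isCanonicalTauStructure_unique KdV.kdv_zero hΩ KdV.isCanonicalTauStructure_tau
    exact ⟨fun F hF hs k hk => KdV.a_eq_onePoint hα hU hF hs hk,
      fun n hn => KdV.algebraMap_generatingSeries hα hU hn rfl rfl⟩
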